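/- **Setting.** Let $n_G\ge 1$ and $n_L\ge1$ be the numbers of generators and loads, and let $i=0,\dots,n_c$ index the network states. Each generator $k$ has a finite nonempty set $\Theta_k\subset[0,\infty)$ of set-points and a set $\Lambda_k\subset\Theta_k\times\Theta_k$ of allowed transitions. Every $e=(l,m)\in\Lambda_k$ has a duration $\delta_{k,e}>0$, a cost $K_{k,e}\ge 0$ and a monotone ramp $\theta^T_{k,e}:[0,\delta_{k,e}]\to\mathbb R$ from $l$ to $m$; the ramps are Lipschitz with a common constant. Put $D_G=\prod_k[\min\Theta_k,\max\Theta_k]$. The operation modes are the elements of $\Gamma=\prod_k(\Theta_k\cup\Lambda_k)$, and $\Lambda(a)=\{(k,(l,m)):a_k=l,\ (l,m)\in\Lambda_k\}$. Set $\delta_{k,l}=0$ for $l\in\Theta_k$. Let $H(a)$ be the set of $r\in\mathbb R^{n_G}_+$ with $r_k=0$ if $a_k\in\Theta_k$ and $r_k\in[0,\delta_{k,a_k})$ if $a_k\in\Lambda_k$. Put $S(r)=\sum_k r_k$, $\varsigma(a)=\sum_k\delta_{k,a_k}$ and $N_T(a)=\#\{k:a_k\in\Lambda_k\}$. The production is $\zeta_k(a,r)=a_k$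 if $a_k\in\Theta_k$ and $\zeta_k(a,r)=\theta^T_{k,a_k}(r_k)$ otherwise. The feasible sets $G_i\subset\mathbb R^{n_G}\times\mathbb R^{n_L}_+$ are convex and compact. For all $p_G\in D_G$ and $p_D\in\mathbb R_+^{n_L}$ there is $z\ge0$ with $(p_G,p_D-z)\in G_i$; for every $p_G\in D_G$ there is $p_D\geq 0$ with $(p_G,p_D)\in\operatorname{int}G_i$; and $(p_G,p_D)\in G_i$, $0\le p_D'\le p_D$ imply $(p_G,p_D')\in G_i$. Let $c\in(0,\infty)^{n_L}$, let $q_i\ge0$ and let $C_G:D_G\to\mathbb R$ be continuous. With $x^+=\max(x,0)$ componentwise, the running cost is $$f(x,a,r)=C_G(\zeta(a,r))+\sum_{i=0}^{n_c} q_i\min\{c^\top z: z\ge0,\ (\zeta(a,r),x^+-z)\in G_i\}.$$ Let $W$ be an $n_L$-dimensional Brownian motion with continuous paths, $\gamma\ge0$, $\sigma\in\mathbb R^{n_L\times n_L}$ non-singular, and $m:[0,T]\to\mathbb R_+^{n_L}$ smooth and Lipschitz. Let $X^{t,x}_s=m(s)+Z_s$ for $s\in[t,T]$, where $dZ_s=-\gamma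 Z_s\,ds+\sigma\,dW_s$, $Z_t=x-m(t)$. Let $\mathcal F$ be the filtration generated by $X^{0,x_0}$ on $[0,T]$. **Problem 1.** Given $t\in[0,T]$, $a\in\Gamma$, $r\in H(a)$, the set $\mathcal V_{t,a,r}$ consists of the random finite sequences $v=(\tau_1,\dots,\tau_N;\beta_1,\dots,\beta_N)$ such that $t\le\tau_1\le\dots\le\tau_N\le T$ are $\mathcal F$-stopping times, strictly increasing among the requests that concern one and the same generator, $\beta_j$ is $\mathcal F_{\tau_j}$-measurable and $\beta_j\in\Lambda(\alpha(\tau_j^-))$. Here $\alpha$ is the mode process that starts in $a$ (with $\alpha(t^-)=a$), in which a generator is in the ordered transition during $[\tau_j,\tau_j+\delta_{\beta_j})$ and then steady at the target level until its next request, and a generator that starts in a transition completes it at time $t+\delta_{k,a_k}-r_k$. Let $\xi(s)\in H(\alpha(s))$ be the vector of times spent in the current transitions. Then $$V(t,x,a,r)=\inf_{v\in\mathcal V_{t,a,r}}\mathbb E\Big[\int_t^T f(X^{t,x}_s,\alpha(s),\xi(s))\,ds+\sum_{\tau_j\le T}K_{\beta_j}\Big].$$ **Problem LB.** Fix $\eta_L\in\mathbb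 R^{n_L}_+$ with Euclidean norm $1$ and vectors $\eta_G^1,\dots,\eta_G^{N_\eta}\in\mathbb R^{n_G}$, $N_\eta\ge1$. Let $d_{i,j}=\max\{(\eta^j_G)^\top p_G+\eta_L^\top p_D: p_G\in D_G,\ p_D\geq 0,\ (p_G,p_D)\in G_i\}$ and $$f_1^\eta(y,a,r)=C_G(\zeta(a,r))+\max_j\sum_{i=0}^{n_c} q_i\min\{c^\top z:z\ge0,\ (\eta_G^j)^\top\zeta(a,r)+y-\eta_L^\top z\le d_{i,j}\},$$ $$f_2^\eta(y,a,\rho)=\inf\{f_1^\eta(y,a,r):r\in H(a),\ S(r)=\rho\}.$$ Put $\sigma^\eta=\|\eta_L^\top\sigma\|$, $W^\eta=\eta_L^\top\sigma W/\sigma^\eta$, let $\mathcal F^\eta$ be the filtration generated by $W^\eta$, and let $X^{\eta,t,y}_s=\eta_L^\top m(s)+Z^\eta_s$, where $dZ^\eta_s=-\gamma Z^\eta_s\,ds+\sigma^\eta\,dW^\eta_s$, $Z^\eta_t=y-\eta_L^\top m(t)$. An admissible control in $\mathcal V^{\eta,R}_{t,a,w}$ consists of requests $(\tau_j,\beta_j)_{j\le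 N}$ as in Problem 1, with $\mathcal F^\eta$ in place of $\mathcal F$ and $\alpha^\eta$ in place of $\alpha$, and of $\mathcal F^\eta$-stopping times: execution times $\vartheta_j\ge\tau_j$ of the requests, $j\leq N$, and execution times $\vartheta^0_k\ge t$ of the transitions that are under way in mode $a$. The mode process $\alpha^\eta$ is defined like $\alpha$, with transitions completed at the execution times. It is required that, for all $s\in[t,T]$ and all $\omega$, $$0\le\rho(s)\le\varsigma(\alpha^\eta(s)),\qquad \rho(s)=w+\int_t^sN_T(\alpha^\eta(u))\,du-\sum_{k:\,a_k\in\Lambda_k,\ \vartheta^0_k\le s}\delta_{k,a_k}-\sum_{j:\,\vartheta_j\le s}\delta_{\beta_j}.$$ Then $$V^\eta(t,y,a,w)=\inf_{v\in\mathcal V^{\eta,R}_{t,a,w}}\mathbb E\Big[\int_t^T f^\eta_2(X^{\eta,t,y}_s,\alpha^\eta(s),\rho(s))\,ds+\sum_{\tau_j\le T}K_{\beta_j}\Big].$$ **Theorem.** For all $t\in[0,T]$, $x\in\mathbb R^{n_L}$, $a\in\Gamma$ and $r\in H(a)$, $$V^\eta(t,\eta_L^\top x,a,S(r))\le V(t,x,a,r).$$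 -/

import Mathlib

open MeasureTheory ProbabilityTheory Filter Topology Set
open scoped NNReal

noncomputable section

namespace Dispatch

/-! ### Ornstein–Uhlenbeck paths -/

/-- The solution on `[t, ∞)` of `dZ = -γ Z ds + dB`, `Z_t = z`, driven by the continuous path `B`.
The noise is additive, so the equation has a pathwise meaning; see `ouPath_eq_integral` and
`ouPath_unique`. -/
def ouPath {E : Type*} [NormedAddCommGroup E] [NormedSpace ℝ E]
    (γ t : ℝ) (z : E) (B : ℝ → E) (s : ℝ) : E :=
  Real.exp (-γ * (s - t)) • z + (B s - B t)
    - γ • ∫ u in t..s, Real.exp (-γ * (s - u)) • (B u - B t)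

section OU

variable {E : Type*} [NormedAddCommGroup E] [NormedSpace ℝ E] [CompleteSpace E]

theorem ouPath_sub_hasDerivAt (γ t : ℝ) (z : E) {B : ℝ → E} (hB : Continuous B) (s : ℝ) :
    HasDerivAt (fun s => ouPath γ t z B s - (B s - B t)) (-(γ • ouPath γ t z B s)) s := by
  have hI : HasDerivAt (fun s => ∫ u in t..s, Real.exp (γ * u) • (B u - B t))
      (Real.exp (γ * s) • (B s - B t)) s := by
    apply intervalIntegral.integral_hasDerivAt_right
    · exact (by fun_prop : Continuous _).intervalIntegrable _ _
    · exact (by fun_prop : Continuous _).stronglyMeasurableAtFilter _ _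
    · exact (by fun_prop : Continuous _).continuousAt
  have hrew : ∀ s, (∫ u in t..s, Real.exp (-γ * (s - u)) • (B u - B t))
      = Real.exp (-γ * s) • ∫ u in t..s, Real.exp (γ * u) • (B u - B t) := by
    intro s
    rw [← intervalIntegral.integral_smul]
    congr 1
    ext u
    rw [smul_smul, ← Real.exp_add]
    congr 2
    ring
  have hfun : (fun s => ouPath γ t z B s - (B s - B t))
      = fun s => Real.exp (-γ * (s - t)) • z
        - γ • (Real.exp (-γ * s) • ∫ u in t..s, Real.exp (γ * u) • (B u - B t)) := by
    ext s
    simp only [ouPath, hrew]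
    abel
  have he1 : HasDerivAt (fun s : ℝ => Real.exp (-γ * (s - t)))
      (Real.exp (-γ * (s - t)) * (-γ)) s := by
    have := (((hasDerivAt_id s).sub_const t).const_mul (-γ)).exp
    simpa using this
  have he2 : HasDerivAt (fun s : ℝ => Real.exp (-γ * s)) (Real.exp (-γ * s) * (-γ)) s := by
    have := ((hasDerivAt_id s).const_mul (-γ)).exp
    simpa using this
  rw [hfun]
  have := (he1.smul_const z).sub ((he2.smul hI).const_smul γ)
  refine this.congr_deriv ?_
  simp only [ouPath, hrew]
  have h1 : Real.exp (-γ * s) * Real.exp (γ * s) = 1 := by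
    rw [← Real.exp_add]; simp
  rw [smul_smul (Real.exp (-γ * s)) (Real.exp (γ * s)), h1]
  module

theorem ouPath_continuous (γ t : ℝ) (z : E) {B : ℝ → E} (hB : Continuous B) :
    Continuous (ouPath γ t z B) := by
  have h : Continuous (fun s => ouPath γ t z B s - (B s - B t)) :=
    continuous_iff_continuousAt.2 fun s => (ouPath_sub_hasDerivAt γ t z hB s).continuousAt
  have h2 := h.add (hB.sub (continuous_const (y := B t)))
  refine h2.congr fun s => ?_
  simp

/-- `ouPath` solves the integral form of the stochastic differential equation. -/
theorem ouPath_eq_integral (γ t : ℝ) (z : E) {B : ℝ → E} (hB : Continuous B) (s : ℝ) :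
    ouPath γ t z B s = z - γ • (∫ u in t..s, ouPath γ t z B u) + (B s - B t) := by
  have hc := ouPath_continuous γ t z hB
  have hF := intervalIntegral.integral_eq_sub_of_hasDerivAt
    (fun u _ => ouPath_sub_hasDerivAt γ t z hB u) (a := t) (b := s)
    ((by fun_prop : Continuous _).intervalIntegrable _ _)
  rw [intervalIntegral.integral_neg, intervalIntegral.integral_smul] at hF
  have h0 : ouPath γ t z B t = z := by simp [ouPath]
  rw [h0] at hF
  have : ouPath γ t z B s - (B s - B t) = z - γ • ∫ u in t..s, ouPath γ t z B u := by
    rw [sub_eq_add_neg z, hF]; simp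
  rw [← this]; abel

/-- `ouPath` is the only continuous solution on `[t, T]`. -/
theorem ouPath_unique (γ t T : ℝ) (z : E) {B Z : ℝ → E} (hB : Continuous B)
    (hZ : ContinuousOn Z (Icc t T))
    (hsol : ∀ s ∈ Icc t T, Z s = z - γ • (∫ u in t..s, Z u) + (B s - B t)) :
    ∀ s ∈ Icc t T, Z s = ouPath γ t z B s := by
  rcases lt_or_ge T t with hlt | hle
  · intro s hs
    exact absurd (hs.1.trans hs.2) (not_le.2 hlt)
  set Y : ℝ → E := fun u => Z (projIcc t T hle u) with hY
  have hYc : Continuous Y :=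
    (continuousOn_iff_continuous_domRestrict.1 hZ).comp continuous_projIcc
  have hYZ : ∀ s ∈ Icc t T, Y s = Z s := by
    intro s hs
    simp only [hY, projIcc_of_mem hle hs]
  have hc := ouPath_continuous γ t z hB
  set D : ℝ → E := fun s => -(γ • ∫ u in t..s, (Y u - ouPath γ t z B u)) with hD
  have hDeq : ∀ s ∈ Icc t T, Y s - ouPath γ t z B s = D s := by
    intro s hs
    have hint : (∫ u in t..s, Z u) = ∫ u in t..s, Y u := by
      apply intervalIntegral.integral_congr
      intro u hu
      rw [uIcc_of_le hs.1] at hu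
      exact (hYZ u ⟨hu.1, hu.2.trans hs.2⟩).symm
    rw [hYZ s hs, hsol s hs, ouPath_eq_integral γ t z hB s, hD, hint]
    simp only
    rw [intervalIntegral.integral_sub (hYc.intervalIntegrable _ _) (hc.intervalIntegrable _ _)]
    module
  have hder : ∀ s, HasDerivAt D (-(γ • (Y s - ouPath γ t z B s))) s := by
    intro s
    refine HasDerivAt.neg (HasDerivAt.const_smul γ ?_)
    apply intervalIntegral.integral_hasDerivAt_right
    · exact (hYc.sub hc).intervalIntegrable _ _
    · exact (hYc.sub hc).stronglyMeasurableAtFilter _ _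
    · exact (hYc.sub hc).continuousAt
  have hDc : Continuous D := continuous_iff_continuousAt.2 fun s => (hder s).continuousAt
  have hbound := norm_le_gronwallBound_of_norm_deriv_right_le (f := D)
    (f' := fun s => -(γ • (Y s - ouPath γ t z B s))) (δ := 0) (K := |γ|) (ε := 0)
    (a := t) (b := T) hDc.continuousOn (fun s _ => (hder s).hasDerivWithinAt)
    (by simp [hD])
    (fun s hs => by
      rw [norm_neg, norm_smul, hDeq s ⟨hs.1, hs.2.le⟩, Real.norm_eq_abs, add_zero])
  intro s hs
  have h0 := hbound s hs
  rw [gronwallBound_ε0_δ0] at h0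
  have h1 := hDeq s hs
  rw [norm_le_zero_iff.1 h0, hYZ s hs] at h1
  exact sub_eq_zero.1 h1

end OU

/-! ### Brownian motion -/

/-- An `n`-dimensional standard Brownian motion with continuous paths: the coordinates are
independent one-dimensional standard Brownian motions. -/
structure BrownianMotion (Ω : Type*) [MeasurableSpace Ω] (P : Measure Ω) (n : ℕ) where
  W : ℝ≥0 → Ω → Fin n → ℝ
  measurable' : ∀ s, Measurable (W s)
  start : ∀ ω, W 0 ω = 0
  continuous' : ∀ ω, Continuous fun s => W s ω
  isBrownian : ∀ j, IsBrownianReal (fun s ω => W s ω j) P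
  indep : iIndepFun (fun j ω => fun s => W s ω j) P

/-- The filtration `u ↦ σ(Y_s : 0 ≤ s ≤ u)`, `0 ≤ u ≤ T`, generated by a process on `[0, T]`. -/
def generatedFiltration {Ω E : Type*} [mΩ : MeasurableSpace Ω] [mE : MeasurableSpace E]
    (T : ℝ) (Y : ℝ → Ω → E) (hY : ∀ s, Measurable (Y s)) : Filtration ℝ mΩ where
  seq u := ⨆ s ∈ Icc 0 T ∩ Iic u, MeasurableSpace.comap (Y s) mE
  mono' _ _ huv := biSup_mono fun _ hs => ⟨hs.1, hs.2.trans huv⟩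
  le' _ := iSup₂_le fun s _ => (hY s).comap_le

theorem ouPath_measurable {Ω : Type*} [MeasurableSpace Ω] {n : ℕ} (γ t s : ℝ) (z : Fin n → ℝ)
    (B : ℝ → Ω → Fin n → ℝ) (hm : ∀ s, Measurable (B s)) (hc : ∀ ω, Continuous fun s => B s ω) :
    Measurable fun ω => ouPath γ t z (fun u => B u ω) s := by
  unfold ouPath
  have hjoint : Measurable (Function.uncurry fun (ω : Ω) (u : ℝ) =>
      Real.exp (-γ * (s - u)) • (B u ω - B t ω)) := by
    have h1 : Measurable (Function.uncurry fun (u : ℝ) (ω : Ω) => B u ω) :=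
      measurable_uncurry_of_continuous_of_measurable hc hm
    have h2 : Measurable fun p : Ω × ℝ => B p.2 p.1 := h1.comp measurable_swap
    have h3 : Measurable fun p : Ω × ℝ => B t p.1 := (hm t).comp measurable_fst
    have h4 : Measurable fun p : Ω × ℝ => Real.exp (-γ * (s - p.2)) := by fun_prop
    exact h4.smul (h2.sub h3)
  have hint : Measurable fun ω => ∫ u in t..s, Real.exp (-γ * (s - u)) • (B u ω - B t ω) := by
    simp only [intervalIntegral]
    exact (hjoint.stronglyMeasurable.integral_prod_right.measurable).sub
      (hjoint.stronglyMeasurable.integral_prod_right.measurable)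
  exact (measurable_const.add ((hm s).sub (hm t))).sub (hint.const_smul γ)

/-! ### The power system -/

/-- The state of one generator: steady production at level `l`, or a transition from level `l` to
level `m`. Production set-points are identified with their production levels. -/
inductive GenMode
  | steady (l : ℝ)
  | transit (l m : ℝ)

/-- A switching request: generator `gen` is to move from level `src` to level `dst`. -/
structure Switch (nG : ℕ) where
  gen : Fin nG
  src : ℝ
  dst : ℝ

/-- The data of the operator's problem with `nG` controllable generators, `nL` loads and
`nc` contingencies (index `0` being the intact network). -/
structure SystemData (nG nL nc : ℕ) where
  /-- time horizon -/
  T : ℝ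
  /-- production set-points of each generator -/
  Θ : Fin nG → Finset ℝ
  /-- allowed transitions of each generator -/
  Λ : Fin nG → Set (ℝ × ℝ)
  /-- duration of a transition -/
  δ : Fin nG → ℝ × ℝ → ℝ
  /-- production during a transition, as a function of the time spent in it -/
  θT : Fin nG → ℝ × ℝ → ℝ → ℝ
  /-- switching costs -/
  K : Fin nG → ℝ × ℝ → ℝ
  /-- running production cost -/
  CG : (Fin nG → ℝ) → ℝ
  /-- feasible sets of pairs (production, demand) -/
  G : Fin (nc + 1) → Set ((Fin nG → ℝ) × (Fin nL → ℝ))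
  /-- nodal costs of load disruption -/
  c : Fin nL → ℝ
  /-- weights of the network states -/
  q : Fin (nc + 1) → ℝ
  /-- demand forecast -/
  m : ℝ → Fin nL → ℝ
  /-- mean reversion of the forecast error -/
  γ : ℝ
  /-- volatility of the forecast error -/
  σ : Matrix (Fin nL) (Fin nL) ℝ
  /-- initial demand -/
  x₀ : Fin nL → ℝ

namespace SystemData

variable {nG nL nc : ℕ} (d : SystemData nG nL nc)

/-- The box of production vectors between the smallest and the largest set-points. -/
def DG : Set (Fin nG → ℝ) :=
  {p | ∀ k, (∃ l ∈ d.Θ k, l ≤ p k) ∧ ∃ u ∈ d.Θ k, p k ≤ u}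

/-- Standing assumptions on the data. -/
structure Valid : Prop where
  nG_pos : 0 < nG
  levels_nonempty : ∀ k, (d.Θ k).Nonempty
  levels_nonneg : ∀ k, ∀ l ∈ d.Θ k, 0 ≤ l
  allowed_subset : ∀ k, ∀ e ∈ d.Λ k, e.1 ∈ d.Θ k ∧ e.2 ∈ d.Θ k
  delay_pos : ∀ k, ∀ e ∈ d.Λ k, 0 < d.δ k e
  ramp_continuous : ∀ k, ∀ e ∈ d.Λ k, ContinuousOn (d.θT k e) (Icc 0 (d.δ k e))
  ramp_monotone : ∀ k, ∀ e ∈ d.Λ k,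
    MonotoneOn (d.θT k e) (Icc 0 (d.δ k e)) ∨ AntitoneOn (d.θT k e) (Icc 0 (d.δ k e))
  ramp_start : ∀ k, ∀ e ∈ d.Λ k, d.θT k e 0 = e.1
  ramp_end : ∀ k, ∀ e ∈ d.Λ k, d.θT k e (d.δ k e) = e.2
  ramp_rate : ∃ C > 0, ∀ k, ∀ e ∈ d.Λ k, ∀ s ∈ Icc 0 (d.δ k e), ∀ s' ∈ Icc 0 (d.δ k e),
    |d.θT k e s - d.θT k e s'| ≤ C * |s - s'|
  switchCost_nonneg : ∀ k, ∀ e ∈ d.Λ k, 0 ≤ d.K k e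
  prodCost_continuous : ContinuousOn d.CG d.DG
  shedPrice_pos : ∀ j, 0 < d.c j
  weight_nonneg : ∀ i, 0 ≤ d.q i
  feasible_demand_nonneg : ∀ i, ∀ p ∈ d.G i, 0 ≤ p.2
  feasible_convex : ∀ i, Convex ℝ (d.G i)
  feasible_compact : ∀ i, IsCompact (d.G i)
  feasible_shed : ∀ i, ∀ pG ∈ d.DG, ∀ pD : Fin nL → ℝ, 0 ≤ pD →
    ∃ z : Fin nL → ℝ, 0 ≤ z ∧ (pG, pD - z) ∈ d.G i
  feasible_interior : ∀ i, ∀ pG ∈ d.DG, ∃ pD : Fin nL → ℝ,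
    0 ≤ pD ∧ (pG, pD) ∈ interior (d.G i)
  feasible_down : ∀ i, ∀ p ∈ d.G i, ∀ pD : Fin nL → ℝ, 0 ≤ pD → pD ≤ p.2 →
    (p.1, pD) ∈ d.G i
  forecast_nonneg : ∀ s ∈ Icc 0 d.T, 0 ≤ d.m s
  forecast_smooth : ContDiffOn ℝ ((⊤ : ℕ∞) : WithTop ℕ∞) d.m (Icc 0 d.T)
  forecast_lipschitz : ∃ C > 0, ∀ s ∈ Icc 0 d.T, ∀ s' ∈ Icc 0 d.T,
    ‖d.m s - d.m s'‖ ≤ C * |s - s'|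
  reversion_nonneg : 0 ≤ d.γ
  volatility_nonsingular : IsUnit d.σ.det

/-- The set of operation modes. -/
def modes : Set (Fin nG → GenMode) :=
  {a | ∀ k, match a k with
    | .steady l => l ∈ d.Θ k
    | .transit l m => (l, m) ∈ d.Λ k}

/-- The switching requests that are admissible in operation mode `a`. -/
def allowed (a : Fin nG → GenMode) : Set (Switch nG) :=
  {b | a b.gen = .steady b.src ∧ (b.src, b.dst) ∈ d.Λ b.gen}

/-- The transition progression vectors that are possible in operation mode `a`. -/
def H (a : Fin nG → GenMode) : Set (Fin nG → ℝ) :=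
  {r | ∀ k, match a k with
    | .steady _ => r k = 0
    | .transit l m => 0 ≤ r k ∧ r k < d.δ k (l, m)}

/-- The production in operation mode `a` with transition progression `r`. -/
def production (a : Fin nG → GenMode) (r : Fin nG → ℝ) : Fin nG → ℝ := fun k =>
  match a k with
  | .steady l => l
  | .transit l m => d.θT k (l, m) (r k)

/-- Duration of the transition that a generator is in; zero in steady production. -/
def modeDelay (k : Fin nG) : GenMode → ℝ
  | .steady _ => 0
  | .transit l m => d.δ k (l, m)

/-- Sum of the durations of the transitions that are under way in mode `a`. -/
def totalDelay (a : Fin nG → GenMode) : ℝ := ∑ k, d.modeDelay k (a k)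

/-- Duration of the transition ordered by a request. -/
def delay (b : Switch nG) : ℝ := d.δ b.gen (b.src, b.dst)

/-- Cost of a request. -/
def switchCost (b : Switch nG) : ℝ := d.K b.gen (b.src, b.dst)

/-- Minimal cost of load disruption in network state `i`. -/
def shedCost (i : Fin (nc + 1)) (pG : Fin nG → ℝ) (pD : Fin nL → ℝ) : ℝ :=
  sInf ((fun z => d.c ⬝ᵥ z) '' {z | 0 ≤ z ∧ (pG, pD - z) ∈ d.G i})

/-- The running cost; the actual demand is the positive part of `x`. -/
def runCost (x : Fin nL → ℝ) (a : Fin nG → GenMode) (r : Fin nG → ℝ) : ℝ :=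
  d.CG (d.production a r) + ∑ i, d.q i * d.shedCost i (d.production a r) (x ⊔ 0)

end SystemData

/-- Number of generators in transition. -/
def numTransit {nG : ℕ} (a : Fin nG → GenMode) : ℝ :=
  ∑ k, match a k with
    | .steady _ => 0
    | .transit _ _ => 1

/-! ### Controls -/

/-- A random finite sequence of requests `β j` made at the times `τ j`, `j < N`. -/
structure Control (Ω : Type*) (nG : ℕ) where
  N : Ω → ℕ
  τ : ℕ → Ω → ℝ
  β : ℕ → Ω → Switch nG

/-- A control for the relaxed problem: it also has the times `ϑ j` at which the requested
transitions are completed, and the times `ϑ₀ k` at which the transitions that are under way at the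
beginning are completed (only relevant for generators `k` that start in transition). -/
structure ExecControl (Ω : Type*) (nG : ℕ) extends Control Ω nG where
  ϑ₀ : Fin nG → Ω → ℝ
  ϑ : ℕ → Ω → ℝ

/-- The `j`-th member of a random finite sequence of times of length `N`; it is `∞` if `N ≤ j`. -/
def timeOrTop {Ω : Type*} (N : Ω → ℕ) (τ : ℕ → Ω → ℝ) (j : ℕ) (ω : Ω) : WithTop ℝ :=
  if j < N ω then (τ j ω : WithTop ℝ) else ⊤

/-- Index of the last request that concerns generator `k` and is made at or before time `s`. -/
def Control.last {Ω : Type*} {nG : ℕ} (v : Control Ω nG) (k : Fin nG) (s : ℝ) (ω : Ω) :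
    WithBot ℕ :=
  ((Finset.range (v.N ω)).filter fun j => (v.β j ω).gen = k ∧ v.τ j ω ≤ s).max

/-- The operation mode at time `s`, starting in mode `a`. A generator is in transition from the
time of its last request until the corresponding execution time, and steady at the target level
from then on until its next request. -/
def ExecControl.mode {Ω : Type*} {nG : ℕ} (v : ExecControl Ω nG) (a : Fin nG → GenMode)
    (s : ℝ) (ω : Ω) : Fin nG → GenMode := fun k =>
  match v.last k s ω with
  | ⊥ =>
    match a k with
    | .steady l => .steady l
    | .transit l m => if s < v.ϑ₀ k ω then .transit l m else .steady m
  | (j : ℕ) =>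
    if s < v.ϑ j ω then .transit (v.β j ω).src (v.β j ω).dst else .steady (v.β j ω).dst

/-- The part of admissibility that the two problems share, for requests made in `[t, T]` under the
mode process `α`: the `τ j` are nondecreasing stopping times, strictly increasing for each
generator, `β j` is known at time `τ j`, and `β j` is allowed in the mode just before `τ j`. -/
structure Control.IsAdmissible {Ω : Type*} [mΩ : MeasurableSpace Ω] {nG nL nc : ℕ}
    (v : Control Ω nG) (d : SystemData nG nL nc) (𝓕 : Filtration ℝ mΩ)
    (α : ℝ → Ω → Fin nG → GenMode) (t : ℝ) : Prop where
  time_mem : ∀ ω j, j < v.N ω → v.τ j ω ∈ Icc t d.T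
  mono : ∀ ω i j, i ≤ j → j < v.N ω → v.τ i ω ≤ v.τ j ω
  strict : ∀ ω i j, i < j → j < v.N ω → (v.β i ω).gen = (v.β j ω).gen → v.τ i ω < v.τ j ω
  stopping : ∀ j, IsStoppingTime 𝓕 (timeOrTop v.N v.τ j)
  known : ∀ j b, MeasurableSet[(stopping j).measurableSpace] {ω | j < v.N ω ∧ v.β j ω = b}
  request : ∀ ω j, j < v.N ω → ∀ᶠ u in 𝓝[<] (v.τ j ω), v.β j ω ∈ d.allowed (α u ω)

/-! ### The operator's problem -/

section Original

variable {Ω : Type*} [mΩ : MeasurableSpace Ω] {P : Measure Ω} {nG nL nc : ℕ}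
  (d : SystemData nG nL nc) (B : BrownianMotion Ω P nL)

/-- The demand process started at time `t` from `x`: forecast plus forecast error `Z`, where
`dZ = -γ Z ds + σ dW` and `Z_t = x - m(t)`. -/
def demand (t : ℝ) (x : Fin nL → ℝ) (s : ℝ) (ω : Ω) : Fin nL → ℝ :=
  d.m s + ouPath d.γ t (x - d.m t) (fun u => d.σ.mulVec (B.W u.toNNReal ω)) s

theorem demand_measurable (t : ℝ) (x : Fin nL → ℝ) (s : ℝ) : Measurable (demand d B t x s) := by
  have hm : Continuous fun y : Fin nL → ℝ => d.σ.mulVec y :=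
    continuous_const.matrix_mulVec continuous_id
  refine measurable_const.add (ouPath_measurable d.γ t s _
    (fun u ω => d.σ.mulVec (B.W u.toNNReal ω)) (fun u => ?_) fun ω => ?_)
  · exact hm.measurable.comp (B.measurable' _)
  · exact hm.comp ((B.continuous' ω).comp continuous_real_toNNReal)

/-- The filtration generated by the demand process. -/
def demandFiltration : Filtration ℝ mΩ :=
  generatedFiltration d.T (demand d B 0 d.x₀) (demand_measurable d B 0 d.x₀)

/-- In the operator's problem a transition is completed when its duration has elapsed. -/
def Control.withDelays (v : Control Ω nG) (t : ℝ) (a : Fin nG → GenMode) (r : Fin nG → ℝ) :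
    ExecControl Ω nG where
  toControl := v
  ϑ₀ k _ := t - r k + d.modeDelay k (a k)
  ϑ j ω := v.τ j ω + d.delay (v.β j ω)

/-- The transition progression vector at time `s`, starting at time `t` from `a` and `r`. -/
def Control.progress (v : Control Ω nG) (t : ℝ) (a : Fin nG → GenMode) (r : Fin nG → ℝ)
    (s : ℝ) (ω : Ω) : Fin nG → ℝ := fun k =>
  match v.last k s ω with
  | ⊥ => if s < t - r k + d.modeDelay k (a k) then s - (t - r k) else 0
  | (j : ℕ) => if s < v.τ j ω + d.delay (v.β j ω) then s - v.τ j ω else 0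

/-- The admissible controls of the operator's problem, started at time `t` from `a` and `r`. -/
def admissible (t : ℝ) (a : Fin nG → GenMode) (r : Fin nG → ℝ) : Set (Control Ω nG) :=
  {v | v.IsAdmissible d (demandFiltration d B) ((v.withDelays d t a r).mode a) t}

/-- Sum of the costs of the requests made at or before `T`. -/
def Control.switchingCosts (v : Control Ω nG) (ω : Ω) : ℝ :=
  ∑ j ∈ Finset.range (v.N ω), if v.τ j ω ≤ d.T then d.switchCost (v.β j ω) else 0

/-- The expected cost-to-go. -/
def costToGo (t : ℝ) (x : Fin nL → ℝ) (a : Fin nG → GenMode) (r : Fin nG → ℝ)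
    (v : Control Ω nG) : ℝ :=
  ∫ ω, ((∫ s in t..d.T, d.runCost (demand d B t x s ω) ((v.withDelays d t a r).mode a s ω)
    (v.progress d t a r s ω)) + v.switchingCosts d ω) ∂P

/-- The value function of the operator's problem (the infimum is taken in `[-∞, ∞]`). -/
def value (t : ℝ) (x : Fin nL → ℝ) (a : Fin nG → GenMode) (r : Fin nG → ℝ) : EReal :=
  ⨅ v ∈ admissible d B t a r, (costToGo d B t x a r v : EReal)

end Original

/-! ### The lower bound problem -/

/-- The directions of the outer half-space approximations. -/
structure Directions (nG nL Nη : ℕ) where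
  ηL : Fin nL → ℝ
  ηG : Fin Nη → Fin nG → ℝ

/-- `ηL` is a componentwise nonnegative unit vector, and there is at least one direction `ηG`. -/
structure Directions.Valid {nG nL Nη : ℕ} (η : Directions nG nL Nη) : Prop where
  nonneg : 0 ≤ η.ηL
  normalized : ∑ j, η.ηL j ^ 2 = 1
  pos : 0 < Nη

section LowerBound

variable {Ω : Type*} [mΩ : MeasurableSpace Ω] {P : Measure Ω} {nG nL nc Nη : ℕ}
  (d : SystemData nG nL nc) (η : Directions nG nL Nη) (B : BrownianMotion Ω P nL)

/-- Level of the half-space with normal `(ηG j, ηL)` that supports the feasible set `i`. -/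
def supportLevel (i : Fin (nc + 1)) (j : Fin Nη) : ℝ :=
  sSup ((fun p : (Fin nG → ℝ) × (Fin nL → ℝ) => η.ηG j ⬝ᵥ p.1 + η.ηL ⬝ᵥ p.2) ''
    {p | p.1 ∈ d.DG ∧ 0 ≤ p.2 ∧ p ∈ d.G i})

/-- Minimal cost of load disruption for the half-space approximation, with projected production
`g` and projected demand `y`. -/
def shedCostη (i : Fin (nc + 1)) (j : Fin Nη) (g y : ℝ) : ℝ :=
  sInf ((fun z => d.c ⬝ᵥ z) '' {z | 0 ≤ z ∧ g + y - η.ηL ⬝ᵥ z ≤ supportLevel d η i j})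

/-- The running cost for the half-space approximations. -/
def runCostη₁ (y : ℝ) (a : Fin nG → GenMode) (r : Fin nG → ℝ) : ℝ :=
  d.CG (d.production a r) + ⨆ j, ∑ i, d.q i * shedCostη d η i j (η.ηG j ⬝ᵥ d.production a r) y

/-- The running cost as a function of the total transition progression. -/
def runCostη₂ (y : ℝ) (a : Fin nG → GenMode) (w : ℝ) : ℝ :=
  sInf (runCostη₁ d η y a '' {r | r ∈ d.H a ∧ ∑ k, r k = w})

/-- The volatility `‖ηLᵀ σ‖` (Euclidean norm) of the projected demand. -/
def volη : ℝ := Real.sqrt (∑ j, (Matrix.vecMul η.ηL d.σ) j ^ 2)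

/-- The Brownian motion that drives the projected demand. -/
def Wη (s : ℝ) (ω : Ω) : ℝ := (volη d η)⁻¹ * (η.ηL ⬝ᵥ d.σ.mulVec (B.W s.toNNReal ω))

theorem Wη_measurable (s : ℝ) : Measurable (Wη d η B s) := by
  have hm : Continuous fun y : Fin nL → ℝ => (volη d η)⁻¹ * (η.ηL ⬝ᵥ d.σ.mulVec y) := by
    have : Continuous fun y : Fin nL → ℝ => d.σ.mulVec y :=
      continuous_const.matrix_mulVec continuous_id
    exact continuous_const.mul (continuous_const.dotProduct this)
  exact hm.measurable.comp (B.measurable' _)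

/-- The filtration generated by `Wη`. -/
def filtrationη : Filtration ℝ mΩ :=
  generatedFiltration d.T (Wη d η B) (Wη_measurable d η B)

/-- The projected demand process started at time `t` from `y`. -/
def demandη (t y s : ℝ) (ω : Ω) : ℝ :=
  η.ηL ⬝ᵥ d.m s + ouPath d.γ t (y - η.ηL ⬝ᵥ d.m t) (fun u => volη d η * Wη d η B u ω) s

/-- The total transition progression at time `s`, starting at time `t` from mode `a` and total
progression `w`: it grows at a rate equal to the number of generators in transition and drops by
the duration of a transition when that transition is executed. -/
def ExecControl.total (v : ExecControl Ω nG) (t : ℝ) (a : Fin nG → GenMode) (w s : ℝ) (ω : Ω) :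
    ℝ :=
  w + (∫ u in t..s, numTransit (v.mode a u ω))
    - (∑ k, if t ≤ v.ϑ₀ k ω ∧ v.ϑ₀ k ω ≤ s then d.modeDelay k (a k) else 0)
    - ∑ j ∈ Finset.range (v.N ω),
        if t ≤ v.ϑ j ω ∧ v.ϑ j ω ≤ s then d.delay (v.β j ω) else 0

/-- The admissible controls of the lower bound problem, started at time `t` from mode `a` and total
progression `w`. -/
structure ExecControl.IsAdmissibleη (v : ExecControl Ω nG) (t : ℝ) (a : Fin nG → GenMode) (w : ℝ) :
    Prop where
  requests : v.toControl.IsAdmissible d (filtrationη d η B) (v.mode a) t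
  exec₀_ge : ∀ k l m, a k = .transit l m → ∀ ω, t ≤ v.ϑ₀ k ω
  exec₀_stopping : ∀ k l m, a k = .transit l m →
    IsStoppingTime (filtrationη d η B) fun ω => (v.ϑ₀ k ω : WithTop ℝ)
  exec_ge : ∀ ω j, j < v.N ω → v.τ j ω ≤ v.ϑ j ω
  exec_stopping : ∀ j, IsStoppingTime (filtrationη d η B) (timeOrTop v.N v.ϑ j)
  bounds : ∀ ω, ∀ s ∈ Icc t d.T,
    0 ≤ v.total d t a w s ω ∧ v.total d t a w s ω ≤ d.totalDelay (v.mode a s ω)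

/-- The expected cost-to-go of the lower bound problem. -/
def costToGoη (t y : ℝ) (a : Fin nG → GenMode) (w : ℝ) (v : ExecControl Ω nG) : ℝ :=
  ∫ ω, ((∫ s in t..d.T, runCostη₂ d η (demandη d η B t y s ω) (v.mode a s ω)
    (v.total d t a w s ω)) + v.switchingCosts d ω) ∂P

/-- The value function of the lower bound problem (the infimum is taken in `[-∞, ∞]`). -/
def valueη (t y : ℝ) (a : Fin nG → GenMode) (w : ℝ) : EReal :=
  ⨅ (v : ExecControl Ω nG) (_ : v.IsAdmissibleη d η B t a w),
    (costToGoη d η B t y a w v : EReal)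

end LowerBound

end Dispatch

end

/-! An admissible control of the operator's problem reacts to the whole Brownian motion, whereas the
relaxed problem only admits controls that react to the projection `Wη`. Two facts bridge the gap.

The first is pathwise. Executing every transition exactly when its duration has elapsed makes the
total progression equal to the sum of the individual ones (`total_eq`), so the relaxed constraint
holds. The slice infimum is at most the half-space cost of the actual production (`runCostη₂_le`).
The latter is at most the true cost, because a feasible set lies inside its supporting half-spaces
and `ηL ≥ 0` (`prodCostη_le_prodCost`).

The second is probabilistic. With the unit vector `e = projDir d η`, the Brownian path is `Wη • e`
plus a remainder, and the two are independent (`indepFun_proj`). The projected demand depends on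
`Wη` alone. If the remainder is frozen at a deterministic path `w`, a control becomes a functional
of `Wη`. The average over `w` of the resulting relaxed costs is the relaxed cost of the original
control, so some `w` does no worse than the average (`valueη_le_integral_listCost`).

Freezing replaces the Brownian path by `Wη • e + w`, which need not be a path of `B`, while
admissibility is demanded for every `ω` and for uncompleted filtrations. Controls are therefore
discretized first: requests are postponed to a grid, so that a control takes values in a countable
set of lists and extends to an adapted, everywhere admissible functional of arbitrary paths
(`exists_adapted_extension`).

Finally the mesh tends to zero. The production of the discretized controls converges for all but
finitely many times, switching costs do not increase, and `prodCostη` is continuous. Since costs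
grow at most linearly in the demand, dominated convergence applies (`valueη_le_costToGo`). The
passage from slice infima to `prodCostη` is made before the limit, as the latter is continuous in
the production. -/

namespace Dispatch

/-! ### Realizations of controls: admissibility in terms of completion times. -/

section Paths

variable {Ω : Type*} {nG nL nc : ℕ}

/-- One realization of an admissible control of the operator's problem, with the condition on
requests expressed through the times at which transitions are completed. -/
structure PathValid (d : SystemData nG nL nc) (t : ℝ) (a : Fin nG → GenMode) (r : Fin nG → ℝ)
    (N : ℕ) (τ : ℕ → ℝ) (β : ℕ → Switch nG) : Prop where
  time_mem : ∀ j < N, τ j ∈ Icc t d.T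
  mono : ∀ i j, i ≤ j → j < N → τ i ≤ τ j
  allowed : ∀ j < N, ((β j).src, (β j).dst) ∈ d.Λ (β j).gen
  next : ∀ i j, i < j → j < N → (β i).gen = (β j).gen →
    (∃ m, i < m ∧ m < j ∧ (β m).gen = (β j).gen) ∨
      ((β i).dst = (β j).src ∧ τ i + d.delay (β i) < τ j)
  first : ∀ j < N, (∃ i < j, (β i).gen = (β j).gen) ∨
    match a (β j).gen with
    | .steady l => l = (β j).src
    | .transit l m => m = (β j).src ∧ t - r (β j).gen + d.δ (β j).gen (l, m) < τ j

theorem Control.last_cases (v : Control Ω nG) (k : Fin nG) (s : ℝ) (ω : Ω) :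
    (v.last k s ω = ⊥ ∧ ∀ j < v.N ω, (v.β j ω).gen = k → s < v.τ j ω) ∨
    ∃ j : ℕ, v.last k s ω = j ∧ j < v.N ω ∧ (v.β j ω).gen = k ∧ v.τ j ω ≤ s ∧
      ∀ i < v.N ω, j < i → (v.β i ω).gen = k → s < v.τ i ω := by
  classical
  rcases h : v.last k s ω with _ | j
  · left
    refine ⟨rfl, fun j hj hk => ?_⟩
    by_contra! hc
    have : j ∈ ((Finset.range (v.N ω)).filter fun j => (v.β j ω).gen = k ∧ v.τ j ω ≤ s) := by
      simp [hj, hk, hc]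
    have h2 := Finset.max_eq_bot.1 h
    simp [h2] at this
  · right
    have hm := Finset.mem_of_max h
    simp only [Finset.mem_filter, Finset.mem_range] at hm
    refine ⟨j, rfl, hm.1, hm.2.1, hm.2.2, fun i hi hji hk => ?_⟩
    by_contra! hc
    have : i ≤ j := Finset.le_max_of_eq (by simp [hi, hk, hc]) h
    omega

theorem Control.last_eq_bot {v : Control Ω nG} {k : Fin nG} {s : ℝ} {ω : Ω}
    (h : ∀ j < v.N ω, (v.β j ω).gen = k → s < v.τ j ω) : v.last k s ω = ⊥ := by
  rcases v.last_cases k s ω with h' | ⟨j, -, hj, hk, hs, -⟩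
  · exact h'.1
  · exact absurd (h j hj hk) (not_lt.2 hs)

theorem Control.last_eq_coe {v : Control Ω nG} {k : Fin nG} {s : ℝ} {ω : Ω} {j : ℕ}
    (hj : j < v.N ω) (hk : (v.β j ω).gen = k) (hs : v.τ j ω ≤ s)
    (h : ∀ i < v.N ω, j < i → (v.β i ω).gen = k → s < v.τ i ω) : v.last k s ω = j := by
  rcases v.last_cases k s ω with ⟨-, h'⟩ | ⟨i, hi, hiN, hik, his, h'⟩
  · exact absurd (h' j hj hk) (not_lt.2 hs)
  · rcases lt_trichotomy i j with hij | rfl | hij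
    · exact absurd (h' j hj hij hk) (not_lt.2 hs)
    · exact hi
    · exact absurd (h i hiN hij hik) (not_lt.2 his)

theorem ExecControl.mode_of_last_bot {v : ExecControl Ω nG} {k : Fin nG} {s : ℝ} {ω : Ω}
    (h : v.last k s ω = ⊥) (a : Fin nG → GenMode) :
    v.mode a s ω k = match a k with
      | .steady l => .steady l
      | .transit l m => if s < v.ϑ₀ k ω then .transit l m else .steady m := by
  simp only [ExecControl.mode, h]

theorem ExecControl.mode_of_last_coe {v : ExecControl Ω nG} {k : Fin nG} {s : ℝ} {ω : Ω} {j : ℕ}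
    (h : v.last k s ω = j) (a : Fin nG → GenMode) :
    v.mode a s ω k =
      if s < v.ϑ j ω then .transit (v.β j ω).src (v.β j ω).dst else .steady (v.β j ω).dst := by
  simp only [ExecControl.mode, h]
  rfl

variable {d : SystemData nG nL nc} {t : ℝ} {a : Fin nG → GenMode} {r : Fin nG → ℝ}

namespace PathValid

variable {N : ℕ} {τ : ℕ → ℝ} {β : ℕ → Switch nG}

/-- A request is made only after the previous transitions of the generator are completed. -/
theorem completed_lt (h : PathValid d t a r N τ β) {i j : ℕ} (hij : i < j)
    (hj : j < N) (hk : (β i).gen = (β j).gen) : τ i + d.delay (β i) < τ j := by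
  induction j using Nat.strong_induction_on with
  | _ j ih =>
    rcases h.next i j hij hj hk with ⟨m, him, hmj, hm⟩ | h'
    · exact (ih m hmj him (hmj.trans hj) (hk.trans hm.symm)).trans_le (h.mono m j hmj.le hj)
    · exact h'.2

theorem delay_pos (h : PathValid d t a r N τ β) (hd : d.Valid) {j : ℕ} (hj : j < N) :
    0 < d.delay (β j) :=
  hd.delay_pos _ _ (h.allowed j hj)

/-- The first request for a generator waits for its initial transition, and later requests come
later still. For a steady generator progression and duration vanish, so the bound reduces to `t ≤ τ
j`. -/
theorem initial_completed_le (h : PathValid d t a r N τ β) (hr : r ∈ d.H a) {j : ℕ}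
    (hj : j < N) : t - r (β j).gen + d.modeDelay (β j).gen (a (β j).gen) ≤ τ j := by
  induction j using Nat.strong_induction_on with
  | _ j ih =>
    rcases h.first j hj with ⟨i, hij, hk⟩ | h'
    · have := ih i hij (hij.trans hj)
      rw [hk] at this
      exact this.trans (h.mono i j hij.le hj)
    · have hr' := hr (β j).gen
      rcases ha : a (β j).gen with l | ⟨l, m⟩
      · rw [ha] at hr'
        simp only at hr'
        simp [SystemData.modeDelay, hr', (h.time_mem j hj).1]
      · rw [ha] at h'
        exact h'.2.le

/-- Pigeonhole: two requests for one generator are more than `δ` apart, so the generator together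
with the `δ`-cell containing the request time determines the request. The bound does not depend on
the realization, which makes switching costs uniformly bounded. -/
theorem length_le (h : PathValid d t a r N τ β) {δ : ℝ} (hδ0 : 0 < δ)
    (hδ : ∀ k, ∀ e ∈ d.Λ k, δ ≤ d.δ k e) :
    N ≤ nG * (⌊(d.T - t) / δ⌋₊ + 1) := by
  set M := ⌊(d.T - t) / δ⌋₊
  have hle : ∀ j < N, ⌊(τ j - t) / δ⌋₊ < M + 1 := fun j hj => by
    refine Nat.lt_succ_of_le (Nat.floor_le_floor ?_)
    gcongr
    exact (h.time_mem j hj).2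
  let F : Fin N → Fin nG × Fin (M + 1) := fun j => ((β j).gen, ⟨⌊(τ j - t) / δ⌋₊, hle j j.2⟩)
  have key : ∀ i j : Fin N, i < j → F i ≠ F j := by
    intro i j hij hF
    simp only [F, Prod.mk.injEq, Fin.mk.injEq] at hF
    have h1 := h.completed_lt hij j.2 hF.1
    have h2 := hδ _ _ (h.allowed i i.2)
    have h3 := (h.time_mem i i.2).1
    have h4 : (τ i - t) / δ + 1 ≤ (τ j - t) / δ := by
      rw [← sub_nonneg]
      have : (τ j - t) / δ - ((τ i - t) / δ + 1) = (τ j - τ i - δ) / δ := by field_simp; ring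
      rw [this]
      apply div_nonneg _ hδ0.le
      unfold SystemData.delay at h1
      linarith
    have h5 := Nat.floor_le_floor h4
    rw [Nat.floor_add_one (div_nonneg (by linarith) hδ0.le)] at h5
    omega
  have hinj : Function.Injective F := by
    intro i j hF
    rcases lt_trichotomy i j with hij | hij | hij
    · exact absurd hF (key i j hij)
    · exact hij
    · exact absurd hF.symm (key j i hij)
  simpa using Fintype.card_le_of_injective F hinj

theorem take (h : PathValid d t a r N τ β) {n : ℕ} (hn : n ≤ N) : PathValid d t a r n τ β where
  time_mem j hj := h.time_mem j (hj.trans_le hn)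
  mono i j hij hj := h.mono i j hij (hj.trans_le hn)
  allowed j hj := h.allowed j (hj.trans_le hn)
  next i j hij hj := h.next i j hij (hj.trans_le hn)
  first j hj := h.first j (hj.trans_le hn)

theorem congr {τ' : ℕ → ℝ} {β' : ℕ → Switch nG} (h : PathValid d t a r N τ β)
    (hτ : ∀ j < N, τ j = τ' j) (hβ : ∀ j < N, β j = β' j) : PathValid d t a r N τ' β' where
  time_mem j hj := hτ j hj ▸ h.time_mem j hj
  mono i j hij hj := by
    rw [← hτ i (hij.trans_lt hj), ← hτ j hj]
    exact h.mono i j hij hj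
  allowed j hj := hβ j hj ▸ h.allowed j hj
  next i j hij hj hk := by
    have := h.next i j hij hj
    rw [← hτ i (hij.trans hj), ← hτ j hj, ← hβ i (hij.trans hj), ← hβ j hj] at *
    rcases this hk with ⟨m, h1, h2, h3⟩ | h'
    · exact .inl ⟨m, h1, h2, hβ m (h2.trans hj) ▸ h3⟩
    · exact .inr h'
  first j hj := by
    have := h.first j hj
    rw [← hτ j hj, ← hβ j hj] at *
    rcases this with ⟨i, h1, h2⟩ | h'
    · exact .inl ⟨i, h1, hβ i (h1.trans hj) ▸ h2⟩
    · exact .inr h'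

/-- Requests may be postponed as long as the distances between them do not decrease. -/
theorem postpone (h : PathValid d t a r N τ β) {τ' : ℕ → ℝ} (hle : ∀ j < N, τ j ≤ τ' j)
    (hT : ∀ j < N, τ' j ≤ d.T)
    (hinc : ∀ i j, i < j → j < N → τ j - τ i ≤ τ' j - τ' i) : PathValid d t a r N τ' β where
  time_mem j hj := ⟨(h.time_mem j hj).1.trans (hle j hj), hT j hj⟩
  mono i j hij hj := by
    rcases hij.eq_or_lt with rfl | hlt
    · exact le_rfl
    · linarith [hinc i j hlt hj, h.mono i j hij hj]
  allowed := h.allowed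
  next i j hij hj hk := (h.next i j hij hj hk).imp_right fun h' =>
    ⟨h'.1, by linarith [hinc i j hij hj, h'.2]⟩
  first j hj := (h.first j hj).imp_right fun h' => by
    rcases ha : a (β j).gen with l | ⟨l, m⟩
    · rw [ha] at h'; exact h'
    · rw [ha] at h'; exact ⟨h'.1, h'.2.trans_le (hle j hj)⟩

end PathValid

/-- The realization of a control at `ω` is admissible. -/
def Control.ValidAt (d : SystemData nG nL nc) (t : ℝ) (a : Fin nG → GenMode) (r : Fin nG → ℝ)
    (v : Control Ω nG) (ω : Ω) : Prop :=
  PathValid d t a r (v.N ω) (fun j => v.τ j ω) (fun j => v.β j ω)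

/-- Admissibility speaks of the mode just before a request. At a single time `u` that lies before
the request and not before the earlier ones for the same generator, the mode must be steady at the
source level; this forces the previous transition to be completed by `u`. The resulting inequalities
between times survive postponement. -/
theorem Control.IsAdmissible.validAt [mΩ : MeasurableSpace Ω] {v : Control Ω nG}
    {𝓕 : Filtration ℝ mΩ}
    (h : v.IsAdmissible d 𝓕 ((v.withDelays d t a r).mode a) t) (ω : Ω) : v.ValidAt d t a r ω := by
  set w := v.withDelays d t a r with hw
  have key : ∀ j < v.N ω, ∃ u < v.τ j ω,
      (∀ i < j, (v.β i ω).gen = (v.β j ω).gen → v.τ i ω ≤ u) ∧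
      v.β j ω ∈ d.allowed (w.mode a u ω) := by
    intro j hj
    have h1 : ∀ᶠ u in 𝓝[<] (v.τ j ω), ∀ i ∈ Finset.range j,
        (v.β i ω).gen = (v.β j ω).gen → v.τ i ω ≤ u := by
      rw [Filter.eventually_all_finset]
      intro i hi
      by_cases hk : (v.β i ω).gen = (v.β j ω).gen
      · have := h.strict ω i j (Finset.mem_range.1 hi) hj hk
        filter_upwards [nhdsWithin_le_nhds (lt_mem_nhds this)] with u hu _ using hu.le
      · filter_upwards with u hk' using absurd hk' hk
    obtain ⟨u, ⟨hu1, hu2⟩, hu3⟩ :=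
      ((h1.and (h.request ω j hj)).and self_mem_nhdsWithin).exists
    exact ⟨u, hu3, fun i hi => hu1 i (Finset.mem_range.2 hi), hu2⟩
  have hlast : ∀ j < v.N ω, ∀ i < j, ∀ u < v.τ j ω, v.τ i ω ≤ u →
      (v.β i ω).gen = (v.β j ω).gen →
      (∀ m, i < m → m < j → (v.β m ω).gen ≠ (v.β j ω).gen) →
      v.last (v.β j ω).gen u ω = i := by
    intro j hj i hij u hu hiu hk hno
    refine Control.last_eq_coe (hij.trans hj) hk hiu fun m hm him hmk => ?_
    by_contra! hmu
    exact hno m him (by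
      by_contra! hjm
      exact absurd (hmu.trans_lt hu) (not_lt.2 (h.mono ω j m hjm hm))) hmk
  refine ⟨fun j hj => h.time_mem ω j hj, fun i j hij hj => h.mono ω i j hij hj,
    fun j hj => ?_, fun i j hij hj hk => ?_, fun j hj => ?_⟩
  · obtain ⟨u, -, -, hu⟩ := key j hj
    exact hu.2
  · by_cases hno : ∀ m, i < m → m < j → (v.β m ω).gen ≠ (v.β j ω).gen
    · right
      obtain ⟨u, huj, hu, hreq⟩ := key j hj
      have hl := hlast j hj i hij u huj (hu i hij hk) hk hno
      have hm := hreq.1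
      rw [ExecControl.mode_of_last_coe (v := w) hl] at hm
      split_ifs at hm with hc
      have hc' : v.τ i ω + d.delay (v.β i ω) ≤ u := not_lt.1 hc
      exact ⟨GenMode.steady.inj hm, hc'.trans_lt huj⟩
    · left
      push Not at hno
      exact hno
  · by_cases hno : ∃ i < j, (v.β i ω).gen = (v.β j ω).gen
    · exact .inl hno
    · right
      obtain ⟨u, huj, hu, hreq⟩ := key j hj
      have hl : v.last (v.β j ω).gen u ω = ⊥ := by
        refine Control.last_eq_bot fun i hi hk => ?_
        have : j ≤ i := by
          by_contra! hij
          exact hno ⟨i, hij, hk⟩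
        exact huj.trans_le (h.mono ω j i this hi)
      have hm := hreq.1
      rw [ExecControl.mode_of_last_bot (v := w) hl] at hm
      rcases ha : a (v.β j ω).gen with l | ⟨l, m⟩
      · simp only [ha] at hm
        simpa using hm
      · simp only [ha] at hm
        split_ifs at hm with hc
        refine ⟨by simpa using hm, lt_of_le_of_lt ?_ huj⟩
        have := not_lt.1 hc
        simpa [hw, Control.withDelays, ha, SystemData.modeDelay] using this

theorem Control.ValidAt.strict {v : Control Ω nG} {ω : Ω} (hd : d.Valid)
    (h : v.ValidAt d t a r ω) {i j : ℕ} (hij : i < j) (hj : j < v.N ω)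
    (hk : (v.β i ω).gen = (v.β j ω).gen) : v.τ i ω < v.τ j ω := by
  have h1 : v.τ i ω + d.delay (v.β i ω) < v.τ j ω := h.completed_lt hij hj hk
  have h2 : 0 < d.delay (v.β i ω) := h.delay_pos hd (hij.trans hj)
  linarith

/-- The way back from inequalities to left limits: strict inequality leaves room for an interval
before the request on which the generator is already steady. -/
theorem Control.ValidAt.request {v : Control Ω nG} {ω : Ω} (hd : d.Valid)
    (h : v.ValidAt d t a r ω) {j : ℕ} (hj : j < v.N ω) :
    ∀ᶠ u in 𝓝[<] (v.τ j ω), v.β j ω ∈ d.allowed ((v.withDelays d t a r).mode a u ω) := by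
  set w := v.withDelays d t a r with hw
  by_cases hex : ∃ i < j, (v.β i ω).gen = (v.β j ω).gen
  -- The latest earlier request for the same generator excludes the first alternative of `next`.
  · obtain ⟨i, ⟨hij, hk⟩, hmax⟩ : ∃ i, (i < j ∧ (v.β i ω).gen = (v.β j ω).gen) ∧
        ∀ m, i < m → m < j → (v.β m ω).gen ≠ (v.β j ω).gen := by
      classical
      have hne : ((Finset.range j).filter fun i => (v.β i ω).gen = (v.β j ω).gen).Nonempty := by
        obtain ⟨i, hi, hk⟩ := hex
        exact ⟨i, by simp [hi, hk]⟩
      have hmem := Finset.max'_mem _ hne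
      simp only [Finset.mem_filter, Finset.mem_range] at hmem
      refine ⟨_, hmem, fun m hm hmj hk => ?_⟩
      have := Finset.le_max' _ m (by simp [hmj, hk] :
        m ∈ (Finset.range j).filter fun i => (v.β i ω).gen = (v.β j ω).gen)
      omega
    rcases h.next i j hij hj hk with ⟨m, h1, h2, h3⟩ | ⟨hdst, hlt⟩
    · exact absurd h3 (hmax m h1 h2)
    have hlt' : v.τ i ω + d.delay (v.β i ω) < v.τ j ω := hlt
    filter_upwards [nhdsWithin_le_nhds (lt_mem_nhds hlt'), self_mem_nhdsWithin] with u hu huj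
    have hu' : v.τ i ω ≤ u := by linarith [h.delay_pos hd (hij.trans hj)]
    have hl : v.last (v.β j ω).gen u ω = i := by
      refine Control.last_eq_coe (hij.trans hj) hk hu' fun m hm him hmk => ?_
      have hjm : j ≤ m := by
        by_contra! hmj
        exact hmax m him hmj hmk
      exact (mem_Iio.1 huj).trans_le (h.mono j m hjm hm)
    refine ⟨?_, h.allowed j hj⟩
    refine (ExecControl.mode_of_last_coe (v := w) hl a).trans ?_
    exact (if_neg (not_lt.2 hu.le)).trans (congrArg _ hdst)
  · have hf := (h.first j hj).resolve_left hex
    have hl : ∀ u < v.τ j ω, v.last (v.β j ω).gen u ω = ⊥ := by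
      intro u huj
      refine Control.last_eq_bot fun m hm hmk => ?_
      have hjm : j ≤ m := by
        by_contra! hmj
        exact hex ⟨m, hmj, hmk⟩
      exact huj.trans_le (h.mono j m hjm hm)
    rcases ha : a (v.β j ω).gen with l | ⟨l, m⟩
    · rw [ha] at hf
      filter_upwards [self_mem_nhdsWithin] with u huj
      refine ⟨?_, h.allowed j hj⟩
      rw [ExecControl.mode_of_last_bot (v := w) (hl u huj), ha]
      exact congrArg _ hf
    · rw [ha] at hf
      filter_upwards [nhdsWithin_le_nhds (lt_mem_nhds hf.2), self_mem_nhdsWithin] with u hu huj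
      refine ⟨?_, h.allowed j hj⟩
      rw [ExecControl.mode_of_last_bot (v := w) (hl u huj), ha]
      simp only
      rw [if_neg, hf.1]
      simpa [hw, Control.withDelays, ha, SystemData.modeDelay] using hu.le

end Paths

end Dispatch

/-! ### Total progression when transitions are executed after their durations. -/

namespace Dispatch

theorem integral_ite_lt {t s c : ℝ} (hs : t ≤ s) (hc : t ≤ c) :
    ∫ u in t..s, (if u < c then (1 : ℝ) else 0) = min s c - t := by
  have h1 : (fun u => if u < c then (1 : ℝ) else 0) = (Iio c).indicator fun _ => 1 := by
    ext u; simp [indicator_apply]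
  rw [h1, intervalIntegral.integral_of_le hs, setIntegral_indicator measurableSet_Iio,
    setIntegral_const, smul_eq_mul, mul_one]
  rcases le_total c s with h | h
  · have : Ioc t s ∩ Iio c = Ioo t c := by
      ext u
      simp only [mem_inter_iff, mem_Ioc, mem_Iio, mem_Ioo]
      constructor
      · rintro ⟨⟨h1, h2⟩, h3⟩; exact ⟨h1, h3⟩
      · rintro ⟨h1, h3⟩; exact ⟨⟨h1, h3.le.trans h⟩, h3⟩
    rw [this, min_eq_right h, Real.volume_real_Ioo_of_le hc]
  · have : Ioc t s ∩ Iio c = Ioc t s \ {c} := by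
      ext u
      simp only [Set.mem_sdiff, mem_inter_iff, mem_Ioc, mem_Iio, mem_singleton_iff]
      constructor
      · rintro ⟨h1, h3⟩; exact ⟨h1, h3.ne⟩
      · rintro ⟨⟨h1, h2⟩, h3⟩; exact ⟨⟨h1, h2⟩, lt_of_le_of_ne (h2.trans h) h3⟩
    rw [this, measureReal_def, measure_sdiff_null (by simp), ← measureReal_def, min_eq_left h,
      Real.volume_real_Ioc_of_le hs]

theorem intervalIntegrable_ite_lt (t s c : ℝ) :
    IntervalIntegrable (fun u => if u < c then (1 : ℝ) else 0) volume t s := by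
  have h1 : (fun u => if u < c then (1 : ℝ) else 0) = (Iio c).indicator fun _ => 1 := by
    ext u; simp [indicator_apply]
  rw [h1, intervalIntegrable_iff]
  exact (intervalIntegrable_const (c := (1 : ℝ)).def'.mono_set le_rfl).indicator measurableSet_Iio

section Progress

variable {Ω : Type*} {nG nL nc : ℕ} {d : SystemData nG nL nc} {t : ℝ} {a : Fin nG → GenMode}
  {r : Fin nG → ℝ} {v : Control Ω nG} {ω : Ω}

theorem Control.mode_withDelays_of_bot {k : Fin nG} {s : ℝ} (h : v.last k s ω = ⊥) :
    (v.withDelays d t a r).mode a s ω k = match a k with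
      | .steady l => .steady l
      | .transit l m =>
        if s < t - r k + d.modeDelay k (a k) then .transit l m else .steady m :=
  ExecControl.mode_of_last_bot (v := v.withDelays d t a r) h a

theorem Control.mode_withDelays_of_coe {k : Fin nG} {s : ℝ} {j : ℕ} (h : v.last k s ω = j) :
    (v.withDelays d t a r).mode a s ω k = if s < v.τ j ω + d.delay (v.β j ω)
      then .transit (v.β j ω).src (v.β j ω).dst else .steady (v.β j ω).dst :=
  ExecControl.mode_of_last_coe (v := v.withDelays d t a r) h a

theorem Control.progress_of_bot {k : Fin nG} {s : ℝ} (h : v.last k s ω = ⊥) :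
    v.progress d t a r s ω k =
      if s < t - r k + d.modeDelay k (a k) then s - (t - r k) else 0 := by
  simp only [Control.progress, h]

theorem Control.progress_of_coe {k : Fin nG} {s : ℝ} {j : ℕ} (h : v.last k s ω = j) :
    v.progress d t a r s ω k =
      if s < v.τ j ω + d.delay (v.β j ω) then s - v.τ j ω else 0 := by
  simp only [Control.progress, h]
  rfl

namespace Control.ValidAt

/-- At most one transition of a generator is under way. -/
theorem match_last_eq_sum (h : v.ValidAt d t a r ω) (hr : r ∈ d.H a) (k : Fin nG) (s : ℝ)
    (φ₀ : ℝ) (φ : ℕ → ℝ) :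
    (match v.last k s ω with
      | ⊥ => if s < t - r k + d.modeDelay k (a k) then φ₀ else 0
      | (j : ℕ) => if s < v.τ j ω + d.delay (v.β j ω) then φ j else 0) =
    (if s < t - r k + d.modeDelay k (a k) then φ₀ else 0) +
      ∑ j ∈ Finset.range (v.N ω), if (v.β j ω).gen = k then
        (if v.τ j ω ≤ s ∧ s < v.τ j ω + d.delay (v.β j ω) then φ j else 0) else 0 := by
  rcases v.last_cases k s ω with ⟨hl, hno⟩ | ⟨j, hl, hj, hk, hjs, hno⟩
  · rw [hl, Finset.sum_eq_zero]
    · simp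
    · intro j hj
      split_ifs with h1 h2
      · exact absurd (hno j (Finset.mem_range.1 hj) h1) (not_lt.2 h2.1)
      · rfl
      · rfl
  · have h0 : ¬ s < t - r k + d.modeDelay k (a k) := by
      have : t - r (v.β j ω).gen + d.modeDelay (v.β j ω).gen (a (v.β j ω).gen) ≤ v.τ j ω :=
        h.initial_completed_le hr hj
      rw [hk] at this
      exact not_lt.2 (this.trans hjs)
    rw [hl, if_neg h0, zero_add, Finset.sum_eq_single_of_mem j (Finset.mem_range.2 hj)]
    · simp only [hk, hjs, true_and, if_true]
      rfl
    · intro i hi hij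
      rw [Finset.mem_range] at hi
      split_ifs with h1 h2
      · rcases lt_or_gt_of_ne hij with hlt | hlt
        · have : v.τ i ω + d.delay (v.β i ω) < v.τ j ω :=
            h.completed_lt hlt hj (h1.trans hk.symm)
          exact absurd h2.2 (not_lt.2 (this.le.trans hjs))
        · exact absurd (hno i hi hlt h1) (not_lt.2 h2.1)
      · rfl
      · rfl

theorem sum_progress (h : v.ValidAt d t a r ω) (hr : r ∈ d.H a) (s : ℝ) :
    ∑ k, v.progress d t a r s ω k =
    (∑ k, if s < t - r k + d.modeDelay k (a k) then s - (t - r k) else 0) +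
      ∑ j ∈ Finset.range (v.N ω),
        if v.τ j ω ≤ s ∧ s < v.τ j ω + d.delay (v.β j ω) then s - v.τ j ω else 0 := by
  have h1 : ∀ k, v.progress d t a r s ω k = _ := fun k =>
    h.match_last_eq_sum hr k s (s - (t - r k)) (fun j => s - v.τ j ω)
  simp_rw [h1]
  rw [Finset.sum_add_distrib, Finset.sum_comm]
  simp

theorem numTransit_mode (h : v.ValidAt d t a r ω) (hr : r ∈ d.H a) {s : ℝ} (hs : t ≤ s) :
    numTransit ((v.withDelays d t a r).mode a s ω) =
    (∑ k, if s < t - r k + d.modeDelay k (a k) then 1 else 0) +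
      ∑ j ∈ Finset.range (v.N ω),
        if v.τ j ω ≤ s ∧ s < v.τ j ω + d.delay (v.β j ω) then 1 else 0 := by
  have h1 : ∀ k, (match (v.withDelays d t a r).mode a s ω k with
      | .steady _ => (0 : ℝ)
      | .transit _ _ => 1) = _ := fun k => by
    refine Eq.trans ?_ (h.match_last_eq_sum hr k s 1 (fun _ => 1))
    rcases v.last_cases k s ω with ⟨hl, -⟩ | ⟨j, hl, -⟩
    · rw [Control.mode_withDelays_of_bot hl, hl]
      have hrk := hr k
      rcases hak : a k with l | ⟨l, m⟩
      · rw [hak] at hrk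
        simp only at hrk
        simp [SystemData.modeDelay, hrk, not_lt.2 hs]
      · by_cases hc : s < t - r k + d.modeDelay k (.transit l m) <;> simp [hc]
    · rw [Control.mode_withDelays_of_coe hl, hl]
      by_cases hc : s < v.τ j ω + d.delay (v.β j ω)
      · rw [if_pos hc]
        exact (if_pos hc).symm
      · rw [if_neg hc]
        exact (if_neg hc).symm
  unfold numTransit
  refine (Finset.sum_congr rfl fun k _ => h1 k).trans ?_
  rw [Finset.sum_add_distrib, Finset.sum_comm (s := Finset.univ)]
  simp

/-- Both sides split over transitions. A transition on `[b, e)` adds `min s e - min s b` to the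
integral and loses `e - b` from time `e` on: this leaves `s - b` while it runs, and zero otherwise.
For an initial transition the integral starts only at `t`; the part before `t` is supplied by `r k`.
-/
theorem total_eq (h : v.ValidAt d t a r ω) (hd : d.Valid) (hr : r ∈ d.H a) {s : ℝ} (hs : t ≤ s) :
    (v.withDelays d t a r).total d t a (∑ k, r k) s ω = ∑ k, v.progress d t a r s ω k := by
  have hinit : ∀ k, t ≤ t - r k + d.modeDelay k (a k) ∧ 0 ≤ r k ∧
      (d.modeDelay k (a k) = 0 ∨ r k < d.modeDelay k (a k)) := by
    intro k
    have hrk := hr k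
    rcases hak : a k with l | ⟨l, m⟩
    · rw [hak] at hrk
      simp only at hrk
      simp [SystemData.modeDelay, hrk]
    · rw [hak] at hrk
      simp only at hrk
      simp only [SystemData.modeDelay]
      exact ⟨by linarith, hrk.1, .inr hrk.2⟩
  have hint : ∫ u in t..s, numTransit ((v.withDelays d t a r).mode a u ω) =
      (∑ k, (min s (t - r k + d.modeDelay k (a k)) - t)) +
      ∑ j ∈ Finset.range (v.N ω),
        (min s (v.τ j ω + d.delay (v.β j ω)) - min s (v.τ j ω)) := by
    have h1 : ∫ u in t..s, numTransit ((v.withDelays d t a r).mode a u ω) =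
        ∫ u in t..s, ((∑ k, if u < t - r k + d.modeDelay k (a k) then (1 : ℝ) else 0) +
          -- The indicator of `[τ j, τ j + delay)` is written as a difference of indicators of
          -- half-lines, to which `integral_ite_lt` applies.
          ∑ j ∈ Finset.range (v.N ω), ((if u < v.τ j ω + d.delay (v.β j ω) then (1 : ℝ) else 0)
            - if u < v.τ j ω then 1 else 0)) := by
      apply intervalIntegral.integral_congr
      intro u hu
      rw [uIcc_of_le hs] at hu
      simp only
      rw [h.numTransit_mode hr hu.1]
      congr 1
      refine Finset.sum_congr rfl fun j hj => ?_
      have : 0 < d.delay (v.β j ω) := h.delay_pos hd (Finset.mem_range.1 hj)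
      rcases lt_or_ge u (v.τ j ω) with h1 | h1
      · simp [h1, not_le.2 h1, h1.trans_le (le_add_of_nonneg_right this.le)]
      · simp [h1, not_lt.2 h1]
    rw [h1, intervalIntegral.integral_add, intervalIntegral.integral_finsetSum,
      intervalIntegral.integral_finsetSum]
    · congr 1
      · exact Finset.sum_congr rfl fun k _ => integral_ite_lt hs (hinit k).1
      · refine Finset.sum_congr rfl fun j hj => ?_
        have h2 : t ≤ v.τ j ω := (h.time_mem j (Finset.mem_range.1 hj)).1
        have : 0 < d.delay (v.β j ω) := h.delay_pos hd (Finset.mem_range.1 hj)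
        rw [intervalIntegral.integral_sub (intervalIntegrable_ite_lt _ _ _)
          (intervalIntegrable_ite_lt _ _ _), integral_ite_lt hs h2, integral_ite_lt hs (by linarith)]
        ring
    · exact fun j _ => (intervalIntegrable_ite_lt _ _ _).sub (intervalIntegrable_ite_lt _ _ _)
    · exact fun k _ => intervalIntegrable_ite_lt _ _ _
    · have := IntervalIntegrable.sum (μ := volume) (a := t) (b := s) Finset.univ fun k _ =>
        intervalIntegrable_ite_lt t s (t - r k + d.modeDelay k (a k))
      rw [Finset.sum_fn] at this
      exact this
    · have := IntervalIntegrable.sum (μ := volume) (a := t) (b := s) (Finset.range (v.N ω))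
        fun j _ => (intervalIntegrable_ite_lt t s (v.τ j ω + d.delay (v.β j ω))).sub
          (intervalIntegrable_ite_lt t s (v.τ j ω))
      rw [Finset.sum_fn] at this
      exact this
  rw [ExecControl.total, hint, h.sum_progress hr]
  have hk : ∑ k, r k + ∑ k, (min s (t - r k + d.modeDelay k (a k)) - t) -
      (∑ k, if t ≤ t - r k + d.modeDelay k (a k) ∧ t - r k + d.modeDelay k (a k) ≤ s
        then d.modeDelay k (a k) else 0) =
      ∑ k, if s < t - r k + d.modeDelay k (a k) then s - (t - r k) else 0 := by
    rw [← Finset.sum_add_distrib, ← Finset.sum_sub_distrib]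
    refine Finset.sum_congr rfl fun k _ => ?_
    rcases lt_or_ge s (t - r k + d.modeDelay k (a k)) with h1 | h1
    · rw [min_eq_left h1.le, if_neg (fun hc => absurd hc.2 (not_le.2 h1)), if_pos h1]
      ring
    · rw [min_eq_right h1, if_pos ⟨(hinit k).1, h1⟩, if_neg (not_lt.2 h1)]
      ring
  have hj : ∑ j ∈ Finset.range (v.N ω),
      (min s (v.τ j ω + d.delay (v.β j ω)) - min s (v.τ j ω)) -
      (∑ j ∈ Finset.range (v.N ω), if t ≤ v.τ j ω + d.delay (v.β j ω) ∧
        v.τ j ω + d.delay (v.β j ω) ≤ s then d.delay (v.β j ω) else 0) =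
      ∑ j ∈ Finset.range (v.N ω),
        if v.τ j ω ≤ s ∧ s < v.τ j ω + d.delay (v.β j ω) then s - v.τ j ω else 0 := by
    rw [← Finset.sum_sub_distrib]
    refine Finset.sum_congr rfl fun j hj => ?_
    have h2 : t ≤ v.τ j ω := (h.time_mem j (Finset.mem_range.1 hj)).1
    have h3 : 0 < d.delay (v.β j ω) := h.delay_pos hd (Finset.mem_range.1 hj)
    rcases lt_or_ge s (v.τ j ω + d.delay (v.β j ω)) with h1 | h1
    · rw [min_eq_left h1.le, if_neg (fun hc => absurd hc.2 (not_le.2 h1))]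
      rcases le_or_gt (v.τ j ω) s with h4 | h4
      · rw [min_eq_right h4, if_pos ⟨h4, h1⟩]; ring
      · rw [min_eq_left h4.le, if_neg (fun hc => absurd hc.1 (not_le.2 h4))]; ring
    · rw [min_eq_right h1, min_eq_right (by linarith), if_pos ⟨by linarith, h1⟩,
        if_neg (fun hc => absurd hc.2 (not_lt.2 h1))]
      ring
  change _ - (∑ k, if t ≤ t - r k + d.modeDelay k (a k) ∧ t - r k + d.modeDelay k (a k) ≤ s
      then d.modeDelay k (a k) else 0) -
    (∑ j ∈ Finset.range (v.N ω), if t ≤ v.τ j ω + d.delay (v.β j ω) ∧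
        v.τ j ω + d.delay (v.β j ω) ≤ s then d.delay (v.β j ω) else 0) = _
  rw [← hk, ← hj]
  ring

theorem mode_mem (h : v.ValidAt d t a r ω) (hd : d.Valid) (ha : a ∈ d.modes) (s : ℝ) :
    (v.withDelays d t a r).mode a s ω ∈ d.modes := by
  intro k
  rcases v.last_cases k s ω with ⟨hl, -⟩ | ⟨j, hl, hj, hk, -⟩
  · rw [Control.mode_withDelays_of_bot hl]
    have hak := ha k
    rcases h1 : a k with l | ⟨l, m⟩
    · rw [h1] at hak; exact hak
    · rw [h1] at hak
      simp only
      split_ifs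
      · exact hak
      · exact (hd.allowed_subset k _ hak).2
  · rw [Control.mode_withDelays_of_coe hl]
    have hΛ : ((v.β j ω).src, (v.β j ω).dst) ∈ d.Λ (v.β j ω).gen := h.allowed j hj
    rw [hk] at hΛ
    split_ifs
    · exact hΛ
    · exact (hd.allowed_subset k _ hΛ).2

end Control.ValidAt

theorem Control.progress_mem (hr : r ∈ d.H a) {s : ℝ} (hs : t ≤ s) :
    v.progress d t a r s ω ∈ d.H ((v.withDelays d t a r).mode a s ω) := by
  intro k
  have hrk := hr k
  rcases v.last_cases k s ω with ⟨hl, -⟩ | ⟨j, hl, hj, hk, hjs, -⟩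
  · rw [Control.mode_withDelays_of_bot hl, Control.progress_of_bot hl]
    rcases hak : a k with l | ⟨l, m⟩
    · rw [hak] at hrk
      simp only at hrk
      simp [SystemData.modeDelay, hrk, not_lt.2 hs]
    · rw [hak] at hrk
      simp only at hrk
      by_cases hc : s < t - r k + d.modeDelay k (.transit l m)
      · simp only [hc, if_true]
        simp only [SystemData.modeDelay] at hc
        exact ⟨by linarith, by linarith⟩
      · simp [hc]
  · rw [Control.mode_withDelays_of_coe hl, Control.progress_of_coe hl]
    by_cases hc : s < v.τ j ω + d.delay (v.β j ω)
    · rw [if_pos hc, if_pos hc]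
      subst hk
      exact ⟨by linarith, show _ < d.delay (v.β j ω) by linarith⟩
    · rw [if_neg hc, if_neg hc]

/-- The production at the levels of admissible modes stays in the box. -/
theorem SystemData.Valid.production_mem_of_Icc (hd : d.Valid) {b : Fin nG → GenMode}
    (hb : b ∈ d.modes) {p : Fin nG → ℝ}
    (hp : ∀ k l m, b k = .transit l m → p k ∈ Icc 0 (d.δ k (l, m))) :
    d.production b p ∈ d.DG := by
  intro k
  have hbk := hb k
  unfold SystemData.production
  rcases h : b k with l | ⟨l, m⟩
  · rw [h] at hbk
    exact ⟨⟨l, hbk, le_rfl⟩, ⟨l, hbk, le_rfl⟩⟩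
  · rw [h] at hbk
    simp only at hbk ⊢
    have hs := hd.ramp_start k _ hbk
    have he := hd.ramp_end k _ hbk
    have hδ := hd.delay_pos k _ hbk
    have hsub := hd.allowed_subset k _ hbk
    have m0 : (0 : ℝ) ∈ Icc 0 (d.δ k (l, m)) := ⟨le_rfl, hδ.le⟩
    have m1 : d.δ k (l, m) ∈ Icc 0 (d.δ k (l, m)) := ⟨hδ.le, le_rfl⟩
    have mp := hp k l m h
    rcases hd.ramp_monotone k _ hbk with hm | hm
    · have h1 := hm m0 mp mp.1
      have h2 := hm mp m1 mp.2
      rw [hs] at h1; rw [he] at h2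
      exact ⟨⟨l, hsub.1, h1⟩, ⟨m, hsub.2, h2⟩⟩
    · have h1 := hm m0 mp mp.1
      have h2 := hm mp m1 mp.2
      rw [hs] at h1; rw [he] at h2
      exact ⟨⟨m, hsub.2, h2⟩, ⟨l, hsub.1, h1⟩⟩

theorem SystemData.Valid.production_mem (hd : d.Valid) {b : Fin nG → GenMode} (hb : b ∈ d.modes)
    {p : Fin nG → ℝ} (hp : p ∈ d.H b) : d.production b p ∈ d.DG :=
  hd.production_mem_of_Icc hb fun k l m h => by
    have := hp k
    rw [h] at this
    exact ⟨this.1, this.2.le⟩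

end Progress

end Dispatch

/-! ### Infima over slices of a convex set. -/

namespace Dispatch

section SliceInf

variable {ι : Type*} [Fintype ι]

/-- Near `w`, the infima of a continuous function over the slices `∑ r = w'` of a convex set stay
below every strict upper bound of the infimum at `w`. -/
theorem eventually_slice_lt {H : Set (ι → ℝ)} (hH : Convex ℝ H) {g : ℝ × (ι → ℝ) → ℝ}
    (hg : ContinuousOn g (univ ×ˢ H)) {y b : ℝ} {r r₁ : ι → ℝ} (hr : r ∈ H) (hr₁ : r₁ ∈ H)
    (hlt : g (y, r) < b) :
    ∀ᶠ p : ℝ × ℝ in 𝓝[univ ×ˢ uIcc (∑ k, r k) (∑ k, r₁ k)] (y, ∑ k, r k),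
      ∃ r' ∈ H, ∑ k, r' k = p.2 ∧ g (p.1, r') < b := by
  set w := ∑ k, r k with hw
  set w₁ := ∑ k, r₁ k with hw₁
  -- The segment from `r` to `r₁` meets the slice of sum `u` at parameter `θ u`. If `w₁ = w`,
  -- division by zero gives `θ = 0`, which is right since then only `u = w` occurs.
  let θ : ℝ → ℝ := fun u => (u - w) / (w₁ - w)
  let R : ℝ → ι → ℝ := fun u => r + θ u • (r₁ - r)
  have hRc : Continuous fun p : ℝ × ℝ => (p.1, R p.2) := by
    simp only [R, θ]
    fun_prop
  have hθ : ∀ u ∈ uIcc w w₁, 0 ≤ θ u ∧ θ u ≤ 1 := by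
    intro u hu
    simp only [θ]
    rcases le_total w w₁ with h | h
    · rw [uIcc_of_le h] at hu
      exact ⟨div_nonneg (by linarith [hu.1]) (by linarith),
        div_le_one_of_le₀ (by linarith [hu.2]) (by linarith)⟩
    · rw [uIcc_of_ge h] at hu
      rw [← neg_div_neg_eq]
      exact ⟨div_nonneg (by linarith [hu.2]) (by linarith),
        div_le_one_of_le₀ (by linarith [hu.1]) (by linarith)⟩
  have hRH : ∀ u ∈ uIcc w w₁, R u ∈ H := fun u hu =>
    hH.add_smul_sub_mem hr hr₁ (hθ u hu)
  have hRs : ∀ u ∈ uIcc w w₁, ∑ k, R u k = u := by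
    intro u hu
    have : ∑ k, R u k = w + θ u * (w₁ - w) := by
      simp only [R, Pi.add_apply, Pi.smul_apply, Pi.sub_apply, smul_eq_mul,
        Finset.sum_add_distrib, ← Finset.mul_sum, Finset.sum_sub_distrib, hw, hw₁]
    rw [this]
    by_cases h : w₁ - w = 0
    · have h' : w₁ = w := by linarith
      rw [h', uIcc_self, mem_singleton_iff] at hu
      rw [h, hu]; ring
    · simp only [θ]
      field_simp
      ring
  have hR0 : R w = r := by simp [R, θ]
  have hcw : ContinuousWithinAt g (univ ×ˢ H) (y, r) := hg _ ⟨trivial, hr⟩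
  have htend : Tendsto (fun p : ℝ × ℝ => (p.1, R p.2)) (𝓝[univ ×ˢ uIcc w w₁] (y, w))
      (𝓝[univ ×ˢ H] (y, r)) := by
    refine tendsto_nhdsWithin_iff.2 ⟨?_, ?_⟩
    · have := hRc.continuousAt (x := (y, w))
      rw [ContinuousAt] at this
      simp only [hR0] at this
      exact this.mono_left nhdsWithin_le_nhds
    · filter_upwards [self_mem_nhdsWithin] with p hp
      exact ⟨trivial, hRH _ hp.2⟩
  filter_upwards [htend.eventually (hcw.eventually_lt_const hlt), self_mem_nhdsWithin] with p hp hpm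
  exact ⟨R p.2, hRH _ hpm.2, hRs _ hpm.2, hp⟩

/-- The infimum of a continuous function over the slices of a convex set is measurable. -/
theorem measurable_sInf_slice {H : Set (ι → ℝ)} (hH : Convex ℝ H) {g : ℝ × (ι → ℝ) → ℝ}
    (hg : ContinuousOn g (univ ×ˢ H)) {C : ℝ} (hC : ∀ y, ∀ r ∈ H, C ≤ g (y, r)) :
    Measurable fun p : ℝ × ℝ =>
      sInf ((fun r => g (p.1, r)) '' {r | r ∈ H ∧ ∑ k, r k = p.2}) := by
  set φ := fun p : ℝ × ℝ => sInf ((fun r => g (p.1, r)) '' {r | r ∈ H ∧ ∑ k, r k = p.2}) with hφ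
  set D : Set ℝ := (fun r : ι → ℝ => ∑ k, r k) '' H with hD
  have hDm : MeasurableSet D := by
    have hlin : IsLinearMap ℝ (fun r : ι → ℝ => ∑ k, r k) :=
      ⟨fun x y => by simp [Finset.sum_add_distrib], fun c x => by simp [Finset.mul_sum]⟩
    exact (hH.is_linear_image hlin).ordConnected.measurableSet
  have hbdd : ∀ p : ℝ × ℝ,
      BddBelow ((fun r => g (p.1, r)) '' {r | r ∈ H ∧ ∑ k, r k = p.2}) := by
    intro p
    refine ⟨C, ?_⟩
    rintro _ ⟨r, hr, rfl⟩
    exact hC _ _ hr.1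
  -- Outside the attainable sums the infimum is over the empty set and has the default value `0`.
  have hout : ∀ p : ℝ × ℝ, p.2 ∉ D → φ p = 0 := by
    intro p hp
    have : {r | r ∈ H ∧ ∑ k, r k = p.2} = ∅ := by
      ext r
      simp only [Set.mem_ofPred_eq, mem_empty_iff_false, iff_false]
      exact fun h => hp ⟨r, h⟩
    simp [hφ, this]
  have hin : ∀ b : ℝ, ∀ p : ℝ × ℝ, p.2 ∈ D → φ p < b →
      ∀ᶠ p' in 𝓝[univ ×ˢ D] p, φ p' < b := by
    rintro b ⟨y, w⟩ ⟨r₀, hr₀, hw₀⟩ hlt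
    obtain ⟨_, ⟨r, ⟨hr, hrw⟩, rfl⟩, hb⟩ := exists_lt_of_csInf_lt
      (by exact ⟨_, ⟨r₀, ⟨hr₀, hw₀⟩, rfl⟩⟩) hlt
    simp only at hrw hb
    have hside : ∀ r₁ ∈ H, ∀ᶠ p' in 𝓝[univ ×ˢ uIcc w (∑ k, r₁ k)] (y, w), φ p' < b := by
      intro r₁ hr₁
      have := eventually_slice_lt hH hg hr hr₁ hb
      rw [hrw] at this
      filter_upwards [this] with p' hp'
      obtain ⟨r', hr', hs, hlt'⟩ := hp'
      exact csInf_lt_of_lt (hbdd p') ⟨r', ⟨hr', hs⟩, rfl⟩ hlt'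
    -- A point of `H` with larger sum covers a right neighbourhood of `w`. If there is none, `w` is
    -- the largest attainable sum and `r` itself serves. The left side is symmetric.
    obtain ⟨r₁, hr₁, hup⟩ : ∃ r₁ ∈ H, ∀ᶠ u in 𝓝 w, u ∈ D → w ≤ u → u ∈ uIcc w (∑ k, r₁ k) := by
      by_cases h : ∃ r₁ ∈ H, w < ∑ k, r₁ k
      · obtain ⟨r₁, hr₁, hlt⟩ := h
        refine ⟨r₁, hr₁, ?_⟩
        filter_upwards [gt_mem_nhds hlt] with u hu _ hwu
        rw [uIcc_of_le hlt.le]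
        exact ⟨hwu, hu.le⟩
      · push Not at h
        refine ⟨r, hr, Eventually.of_forall ?_⟩
        rintro u ⟨r₂, hr₂, rfl⟩ hwu
        exact le_antisymm hwu (h r₂ hr₂) ▸ left_mem_uIcc
    obtain ⟨r₂, hr₂, hdn⟩ : ∃ r₂ ∈ H, ∀ᶠ u in 𝓝 w, u ∈ D → u ≤ w → u ∈ uIcc w (∑ k, r₂ k) := by
      by_cases h : ∃ r₁ ∈ H, ∑ k, r₁ k < w
      · obtain ⟨r₁, hr₁, hlt⟩ := h
        refine ⟨r₁, hr₁, ?_⟩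
        filter_upwards [lt_mem_nhds hlt] with u hu _ hwu
        rw [uIcc_of_ge hlt.le]
        exact ⟨hu.le, hwu⟩
      · push Not at h
        refine ⟨r, hr, Eventually.of_forall ?_⟩
        rintro u ⟨r₂, hr₂, rfl⟩ hwu
        exact le_antisymm (h r₂ hr₂) hwu ▸ left_mem_uIcc
    have h1 := hside r₁ hr₁
    have h2 := hside r₂ hr₂
    rw [eventually_nhdsWithin_iff] at h1 h2 ⊢
    have hs : Tendsto Prod.snd (𝓝 (y, w)) (𝓝 w) := continuous_snd.continuousAt
    filter_upwards [h1, h2, hs.eventually hup, hs.eventually hdn] with p' h1 h2 h3 h4 hp'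
    rcases le_total w p'.2 with h | h
    · exact h1 ⟨trivial, h3 hp'.2 h⟩
    · exact h2 ⟨trivial, h4 hp'.2 h⟩
  refine measurable_of_Iio fun b => ?_
  have hDm' : MeasurableSet (univ ×ˢ D : Set (ℝ × ℝ)) := MeasurableSet.univ.prod hDm
  set A := φ ⁻¹' Iio b with hA
  -- By `hin` the infimum is upper semicontinuous relative to the attainable sums, so its strict
  -- sublevel sets are relatively open there. The complement belongs to `A` entirely or not at all,
  -- depending on the default value.
  have hsplit : A = (interior (A ∪ (univ ×ˢ D)ᶜ) ∩ univ ×ˢ D) ∪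
      (if 0 < b then (univ ×ˢ D)ᶜ else ∅) := by
    ext p
    by_cases hp : p.2 ∈ D
    · have hp' : p ∈ (univ ×ˢ D : Set (ℝ × ℝ)) := ⟨trivial, hp⟩
      constructor
      · intro hpA
        refine .inl ⟨mem_interior_iff_mem_nhds.2 ?_, hp'⟩
        have := hin b p hp hpA
        rw [eventually_nhdsWithin_iff] at this
        filter_upwards [this] with p' h'
        by_cases hc : p' ∈ (univ ×ˢ D : Set (ℝ × ℝ))
        · exact .inl (h' hc)
        · exact .inr hc
      · rintro (h | h)
        · rcases interior_subset h.1 with h1 | h1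
          · exact h1
          · exact absurd hp' h1
        · split_ifs at h
          · exact absurd hp' h
          · exact absurd h (notMem_empty _)
    · have hp' : p ∉ (univ ×ˢ D : Set (ℝ × ℝ)) := fun h => hp h.2
      have h0 : p ∈ A ↔ 0 < b := by
        rw [hA, mem_preimage, hout p hp, mem_Iio]
      rw [h0]
      by_cases hb : 0 < b <;> simp [hb, hp]
  rw [hsplit]
  refine (isOpen_interior.measurableSet.inter hDm').union ?_
  split_ifs
  · exact hDm'.compl
  · exact .empty

end SliceInf

/-! ### Comparison, growth and regularity of the running costs. -/

section Costs

variable {nG nL nc Nη : ℕ} (d : SystemData nG nL nc) (η : Directions nG nL Nη)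

/-- The running cost as a function of the production. -/
noncomputable def SystemData.prodCost (x : Fin nL → ℝ) (p : Fin nG → ℝ) : ℝ :=
  d.CG p + ∑ i, d.q i * d.shedCost i p (x ⊔ 0)

/-- The running cost for the half-space approximations as a function of the production. -/
noncomputable def prodCostη (y : ℝ) (p : Fin nG → ℝ) : ℝ :=
  d.CG p + ⨆ j, ∑ i, d.q i * shedCostη d η i j (η.ηG j ⬝ᵥ p) y

/-- Minimal cost of reducing the projected demand by one unit. -/
noncomputable def unitShedCost : ℝ := sInf ((fun z => d.c ⬝ᵥ z) '' {z | 0 ≤ z ∧ 1 ≤ η.ηL ⬝ᵥ z})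

variable {d η}

theorem SystemData.Valid.shedPrice_dot_nonneg (hd : d.Valid) {z : Fin nL → ℝ} (hz : 0 ≤ z) :
    0 ≤ d.c ⬝ᵥ z :=
  dotProduct_nonneg_of_nonneg (fun j => (hd.shedPrice_pos j).le) hz

theorem shedCostη_nonneg (hd : d.Valid) (i : Fin (nc + 1)) (j : Fin Nη) (g y : ℝ) :
    0 ≤ shedCostη d η i j g y := by
  refine Real.sInf_nonneg ?_
  rintro _ ⟨z, hz, rfl⟩
  exact hd.shedPrice_dot_nonneg hz.1

theorem SystemData.Valid.shedCost_nonneg (hd : d.Valid) (i : Fin (nc + 1)) (p : Fin nG → ℝ)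
    (x : Fin nL → ℝ) : 0 ≤ d.shedCost i p x := by
  refine Real.sInf_nonneg ?_
  rintro _ ⟨z, hz, rfl⟩
  exact hd.shedPrice_dot_nonneg hz.1

/-- Scaling: for a positive excess `b` over the support level, `z ↦ b • z` maps the feasible set of
the unit problem onto that of the given one and the cost is linear; without excess, `z = 0` is
optimal. The closed form makes continuity in production and demand evident. -/
theorem shedCostη_eq (hd : d.Valid) (i : Fin (nc + 1)) (j : Fin Nη) (g y : ℝ) :
    shedCostη d η i j g y = unitShedCost d η * max (g + y - supportLevel d η i j) 0 := by
  set b := g + y - supportLevel d η i j with hb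
  have hset : ∀ z : Fin nL → ℝ, g + y - η.ηL ⬝ᵥ z ≤ supportLevel d η i j ↔ b ≤ η.ηL ⬝ᵥ z :=
    fun z => by constructor <;> intro h <;> linarith
  rcases le_or_gt b 0 with h0 | h0
  · rw [max_eq_right h0, mul_zero]
    refine le_antisymm ?_ (shedCostη_nonneg hd i j g y)
    refine csInf_le ⟨0, ?_⟩ ⟨0, ⟨le_rfl, ?_⟩, by simp⟩
    · rintro _ ⟨z, hz, rfl⟩
      exact hd.shedPrice_dot_nonneg hz.1
    · rw [hset]; simpa using h0
  · rw [max_eq_left h0.le, mul_comm, unitShedCost, ← smul_eq_mul, ← Real.sInf_smul_of_nonneg h0.le,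
      shedCostη]
    congr 1
    ext u
    constructor
    · rintro ⟨z, ⟨hz, hzb⟩, rfl⟩
      rw [hset] at hzb
      refine ⟨d.c ⬝ᵥ (b⁻¹ • z), ⟨b⁻¹ • z, ⟨smul_nonneg (inv_nonneg.2 h0.le) hz, ?_⟩, rfl⟩, ?_⟩
      · rw [dotProduct_smul, smul_eq_mul]
        rwa [← div_eq_inv_mul, le_div_iff₀ h0, one_mul]
      · simp only [dotProduct_smul, smul_eq_mul]
        field_simp
    · rintro ⟨_, ⟨z, ⟨hz, hz1⟩, rfl⟩, rfl⟩
      refine ⟨b • z, ⟨smul_nonneg h0.le hz, ?_⟩, by simp [dotProduct_smul]⟩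
      rw [hset, dotProduct_smul, smul_eq_mul]
      nlinarith

theorem continuousOn_prodCostη (hd : d.Valid) (hη : η.Valid) :
    ContinuousOn (fun p : ℝ × (Fin nG → ℝ) => prodCostη d η p.1 p.2) (univ ×ˢ d.DG) := by
  have : Nonempty (Fin Nη) := ⟨⟨0, hη.pos⟩⟩
  have h2 : Continuous fun p : ℝ × (Fin nG → ℝ) =>
      ⨆ j, ∑ i, d.q i * shedCostη d η i j (η.ηG j ⬝ᵥ p.2) p.1 := by
    simp_rw [shedCostη_eq hd, ← Finset.sup'_univ_eq_ciSup]
    refine Continuous.finset_sup'_apply _ fun j _ => ?_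
    have : Continuous fun p : ℝ × (Fin nG → ℝ) => η.ηG j ⬝ᵥ p.2 :=
      continuous_const.dotProduct continuous_snd
    fun_prop
  exact (hd.prodCost_continuous.comp continuousOn_snd fun p hp => hp.2).add h2.continuousOn

theorem SystemData.Valid.isCompact_DG (hd : d.Valid) : IsCompact d.DG := by
  have : d.DG = univ.pi fun k => Icc ((d.Θ k).min' (hd.levels_nonempty k))
      ((d.Θ k).max' (hd.levels_nonempty k)) := by
    ext p
    simp only [SystemData.DG, Set.mem_ofPred_eq, Set.mem_pi, mem_univ, true_implies, mem_Icc]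
    refine forall_congr' fun k => and_congr ⟨?_, fun h => ⟨_, Finset.min'_mem _ _, h⟩⟩
      ⟨?_, fun h => ⟨_, Finset.max'_mem _ _, h⟩⟩
    · rintro ⟨l, hl, h⟩
      exact (Finset.min'_le _ _ hl).trans h
    · rintro ⟨l, hl, h⟩
      exact h.trans (Finset.le_max' _ _ hl)
  rw [this]
  exact isCompact_univ_pi fun k => isCompact_Icc

theorem SystemData.Valid.exists_CG_bound (hd : d.Valid) : ∃ C, 0 ≤ C ∧ ∀ p ∈ d.DG, |d.CG p| ≤ C := by
  obtain ⟨C, hC⟩ := hd.isCompact_DG.exists_bound_of_continuousOn hd.prodCost_continuous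
  exact ⟨max C 0, le_max_right _ _, fun p hp => (hC p hp).trans (le_max_left _ _)⟩

/-- The half-space approximations underestimate the cost of load disruption. -/
theorem shedCostη_le_shedCost (hd : d.Valid) (hη : η.Valid) (i : Fin (nc + 1)) (j : Fin Nη)
    {p : Fin nG → ℝ} (hp : p ∈ d.DG) (x : Fin nL → ℝ) :
    shedCostη d η i j (η.ηG j ⬝ᵥ p) (η.ηL ⬝ᵥ x) ≤ d.shedCost i p (x ⊔ 0) := by
  obtain ⟨z₀, hz₀, hz₀G⟩ := hd.feasible_shed i p hp (x ⊔ 0) le_sup_right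
  -- Load shedding that is feasible for the network is feasible for the half-space, so the infimum
  -- on the left is over a larger set. The smaller set must be nonempty, because the real infimum of
  -- the empty set is `0`.
  refine csInf_le_csInf ⟨0, ?_⟩ ⟨_, ⟨z₀, ⟨hz₀, hz₀G⟩, rfl⟩⟩ (image_mono ?_)
  · rintro _ ⟨z, hz, rfl⟩
    exact hd.shedPrice_dot_nonneg hz.1
  · rintro z ⟨hz, hzG⟩
    refine ⟨hz, ?_⟩
    have hbdd : BddAbove ((fun p : (Fin nG → ℝ) × (Fin nL → ℝ) =>
        η.ηG j ⬝ᵥ p.1 + η.ηL ⬝ᵥ p.2) '' {p | p.1 ∈ d.DG ∧ 0 ≤ p.2 ∧ p ∈ d.G i}) := by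
      have hc : Continuous fun p : (Fin nG → ℝ) × (Fin nL → ℝ) =>
          η.ηG j ⬝ᵥ p.1 + η.ηL ⬝ᵥ p.2 :=
        (continuous_const.dotProduct continuous_fst).add
          (continuous_const.dotProduct continuous_snd)
      exact ((hd.feasible_compact i).bddAbove_image hc.continuousOn).mono
        (image_mono fun p hp => hp.2.2)
    -- The demand left after shedding is nonnegative, so the pair competes in the maximum that
    -- defines the support level.
    have h1 : η.ηG j ⬝ᵥ p + η.ηL ⬝ᵥ (x ⊔ 0 - z) ≤ supportLevel d η i j :=
      le_csSup hbdd ⟨(p, x ⊔ 0 - z), ⟨hp, hd.feasible_demand_nonneg i _ hzG, hzG⟩, rfl⟩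
    have h2 : η.ηL ⬝ᵥ x ≤ η.ηL ⬝ᵥ (x ⊔ 0) :=
      dotProduct_le_dotProduct_of_nonneg_left le_sup_left hη.nonneg
    rw [dotProduct_sub] at h1
    linarith

theorem prodCostη_le_prodCost (hd : d.Valid) (hη : η.Valid) {p : Fin nG → ℝ} (hp : p ∈ d.DG)
    (x : Fin nL → ℝ) : prodCostη d η (η.ηL ⬝ᵥ x) p ≤ d.prodCost x p := by
  have : Nonempty (Fin Nη) := ⟨⟨0, hη.pos⟩⟩
  have h (j : Fin Nη) : ∑ i, d.q i * shedCostη d η i j (η.ηG j ⬝ᵥ p) (η.ηL ⬝ᵥ x) ≤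
      ∑ i, d.q i * d.shedCost i p (x ⊔ 0) := Finset.sum_le_sum fun i _ =>
    mul_le_mul_of_nonneg_left (shedCostη_le_shedCost hd hη i j hp x) (hd.weight_nonneg i)
  exact add_le_add_right (ciSup_le h) _

theorem CG_le_prodCostη (hd : d.Valid) (y : ℝ) (p : Fin nG → ℝ) : d.CG p ≤ prodCostη d η y p :=
  le_add_of_nonneg_right (Real.iSup_nonneg fun j => Finset.sum_nonneg fun i _ =>
    mul_nonneg (hd.weight_nonneg i) (shedCostη_nonneg hd i j _ _))

/-- Feasible demand is nonnegative, so no more than `x ⊔ 0` can be shed, and every component of it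
is at most `‖x‖`. -/
theorem SystemData.Valid.shedCost_le (hd : d.Valid) (i : Fin (nc + 1)) {p : Fin nG → ℝ}
    (hp : p ∈ d.DG) (x : Fin nL → ℝ) : d.shedCost i p (x ⊔ 0) ≤ (∑ j, d.c j) * ‖x‖ := by
  obtain ⟨z, hz, hzG⟩ := hd.feasible_shed i p hp (x ⊔ 0) le_sup_right
  have h1 : d.shedCost i p (x ⊔ 0) ≤ d.c ⬝ᵥ z := by
    refine csInf_le ⟨0, ?_⟩ ⟨z, ⟨hz, hzG⟩, rfl⟩
    rintro _ ⟨z, hz, rfl⟩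
    exact hd.shedPrice_dot_nonneg hz.1
  refine h1.trans ?_
  rw [dotProduct, Finset.sum_mul]
  refine Finset.sum_le_sum fun j _ => mul_le_mul_of_nonneg_left ?_ (hd.shedPrice_pos j).le
  have h2 := hd.feasible_demand_nonneg i _ hzG j
  simp only [Pi.zero_apply, Pi.sub_apply, Pi.sup_apply] at h2
  have h3 : x j ⊔ 0 ≤ ‖x‖ :=
    sup_le ((le_abs_self _).trans (norm_le_pi_norm x j)) (norm_nonneg x)
  linarith

/-- Coefficient of the linear growth of the running cost. -/
noncomputable def SystemData.growth (d : SystemData nG nL nc) : ℝ := (∑ i, d.q i) * ∑ j, d.c j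

theorem SystemData.Valid.prodCost_le (hd : d.Valid) {p : Fin nG → ℝ} (hp : p ∈ d.DG)
    (x : Fin nL → ℝ) : d.prodCost x p ≤ d.CG p + d.growth * ‖x‖ := by
  refine add_le_add_right ?_ _
  rw [SystemData.growth, Finset.sum_mul, Finset.sum_mul]
  refine Finset.sum_le_sum fun i _ => ?_
  rw [mul_assoc]
  exact mul_le_mul_of_nonneg_left (hd.shedCost_le i hp x) (hd.weight_nonneg i)

theorem SystemData.Valid.continuousOn_production (hd : d.Valid) {b : Fin nG → GenMode}
    (hb : b ∈ d.modes) : ContinuousOn (d.production b) (d.H b) := by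
  refine continuousOn_pi.2 fun k => ?_
  have hbk := hb k
  unfold SystemData.production
  rcases h : b k with l | ⟨l, m⟩
  · exact continuousOn_const
  · rw [h] at hbk
    refine (hd.ramp_continuous k _ hbk).comp (continuous_apply k).continuousOn fun p hp => ?_
    have := hp k
    rw [h] at this
    exact ⟨this.1, this.2.le⟩

theorem SystemData.H_eq_pi (d : SystemData nG nL nc) (b : Fin nG → GenMode) :
    d.H b = univ.pi fun k => match b k with
      | .steady _ => ({0} : Set ℝ)
      | .transit l m => Ico 0 (d.δ k (l, m)) := by
  ext p
  simp only [SystemData.H, Set.mem_ofPred_eq, Set.mem_pi, mem_univ, true_implies]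
  refine forall_congr' fun k => ?_
  rcases b k with l | ⟨l, m⟩ <;> exact Iff.rfl

theorem SystemData.convex_H (d : SystemData nG nL nc) (b : Fin nG → GenMode) : Convex ℝ (d.H b) := by
  rw [d.H_eq_pi]
  refine convex_pi fun k _ => ?_
  rcases b k with l | ⟨l, m⟩
  · exact convex_singleton 0
  · exact convex_Ico 0 _

/-- The progression `p` is itself a competitor in its slice. The slice costs are bounded below
because `CG` is bounded on the compact box and shedding costs are nonnegative. -/
theorem runCostη₂_le (hd : d.Valid) {b : Fin nG → GenMode} (hb : b ∈ d.modes) {p : Fin nG → ℝ}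
    (hp : p ∈ d.H b) (y : ℝ) :
    runCostη₂ d η y b (∑ k, p k) ≤ prodCostη d η y (d.production b p) := by
  obtain ⟨C, -, hC⟩ := hd.exists_CG_bound
  refine csInf_le ⟨-C, ?_⟩ ⟨p, ⟨hp, rfl⟩, rfl⟩
  rintro _ ⟨r, hr, rfl⟩
  exact (abs_le.1 (hC _ (hd.production_mem hb hr.1))).1.trans (CG_le_prodCostη hd _ _)

theorem le_runCostη₂ (hd : d.Valid) {C : ℝ} (hC : ∀ p ∈ d.DG, |d.CG p| ≤ C)
    {b : Fin nG → GenMode} (hb : b ∈ d.modes) {p : Fin nG → ℝ} (hp : p ∈ d.H b) (y : ℝ) :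
    -C ≤ runCostη₂ d η y b (∑ k, p k) := by
  refine le_csInf ⟨_, ⟨p, ⟨hp, rfl⟩, rfl⟩⟩ ?_
  rintro _ ⟨r, hr, rfl⟩
  exact (abs_le.1 (hC _ (hd.production_mem hb hr.1))).1.trans (CG_le_prodCostη hd _ _)

theorem measurable_runCostη₂ (hd : d.Valid) (hη : η.Valid) {b : Fin nG → GenMode}
    (hb : b ∈ d.modes) : Measurable fun p : ℝ × ℝ => runCostη₂ d η p.1 b p.2 := by
  obtain ⟨C, -, hC⟩ := hd.exists_CG_bound
  refine measurable_sInf_slice (d.convex_H b)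
    (g := fun q => prodCostη d η q.1 (d.production b q.2)) (C := -C) ?_ fun y r hr =>
    (abs_le.1 (hC _ (hd.production_mem hb hr))).1.trans (CG_le_prodCostη hd _ _)
  refine (continuousOn_prodCostη hd hη).comp (f := fun q : ℝ × (Fin nG → ℝ) =>
    (q.1, d.production b q.2)) (continuousOn_fst.prodMk
      ((hd.continuousOn_production hb).comp continuousOn_snd fun q hq => hq.2)) ?_
  exact fun q hq => ⟨trivial, hd.production_mem hb hq.2⟩

variable {α : Type*} [MeasurableSpace α]

theorem measurable_prodCostη (hd : d.Valid) (hη : η.Valid) {Y : α → ℝ} {p : α → Fin nG → ℝ}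
    (hY : Measurable Y) (hp : Measurable p) (hpD : ∀ ω, p ω ∈ d.DG) :
    Measurable fun ω => prodCostη d η (Y ω) (p ω) := by
  have h := (continuousOn_iff_continuous_domRestrict.1 (continuousOn_prodCostη hd hη)).measurable
  exact h.comp ((hY.prodMk hp).subtype_mk (h := fun ω => ⟨trivial, hpD ω⟩))

/-- The cost is below `b` iff, for some rational `q < b`, some feasible shedding costs at most `q`.
The data admitting such a shedding form the projection of a closed set along the compact set `d.G
i`, hence a closed set. -/
theorem measurable_shedCost (hd : d.Valid) (i : Fin (nc + 1)) {X : α → Fin nL → ℝ}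
    {p : α → Fin nG → ℝ} (hX : Measurable X) (hp : Measurable p) (hpD : ∀ ω, p ω ∈ d.DG) :
    Measurable fun ω => d.shedCost i (p ω) (X ω ⊔ 0) := by
  -- The first component is the feasible point reached, the second the pair of production and
  -- demand; their difference in demand is what is shed.
  let S : ℝ → Set ((Fin nG → ℝ) × (Fin nL → ℝ)) := fun b => Prod.snd ''
    {u : d.G i × ((Fin nG → ℝ) × (Fin nL → ℝ)) |
      u.1.1.1 = u.2.1 ∧ 0 ≤ u.2.2 - u.1.1.2 ∧ d.c ⬝ᵥ (u.2.2 - u.1.1.2) ≤ b}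
  have : CompactSpace (d.G i) := isCompact_iff_compactSpace.1 (hd.feasible_compact i)
  have hS : ∀ b, IsClosed (S b) := by
    intro b
    refine isClosedMap_snd_of_compactSpace _ ?_
    have h1 : Continuous fun u : d.G i × ((Fin nG → ℝ) × (Fin nL → ℝ)) => u.1.1.1 := by fun_prop
    have h2 : Continuous fun u : d.G i × ((Fin nG → ℝ) × (Fin nL → ℝ)) => u.2.1 := by fun_prop
    have h3 : Continuous fun u : d.G i × ((Fin nG → ℝ) × (Fin nL → ℝ)) => u.2.2 - u.1.1.2 := by
      fun_prop
    exact (isClosed_eq h1 h2).inter ((isClosed_le continuous_const h3).inter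
      (isClosed_le (continuous_const.dotProduct h3) continuous_const))
  refine measurable_of_Iio fun b => ?_
  have : (fun ω => d.shedCost i (p ω) (X ω ⊔ 0)) ⁻¹' Iio b =
      ⋃ (q : ℚ) (_ : (q : ℝ) < b), (fun ω => (p ω, X ω ⊔ 0)) ⁻¹' S q := by
    ext ω
    simp only [mem_preimage, mem_Iio, mem_iUnion, exists_prop]
    constructor
    · intro h
      obtain ⟨z₀, hz₀, hz₀G⟩ := hd.feasible_shed i _ (hpD ω) (X ω ⊔ 0) le_sup_right
      obtain ⟨_, ⟨z, ⟨hz, hzG⟩, rfl⟩, hlt⟩ := exists_lt_of_csInf_lt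
        (by exact ⟨_, ⟨z₀, ⟨hz₀, hz₀G⟩, rfl⟩⟩) h
      obtain ⟨q, hq1, hq2⟩ := exists_rat_btwn hlt
      refine ⟨q, hq2, ⟨(⟨_, hzG⟩, (p ω, X ω ⊔ 0)), ⟨rfl, ?_, ?_⟩, rfl⟩⟩
      · simpa using hz
      · simpa using hq1.le
    · rintro ⟨q, hq, ⟨⟨g, u⟩, ⟨h1, h2, h3⟩, h4⟩⟩
      simp only at h1 h2 h3 h4
      subst h4
      simp only at h1 h2 h3
      refine lt_of_le_of_lt ?_ (h3.trans_lt hq)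
      refine csInf_le ⟨0, ?_⟩ ⟨X ω ⊔ 0 - g.1.2, ⟨h2, ?_⟩, rfl⟩
      · rintro _ ⟨z, hz, rfl⟩
        exact hd.shedPrice_dot_nonneg hz.1
      · rw [sub_sub_cancel, ← h1]
        exact g.2
  rw [this]
  have hsup : Continuous fun x : Fin nL → ℝ => x ⊔ 0 := continuous_pi fun j =>
    (continuous_apply j).sup continuous_const
  have hm : Measurable fun ω => (p ω, X ω ⊔ 0) := hp.prodMk (hsup.measurable.comp hX)
  exact .iUnion fun q => .iUnion fun _ => hm (hS q).measurableSet

theorem SystemData.Valid.measurable_prodCost (hd : d.Valid) {X : α → Fin nL → ℝ}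
    {p : α → Fin nG → ℝ} (hX : Measurable X) (hp : Measurable p) (hpD : ∀ ω, p ω ∈ d.DG) :
    Measurable fun ω => d.prodCost (X ω) (p ω) := by
  have h := (continuousOn_iff_continuous_domRestrict.1 hd.prodCost_continuous).measurable
  exact (h.comp (hp.subtype_mk (h := hpD))).add (Finset.measurable_sum _ fun i _ =>
    (measurable_shedCost hd i hX hp hpD).const_mul _)

end Costs

end Dispatch

/-! ### Brownian motion: projection and moments. -/

namespace Dispatch

section Brownian

variable {Ω : Type*} [mΩ : MeasurableSpace Ω] {P : Measure Ω} {n : ℕ}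

theorem BrownianMotion.isProbabilityMeasure (B : BrownianMotion Ω P n) : IsProbabilityMeasure P :=
  B.indep.isProbabilityMeasure

/-- The path of a Brownian motion, extended by its initial value to negative times. -/
def BrownianMotion.path (B : BrownianMotion Ω P n) (ω : Ω) : ℝ → Fin n → ℝ :=
  fun s => B.W s.toNNReal ω

theorem BrownianMotion.measurable_path (B : BrownianMotion Ω P n) : Measurable B.path :=
  measurable_pi_lambda _ fun _ => B.measurable' _

theorem BrownianMotion.continuous_path (B : BrownianMotion Ω P n) (ω : Ω) :
    Continuous (B.path ω) :=
  (B.continuous' ω).comp continuous_real_toNNReal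

theorem BrownianMotion.gaussian_coord (B : BrownianMotion Ω P n) (j : Fin n) :
    IsGaussianProcess (fun s ω => B.W s ω j) P :=
  IsPreBrownianReal.isGaussianProcess (B.isBrownian j).toIsPreBrownianReal

/-- Independent Gaussian vectors are jointly Gaussian; the map `L` only exchanges the indices of
coordinate and time. -/
theorem BrownianMotion.gaussian (B : BrownianMotion Ω P n) :
    IsGaussianProcess B.W P where
  hasGaussianLaw I := by
    have hind := B.indep.comp (fun j (f : ℝ≥0 → ℝ) => I.restrict f)
      (fun j => Finset.measurable_restrict I)
    have h := hind.hasGaussianLaw (fun j => (B.gaussian_coord j).hasGaussianLaw I)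
    let L : (Fin n → I → ℝ) →L[ℝ] (I → Fin n → ℝ) :=
      { toFun x s j := x j s
        map_add' x y := rfl
        map_smul' c x := rfl }
    exact h.map L

theorem BrownianMotion.covariance (B : BrownianMotion Ω P n) (s u : ℝ≥0) (j k : Fin n) :
    cov[fun ω => B.W s ω j, fun ω => B.W u ω k; P] = if j = k then ((min s u : ℝ≥0) : ℝ) else 0 := by
  have := B.isProbabilityMeasure
  split_ifs with h
  · subst h
    exact_mod_cast (B.isBrownian j).covariance_eval s u
  · have hs : Measurable fun f : ℝ≥0 → ℝ => f s := measurable_pi_apply s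
    have hu : Measurable fun f : ℝ≥0 → ℝ => f u := measurable_pi_apply u
    have hind := (B.indep.indepFun h).comp hs hu
    exact hind.covariance_eq_zero
      ((B.gaussian_coord j).hasGaussianLaw_eval s).memLp_two
      ((B.gaussian_coord k).hasGaussianLaw_eval u).memLp_two

/-- A projection of a Brownian motion to a unit vector is independent of the rest. -/
theorem BrownianMotion.indepFun_proj (B : BrownianMotion Ω P n) (e : Fin n → ℝ)
    (he : ∑ j, e j ^ 2 = 1) :
    IndepFun (fun ω (s : ℝ) => e ⬝ᵥ B.path ω s)
      (fun ω (s : ℝ) => B.path ω s - (e ⬝ᵥ B.path ω s) • e) P := by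
  have := B.isProbabilityMeasure
  -- The projection is first kept as a vector along `e`, so that it forms a single Gaussian process
  -- with the remainder, indexed by `ℝ ⊕ ℝ`.
  let Y : ℝ → Ω → Fin n → ℝ := fun s ω => (e ⬝ᵥ B.path ω s) • e
  let R : ℝ → Ω → Fin n → ℝ := fun s ω => B.path ω s - (e ⬝ᵥ B.path ω s) • e
  let L : (Fin n → ℝ) →L[ℝ] (Fin n → ℝ) := LinearMap.toContinuousLinearMap
    { toFun x := (e ⬝ᵥ x) • e
      map_add' x y := by simp [dotProduct_add, add_smul]
      map_smul' c x := by simp [dotProduct_smul, smul_smul] }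
  have hG : IsGaussianProcess (Sum.elim Y R) P := by
    let idx : ℝ ⊕ ℝ → ℝ≥0 := Sum.elim Real.toNNReal Real.toNNReal
    let LL : ℝ ⊕ ℝ → (Fin n → ℝ) →L[ℝ] (Fin n → ℝ) :=
      Sum.elim (fun _ => L) (fun _ => ContinuousLinearMap.id ℝ _ - L)
    have hE : Sum.elim Y R = fun p ω => LL p ((B.W ∘ idx) p ω) := by
      funext p ω
      rcases p with s | s <;> rfl
    rw [hE]
    exact (B.gaussian.comp_right idx).comp_left LL
  have hm : ∀ s, Measurable fun ω => e ⬝ᵥ B.path ω s := fun s =>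
    (continuous_const.dotProduct continuous_id).measurable.comp (B.measurable' _)
  have hmY : ∀ s, Measurable (Y s) := fun s => (hm s).smul_const e
  have hmR : ∀ s, Measurable (R s) := fun s => (B.measurable' _).sub (hmY s)
  have hL2 : ∀ s j, MemLp (fun ω => B.W s ω j) 2 P := fun s j =>
    ((B.gaussian_coord j).hasGaussianLaw_eval s).memLp_two
  have hlin : ∀ (K : StrongDual ℝ (Fin n → ℝ)), ∃ b : Fin n → ℝ, ∀ x, K x = ∑ j, b j * x j := by
    intro K
    refine ⟨fun j => K (Pi.single j 1), fun x => ?_⟩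
    conv_lhs => rw [pi_eq_sum_univ' x]
    simp [map_sum, mul_comm]
  have hcov : ∀ (s u : ℝ≥0) (b c : Fin n → ℝ),
      cov[fun ω => ∑ j, b j * B.W s ω j, fun ω => ∑ j, c j * B.W u ω j; P] =
        (min s u : ℝ≥0) * ∑ j, b j * c j := by
    intro s u b c
    rw [covariance_fun_sum_fun_sum (fun j => (hL2 s j).const_mul _)
      (fun j => (hL2 u j).const_mul _)]
    simp_rw [covariance_const_mul_left, covariance_const_mul_right, B.covariance]
    simp [Finset.mul_sum]
    refine Finset.sum_congr rfl fun j _ => by ring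
  -- Jointly Gaussian processes are independent as soon as they are uncorrelated. For functionals
  -- `K₁` and `K₂` the covariance is `min s u` times `K₁ e * (K₂ e - K₂ e * ∑ j, e j ^ 2)`, which
  -- vanishes as `e` is a unit vector.
  have hI : IndepFun (fun ω s => Y s ω) (fun ω s => R s ω) P := by
    refine hG.indepFun_of_covariance_strongDual (fun s => (hmY s).aemeasurable)
      (fun s => (hmR s).aemeasurable) fun s u K₁ K₂ => ?_
    obtain ⟨b, hb⟩ := hlin K₁
    obtain ⟨c, hc⟩ := hlin K₂
    have h1 : K₁ ∘ Y s = fun ω => ∑ j, (K₁ e * e j) * B.W s.toNNReal ω j := by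
      ext ω
      simp only [Function.comp, Y, map_smul, smul_eq_mul, dotProduct, BrownianMotion.path,
        Finset.sum_mul]
      exact Finset.sum_congr rfl fun j _ => by ring
    have h2 : K₂ ∘ R u = fun ω => ∑ j, (c j - K₂ e * e j) * B.W u.toNNReal ω j := by
      ext ω
      simp only [Function.comp, R, map_sub, map_smul, smul_eq_mul]
      rw [hc (B.path ω u), dotProduct, Finset.sum_mul, ← Finset.sum_sub_distrib]
      exact Finset.sum_congr rfl fun j _ => by simp only [BrownianMotion.path]; ring
    rw [h1, h2, hcov]
    have h3 : ∑ j, K₁ e * e j * (c j - K₂ e * e j) =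
        K₁ e * (∑ j, c j * e j - K₂ e * ∑ j, e j ^ 2) := by
      rw [Finset.mul_sum, ← Finset.sum_sub_distrib, Finset.mul_sum]
      exact Finset.sum_congr rfl fun j _ => by ring
    rw [h3, he, hc e]
    ring
  have h := hI.comp (φ := fun (f : ℝ → Fin n → ℝ) s => e ⬝ᵥ f s) (ψ := id)
    (measurable_pi_lambda _ fun s => (continuous_const.dotProduct continuous_id).measurable.comp
      (measurable_pi_apply s)) measurable_id
  have hee : e ⬝ᵥ e = 1 := by
    rw [← he, dotProduct]
    exact Finset.sum_congr rfl fun j _ => by ring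
  have hE : (fun ω (s : ℝ) => e ⬝ᵥ B.path ω s) =
      (fun (f : ℝ → Fin n → ℝ) s => e ⬝ᵥ f s) ∘ fun ω s => Y s ω := by
    ext ω s
    simp only [Function.comp, Y, dotProduct_smul, smul_eq_mul, hee, mul_one]
  rw [hE]
  exact h

/-- The supremum norm is at most the sum of the `|W j|`, and `|y| ≤ 1 + y²` reduces each term to the
variance. A crude bound suffices, as only integrability over the horizon is needed. -/
theorem BrownianMotion.integral_norm_le (B : BrownianMotion Ω P n) (s : ℝ) :
    Integrable (fun ω => ‖B.path ω s‖) P ∧ ∫ ω, ‖B.path ω s‖ ∂P ≤ n * (1 + |s|) := by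
  have := B.isProbabilityMeasure
  have hint : ∀ j, Integrable (fun ω => B.W s.toNNReal ω j) P := fun j =>
    ((B.gaussian_coord j).hasGaussianLaw_eval _).integrable
  have hL2 : ∀ j, MemLp (fun ω => B.W s.toNNReal ω j) 2 P := fun j =>
    ((B.gaussian_coord j).hasGaussianLaw_eval _).memLp_two
  have hle : ∀ ω, ‖B.path ω s‖ ≤ ∑ j, |B.W s.toNNReal ω j| := fun ω =>
    (pi_norm_le_iff_of_nonneg (Finset.sum_nonneg fun j _ => abs_nonneg _)).2 fun j =>
      Finset.single_le_sum (f := fun j => |B.W s.toNNReal ω j|) (fun j _ => abs_nonneg _)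
        (Finset.mem_univ j)
  have hsum : Integrable (fun ω => ∑ j, |B.W s.toNNReal ω j|) P :=
    integrable_finsetSum _ fun j _ => (hint j).abs
  have hI : Integrable (fun ω => ‖B.path ω s‖) P :=
    hsum.mono' (B.measurable' _).norm.aestronglyMeasurable
      (ae_of_all _ fun ω => by simpa using hle ω)
  refine ⟨hI, (integral_mono hI hsum hle).trans ?_⟩
  rw [integral_finsetSum _ fun j _ => (hint j).abs]
  have hj : ∀ j, ∫ ω, |B.W s.toNNReal ω j| ∂P ≤ 1 + |s| := by
    intro j
    have hsq : ∫ ω, (B.W s.toNNReal ω j) ^ 2 ∂P = s.toNNReal := by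
      have h1 := B.covariance s.toNNReal s.toNNReal j j
      rw [covariance_self (hint j).aemeasurable, variance_eq_sub (hL2 j)] at h1
      have h0 : ∫ ω, B.W s.toNNReal ω j ∂P = 0 := (B.isBrownian j).integral_eval _
      simpa [h0] using h1
    calc ∫ ω, |B.W s.toNNReal ω j| ∂P ≤ ∫ ω, (1 + (B.W s.toNNReal ω j) ^ 2) ∂P := by
          refine integral_mono (hint j).abs ((integrable_const 1).add (hL2 j).integrable_sq) ?_
          intro ω
          simp only
          nlinarith [sq_nonneg (|B.W s.toNNReal ω j| - 1), sq_abs (B.W s.toNNReal ω j),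
            abs_nonneg (B.W s.toNNReal ω j)]
      _ = 1 + s.toNNReal := by
          rw [integral_add (integrable_const 1) (hL2 j).integrable_sq, hsq]
          simp
      _ ≤ 1 + |s| := by
          rw [Real.coe_toNNReal']
          gcongr
          exact max_le (le_abs_self s) (abs_nonneg s)
  calc ∑ j, ∫ ω, |B.W s.toNNReal ω j| ∂P ≤ ∑ _j : Fin n, (1 + |s|) :=
        Finset.sum_le_sum fun j _ => hj j
    _ = n * (1 + |s|) := by simp [mul_add]

end Brownian

end Dispatch

/-! ### The demand as a functional of the Brownian path. -/

namespace Dispatch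

theorem ouPath_map {E F : Type*} [NormedAddCommGroup E] [NormedSpace ℝ E] [CompleteSpace E]
    [NormedAddCommGroup F] [NormedSpace ℝ F] [CompleteSpace F] (L : E →L[ℝ] F) (γ t : ℝ) (z : E)
    {B : ℝ → E} (hB : Continuous B) (s : ℝ) :
    ouPath γ t (L z) (fun u => L (B u)) s = L (ouPath γ t z B s) := by
  have hint : IntervalIntegrable (fun u => Real.exp (-γ * (s - u)) • (B u - B t)) volume t s :=
    (by fun_prop : Continuous _).intervalIntegrable _ _
  simp only [ouPath, map_add, map_sub, map_smul, ← L.intervalIntegral_comp_comm hint]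

theorem norm_ouPath_le {E : Type*} [NormedAddCommGroup E] [NormedSpace ℝ E] {γ t s : ℝ}
    (hγ : 0 ≤ γ) (hts : t ≤ s) (z : E) {B : ℝ → E} (hB : Continuous B) :
    ‖ouPath γ t z B s‖ ≤ ‖z‖ + ‖B s‖ + ‖B t‖ + γ * ∫ u in t..s, (‖B u‖ + ‖B t‖) := by
  have hexp : ∀ u ≤ s, Real.exp (-γ * (s - u)) ≤ 1 := fun u hu =>
    Real.exp_le_one_iff.2 (by nlinarith)
  have h1 : ‖Real.exp (-γ * (s - t)) • z‖ ≤ ‖z‖ := by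
    rw [norm_smul, Real.norm_eq_abs, Real.abs_exp]
    exact mul_le_of_le_one_left (norm_nonneg _) (hexp t hts)
  have h2 : ‖∫ u in t..s, Real.exp (-γ * (s - u)) • (B u - B t)‖ ≤
      ∫ u in t..s, (‖B u‖ + ‖B t‖) := by
    refine intervalIntegral.norm_integral_le_of_norm_le hts ?_ ?_
    · refine Eventually.of_forall fun u hu => ?_
      rw [norm_smul, Real.norm_eq_abs, Real.abs_exp]
      exact (mul_le_of_le_one_left (norm_nonneg _) (hexp u hu.2)).trans (norm_sub_le _ _)
    · exact (by fun_prop : Continuous fun u => ‖B u‖ + ‖B t‖).intervalIntegrable _ _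
  calc ‖ouPath γ t z B s‖ ≤ ‖Real.exp (-γ * (s - t)) • z + (B s - B t)‖ +
        ‖γ • ∫ u in t..s, Real.exp (-γ * (s - u)) • (B u - B t)‖ := norm_sub_le _ _
    _ ≤ (‖z‖ + (‖B s‖ + ‖B t‖)) + γ * ∫ u in t..s, (‖B u‖ + ‖B t‖) := by
        refine add_le_add ((norm_add_le _ _).trans (add_le_add h1 (norm_sub_le _ _))) ?_
        rw [norm_smul, Real.norm_eq_abs, abs_of_nonneg hγ]
        exact mul_le_mul_of_nonneg_left h2 hγ
    _ = _ := by ring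

/-- The coordinate filtration on paths. -/
def pathFiltration (T : ℝ) (n : ℕ) :
    Filtration ℝ (MeasurableSpace.pi : MeasurableSpace (ℝ → Fin n → ℝ)) :=
  generatedFiltration T (fun s w => w s) fun s => measurable_pi_apply s

theorem measurable_generatedFiltration {Ω E : Type*} [MeasurableSpace Ω] [MeasurableSpace E]
    {T : ℝ} {Y : ℝ → Ω → E} (hY : ∀ s, Measurable (Y s)) {s u : ℝ} (hs : s ∈ Icc 0 T)
    (hsu : s ≤ u) : Measurable[generatedFiltration T Y hY u] (Y s) :=
  measurable_iff_comap_le.2 (le_iSup₂_of_le s ⟨hs, hsu⟩ le_rfl)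

theorem measurable_pathFiltration_eval (T : ℝ) (n : ℕ) {s u : ℝ} (hs : s ∈ Icc 0 T)
    (hsu : s ≤ u) : Measurable[pathFiltration T n u] fun w : ℝ → Fin n → ℝ => w s :=
  measurable_iff_comap_le.2 (le_iSup₂_of_le (f := fun s (_ : s ∈ Icc 0 T ∩ Iic u) =>
    MeasurableSpace.comap (fun w : ℝ → Fin n → ℝ => w s) MeasurableSpace.pi) s ⟨hs, hsu⟩ le_rfl)

section Demand

variable {Ω : Type*} [mΩ : MeasurableSpace Ω] {P : Measure Ω} {nG nL nc Nη : ℕ}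
  {d : SystemData nG nL nc} {η : Directions nG nL Nη} (B : BrownianMotion Ω P nL)

/-- The demand at time `s` is a functional of the Brownian path on `[0, s]`. Hence controls adapted
to the demand are adapted to the path; the converse inclusion is not needed. -/
theorem demandFiltration_le (u : ℝ) :
    demandFiltration d B u ≤ (pathFiltration d.T nL u).comap B.path := by
  refine iSup₂_le fun s hs => ?_
  rw [← measurable_iff_comap_le]
  have hmul : Continuous fun y : Fin nL → ℝ => d.σ.mulVec y :=
    continuous_const.matrix_mulVec continuous_id
  -- The noise is stopped at `s` and frozen before `0`. All its values are then known at time `u`,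
  -- while the solution at `s` is unchanged.
  let Bs : ℝ → Ω → Fin nL → ℝ := fun v ω => d.σ.mulVec (B.path ω (max (min v s) 0))
  have hmeas : ∀ v, Measurable[(pathFiltration d.T nL u).comap B.path] (Bs v) := by
    intro v
    have hmem : max (min v s) 0 ∈ Icc 0 d.T :=
      ⟨le_max_right _ _, max_le ((min_le_right _ _).trans hs.1.2) (hs.1.1.trans hs.1.2)⟩
    have hle : max (min v s) 0 ≤ u := (max_le (min_le_right _ _) hs.1.1).trans hs.2
    have h1 : Measurable[pathFiltration d.T nL u] fun w : ℝ → Fin nL → ℝ => w (max (min v s) 0) :=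
      measurable_pathFiltration_eval d.T nL hmem hle
    have h2 : Measurable[(pathFiltration d.T nL u).comap B.path, pathFiltration d.T nL u] B.path :=
      measurable_iff_comap_le.2 le_rfl
    have h3 : Measurable[(pathFiltration d.T nL u).comap B.path]
      fun ω => B.path ω (max (min v s) 0) := h1.comp h2
    exact hmul.measurable.comp h3
  have hcont : ∀ ω, Continuous fun v => Bs v ω := fun ω =>
    hmul.comp ((B.continuous_path ω).comp (by fun_prop))
  have key := @ouPath_measurable Ω ((pathFiltration d.T nL u).comap B.path) nL d.γ 0 s
    (d.x₀ - d.m 0) Bs hmeas hcont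
  have heq : demand d B 0 d.x₀ s =
      fun ω => d.m s + ouPath d.γ 0 (d.x₀ - d.m 0) (fun u => Bs u ω) s := by
    ext1 ω
    have hv : ∀ v ∈ Icc 0 s, Bs v ω = d.σ.mulVec (B.W v.toNNReal ω) := by
      intro v hv
      simp only [Bs, min_eq_left hv.2, max_eq_left hv.1, BrownianMotion.path]
    simp only [demand, ouPath]
    rw [hv s ⟨hs.1.1, le_rfl⟩, hv 0 ⟨le_rfl, hs.1.1⟩]
    congr 3
    apply intervalIntegral.integral_congr
    intro v hv'
    rw [uIcc_of_le hs.1.1] at hv'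
    simp only [hv v hv']
  rw [heq]
  exact measurable_const.add key

/-- The unit vector along which the Brownian motion is projected. -/
noncomputable def projDir (d : SystemData nG nL nc) (η : Directions nG nL Nη) : Fin nL → ℝ :=
  (volη d η)⁻¹ • Matrix.vecMul η.ηL d.σ

/-- As `σ` is invertible, `ηLᵀ σ = 0` would force `ηL = 0`, against the normalization. -/
theorem volη_pos (hd : d.Valid) (hη : η.Valid) : 0 < volη d η := by
  refine Real.sqrt_pos.2 ?_
  have hne : Matrix.vecMul η.ηL d.σ ≠ 0 := by
    intro h0
    have h1 : Matrix.vecMul (Matrix.vecMul η.ηL d.σ) d.σ⁻¹ = η.ηL := by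
      rw [Matrix.vecMul_vecMul, Matrix.mul_nonsing_inv _ hd.volatility_nonsingular,
        Matrix.vecMul_one]
    rw [h0, Matrix.zero_vecMul] at h1
    have := hη.normalized
    rw [← h1] at this
    simp at this
  obtain ⟨j, hj⟩ := Function.ne_iff.1 hne
  exact Finset.sum_pos' (fun j _ => sq_nonneg _) ⟨j, Finset.mem_univ _, by
    have : Matrix.vecMul η.ηL d.σ j ≠ 0 := hj
    positivity⟩

theorem sum_sq_projDir (hd : d.Valid) (hη : η.Valid) : ∑ j, projDir d η j ^ 2 = 1 := by
  have hv := volη_pos hd hη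
  have hsq : volη d η ^ 2 = ∑ j, (Matrix.vecMul η.ηL d.σ) j ^ 2 :=
    Real.sq_sqrt (Finset.sum_nonneg fun j _ => sq_nonneg _)
  simp only [projDir, Pi.smul_apply, smul_eq_mul, mul_pow, ← Finset.mul_sum, ← hsq]
  field_simp

theorem Wη_eq (s : ℝ) (ω : Ω) : Wη d η B s ω = projDir d η ⬝ᵥ B.path ω s := by
  simp [Wη, projDir, BrownianMotion.path, Matrix.dotProduct_mulVec]

/-- The equation is linear, so `ηL` commutes with the solution map (`ouPath_map`). The identity
holds for every `ω`, and both problems are thereby posed on the same scenarios. -/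
theorem demandη_eq (hd : d.Valid) (hη : η.Valid) (t : ℝ) (x : Fin nL → ℝ) (s : ℝ) (ω : Ω) :
    demandη d η B t (η.ηL ⬝ᵥ x) s ω = η.ηL ⬝ᵥ demand d B t x s ω := by
  have hv := volη_pos hd hη
  let L : (Fin nL → ℝ) →L[ℝ] ℝ := LinearMap.toContinuousLinearMap
    { toFun y := η.ηL ⬝ᵥ y
      map_add' x y := dotProduct_add _ _ _
      map_smul' c x := dotProduct_smul _ _ _ }
  have hmul : Continuous fun y : Fin nL → ℝ => d.σ.mulVec y :=
    continuous_const.matrix_mulVec continuous_id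
  have h := ouPath_map L d.γ t (x - d.m t) (B := fun u => d.σ.mulVec (B.W u.toNNReal ω))
    (hmul.comp (B.continuous_path ω)) s
  have hL : ∀ y, L y = η.ηL ⬝ᵥ y := fun y => rfl
  simp only [hL] at h
  rw [demandη, demand, dotProduct_add, ← h, dotProduct_sub]
  congr 2
  ext u
  rw [Wη]
  field_simp

/-- Replacing the projection of the driving path preserves adaptedness. -/
theorem measurable_replaceProj (w : ℝ → Fin nL → ℝ) (u : ℝ) :
    Measurable[filtrationη d η B u, pathFiltration d.T nL u]
      fun ω s => Wη d η B s ω • projDir d η + w s := by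
  rw [measurable_iff_comap_le]
  change MeasurableSpace.comap _ (⨆ s ∈ Icc 0 d.T ∩ Iic u, _) ≤ _
  simp only [MeasurableSpace.comap_iSup, MeasurableSpace.comap_comp]
  refine iSup₂_le fun s hs => ?_
  rw [← measurable_iff_comap_le]
  exact ((measurable_generatedFiltration (Wη_measurable d η B) hs.1 hs.2).smul_const _).add_const _

/-- The demand, with the forecast extended constantly outside the horizon. -/
noncomputable def demandExt (d : SystemData nG nL nc) (B : BrownianMotion Ω P nL) (t : ℝ)
    (x : Fin nL → ℝ) (s : ℝ) (ω : Ω) : Fin nL → ℝ :=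
  d.m (max 0 (min d.T s)) +
    ouPath d.γ t (x - d.m t) (fun u => d.σ.mulVec (B.W u.toNNReal ω)) s

theorem demandExt_eq {t s : ℝ} (hs : s ∈ Icc 0 d.T) (x : Fin nL → ℝ) (ω : Ω) :
    demandExt d B t x s ω = demand d B t x s ω := by
  rw [demandExt, demand, min_eq_right hs.2, max_eq_right hs.1]

/-- A process that is continuous in time and measurable in `ω` is jointly measurable. The forecast
is regular only on the horizon, which is why the extended version is used. -/
theorem measurable_demandExt (hd : d.Valid) (hT : 0 ≤ d.T) (t : ℝ) (x : Fin nL → ℝ) :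
    Measurable fun p : ℝ × Ω => demandExt d B t x p.1 p.2 := by
  have hmul : Continuous fun y : Fin nL → ℝ => d.σ.mulVec y :=
    continuous_const.matrix_mulVec continuous_id
  have hm : Continuous fun s => d.m (max 0 (min d.T s)) := by
    refine hd.forecast_smooth.continuousOn.comp_continuous (by fun_prop) fun s => ?_
    exact ⟨le_max_left _ _, max_le hT (min_le_left _ _)⟩
  refine measurable_uncurry_of_continuous_of_measurable (u := demandExt d B t x) (fun ω => ?_)
    fun s => ?_
  · exact hm.add (ouPath_continuous _ _ _ (hmul.comp (B.continuous_path ω)))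
  · exact measurable_const.add (ouPath_measurable d.γ t s _
      (fun u ω => d.σ.mulVec (B.W u.toNNReal ω))
      (fun u => hmul.measurable.comp (B.measurable' _))
      fun ω => hmul.comp (B.continuous_path ω))

theorem integrable_norm_path (T : ℝ) :
    Integrable (fun p : ℝ × Ω => ‖B.path p.2 p.1‖) ((volume.restrict (Ioc 0 T)).prod P) := by
  have := B.isProbabilityMeasure
  have hm : Measurable fun p : ℝ × Ω => B.path p.2 p.1 :=
    measurable_uncurry_of_continuous_of_measurable (u := fun s ω => B.path ω s)
      (fun ω => B.continuous_path ω) fun s => B.measurable' _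
  refine (integrable_prod_iff hm.norm.aestronglyMeasurable).2
    ⟨ae_of_all _ fun s => (B.integral_norm_le s).1, ?_⟩
  simp only [norm_norm]
  refine (integrable_const ((nL : ℝ) * (1 + T))).mono'
    hm.norm.stronglyMeasurable.integral_prod_right.aestronglyMeasurable ?_
  filter_upwards [ae_restrict_mem measurableSet_Ioc] with s hs
  rw [Real.norm_of_nonneg (integral_nonneg fun ω => norm_nonneg _)]
  refine (B.integral_norm_le s).2.trans ?_
  rw [abs_of_pos hs.1]
  gcongr
  exact hs.2

/-- Combined with the linear growth of the costs, this yields one integrable bound for all controls.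
-/
theorem integrable_norm_demandExt (hd : d.Valid) {t : ℝ} (ht : t ∈ Icc 0 d.T) (x : Fin nL → ℝ) :
    Integrable (fun p : ℝ × Ω => ‖demandExt d B t x p.1 p.2‖)
      ((volume.restrict (Ioc t d.T)).prod P) := by
  have := B.isProbabilityMeasure
  have hT : 0 ≤ d.T := ht.1.trans ht.2
  let L : (Fin nL → ℝ) →L[ℝ] (Fin nL → ℝ) := LinearMap.toContinuousLinearMap d.σ.mulVecLin
  have hL : ∀ y, L y = d.σ.mulVec y := fun y => rfl
  obtain ⟨M, hM⟩ := isCompact_Icc.exists_bound_of_continuousOn hd.forecast_smooth.continuousOn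
  have hpath := integrable_norm_path B d.T
  have hJ : Integrable (fun ω => ∫ u in Ioc 0 d.T, ‖B.path ω u‖) P := hpath.integral_prod_right
  have hpath' : Integrable (fun p : ℝ × Ω => ‖B.path p.2 p.1‖)
      ((volume.restrict (Ioc t d.T)).prod P) :=
    hpath.mono_measure (Measure.prod_mono (Measure.restrict_mono (Ioc_subset_Ioc_left ht.1) le_rfl)
      le_rfl)
  -- The terms are those of `norm_ouPath_le`, with the integral over `[t, s]` enlarged to the whole
  -- horizon so that it no longer depends on `s`.
  have hdom : Integrable (fun p : ℝ × Ω => M + ‖x - d.m t‖ + ‖L‖ * ‖B.path p.2 p.1‖ +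
      ((‖L‖ + d.γ * ‖L‖ * d.T) * ‖B.path p.2 t‖ +
        d.γ * ‖L‖ * ∫ u in Ioc 0 d.T, ‖B.path p.2 u‖)) ((volume.restrict (Ioc t d.T)).prod P) := by
    refine ((integrable_const _).add (hpath'.const_mul _)).add ?_
    exact (((B.integral_norm_le t).1.const_mul _).add (hJ.const_mul _)).comp_snd _
  refine hdom.mono' (measurable_demandExt B hd hT t x).norm.aestronglyMeasurable ?_
  have hmem : ∀ᵐ p : ℝ × Ω ∂((volume.restrict (Ioc t d.T)).prod P), p.1 ∈ Ioc t d.T :=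
    Measure.quasiMeasurePreserving_fst.ae (ae_restrict_mem measurableSet_Ioc)
  filter_upwards [hmem] with p hp
  obtain ⟨s, ω⟩ := p
  simp only at hp
  rw [norm_norm]
  have hcB : Continuous fun u => L (B.path ω u) := L.continuous.comp (B.continuous_path ω)
  have hcN : Continuous fun u => ‖B.path ω u‖ := (B.continuous_path ω).norm
  have h1 := norm_ouPath_le hd.reversion_nonneg hp.1.le (x - d.m t) hcB
  have hs : s ∈ Icc 0 d.T := ⟨ht.1.trans hp.1.le, hp.2⟩
  have hint : ∫ u in t..s, (‖L (B.path ω u)‖ + ‖L (B.path ω t)‖) ≤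
      ‖L‖ * (∫ u in Ioc 0 d.T, ‖B.path ω u‖) + d.T * (‖L‖ * ‖B.path ω t‖) := by
    have h2 : ∫ u in t..s, (‖L (B.path ω u)‖ + ‖L (B.path ω t)‖) ≤
        ∫ u in t..s, (‖L‖ * ‖B.path ω u‖ + ‖L‖ * ‖B.path ω t‖) := by
      refine intervalIntegral.integral_mono_on hp.1.le ?_ ?_ fun u _ =>
        add_le_add (L.le_opNorm _) (L.le_opNorm _)
      · exact (hcB.norm.add continuous_const).intervalIntegrable _ _
      · exact (by fun_prop : Continuous _).intervalIntegrable _ _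
    refine h2.trans ?_
    rw [intervalIntegral.integral_add ((by fun_prop : Continuous _).intervalIntegrable _ _)
      ((by fun_prop : Continuous _).intervalIntegrable _ _), intervalIntegral.integral_const_mul,
      intervalIntegral.integral_const, smul_eq_mul, intervalIntegral.integral_of_le hp.1.le]
    refine add_le_add (mul_le_mul_of_nonneg_left ?_ (norm_nonneg _))
      (mul_le_mul_of_nonneg_right (by linarith [hp.2, ht.1]) (by positivity))
    refine setIntegral_mono_set ?_ (ae_of_all _ fun u => norm_nonneg _)
      (Ioc_subset_Ioc ht.1 hp.2).eventuallyLE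
    exact (hcN.integrableOn_Icc (a := 0) (b := d.T)).mono_set Ioc_subset_Icc_self
  have h3 : ‖d.m (max 0 (min d.T s))‖ ≤ M := by
    rw [min_eq_right hs.2, max_eq_right hs.1]
    exact hM s hs
  have h4 : ‖demandExt d B t x s ω‖ ≤ M + ‖ouPath d.γ t (x - d.m t)
      (fun u => L (B.path ω u)) s‖ := (norm_add_le _ _).trans (add_le_add_left h3 _)
  have h5 := mul_le_mul_of_nonneg_left hint hd.reversion_nonneg
  have h6 := L.le_opNorm (B.path ω s)
  have h7 := L.le_opNorm (B.path ω t)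
  simp only
  linarith [h1, h4, h5, h6, h7]

end Demand

end Dispatch

/-! ### Adapted extension to arbitrary paths. -/

namespace Dispatch

/-- An adapted discrete control on a set of paths extends to an adapted control on all paths. -/
theorem exists_adapted_extension {Ω 𝕎 L : Type*} (path : Ω → 𝕎) {𝓖 : ℕ → MeasurableSpace 𝕎}
    (hmono : Monotone 𝓖) [Countable L] [MeasurableSpace L] [DiscreteMeasurableSpace L] [Nonempty L]
    {trunc : ℕ → L → L} (htrunc : ∀ i j l, trunc i (trunc j l) = trunc (min i j) l) {K : ℕ}
    (hK : ∀ l, trunc K l = l) {c : Ω → L}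
    (hc : ∀ k, Measurable[(𝓖 k).comap path] fun ω => trunc k (c ω)) :
    ∃ c' : 𝕎 → L, (∀ k, Measurable[𝓖 k] fun w => trunc k (c' w)) ∧ ∀ ω, c' (path ω) = c ω := by
  classical
  -- Factorization through `path` at each level. The functions `g k` agree with the truncations of
  -- `c` on actual paths, but need not be consistent with one another elsewhere.
  have hg : ∀ k, ∃ g : 𝕎 → L, Measurable[𝓖 k] g ∧ (fun ω => trunc k (c ω)) = g ∘ path := fun k =>
    @Measurable.exists_eq_measurable_comp Ω 𝕎 L (𝓖 k) path _ _ _ _ (hc k)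
  choose g hgm hgp using hg
  -- The next truncation is accepted only if it extends what has been decided so far; otherwise the
  -- control makes no further request at this step. This restores consistency on all paths without
  -- using the future.
  let step : ℕ → (𝕎 → L) → 𝕎 → L := fun k ek w =>
    if trunc k (g (k + 1) w) = ek w then trunc (k + 1) (g (k + 1) w) else ek w
  let e : ℕ → 𝕎 → L := fun k =>
    Nat.rec (motive := fun _ => 𝕎 → L) (fun w => trunc 0 (g 0 w)) step k
  have e_succ : ∀ (k : ℕ) (w : 𝕎), e (k + 1) w =
      if trunc k (g (k + 1) w) = e k w then trunc (k + 1) (g (k + 1) w) else e k w :=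
    fun k w => rfl
  have h1 : ∀ (k : ℕ) (w : 𝕎), trunc k (e k w) = e k w ∧ trunc k (e (k + 1) w) = e k w := by
    intro k
    induction k with
    | zero =>
      intro w
      have h0 : trunc 0 (e 0 w) = e 0 w := by
        change trunc 0 (trunc 0 (g 0 w)) = trunc 0 (g 0 w)
        rw [htrunc]; simp
      refine ⟨h0, ?_⟩
      rw [e_succ]
      split_ifs with h
      · rw [htrunc]; simpa using h
      · exact h0
    | succ k ih =>
      intro w
      have h0 : trunc (k + 1) (e (k + 1) w) = e (k + 1) w := by
        rw [e_succ]
        split_ifs with h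
        · rw [htrunc]; simp
        · rw [← (ih w).1, htrunc]; simp
      refine ⟨h0, ?_⟩
      rw [e_succ (k + 1)]
      split_ifs with h
      · rw [htrunc]; simpa using h
      · exact h0
  have h2 : ∀ (k : ℕ) (w : 𝕎), ∀ j ≤ k, trunc j (e k w) = e j w := by
    intro k w
    induction k with
    | zero =>
      intro j hj
      obtain rfl : j = 0 := by omega
      exact (h1 0 w).1
    | succ k ih =>
      intro j hj
      rcases hj.eq_or_lt with rfl | hlt
      · exact (h1 _ w).1
      · have hjk : j ≤ k := by omega
        rw [← ih j hjk, ← (h1 k w).2, htrunc, min_eq_left hjk]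
  have h3 : ∀ k, Measurable[𝓖 k] (e k) := by
    intro k
    induction k with
    | zero => exact (Measurable.of_discrete (f := trunc 0)).comp (hgm 0)
    | succ k ih =>
      have ih' : Measurable[𝓖 (k + 1)] (e k) := ih.mono (hmono k.le_succ) le_rfl
      have hm1 : Measurable[𝓖 (k + 1)] fun w => (g (k + 1) w, e k w) := (hgm _).prodMk ih'
      exact (Measurable.of_discrete (f := fun p : L × L =>
        if trunc k p.1 = p.2 then trunc (k + 1) p.1 else p.2)).comp hm1
  -- On actual paths the test always succeeds, so the recursion reproduces `c`.
  have h4 : ∀ k ω, e k (path ω) = trunc k (c ω) := by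
    intro k ω
    have hgk : ∀ k, g k (path ω) = trunc k (c ω) := fun k => (congrFun (hgp k) ω).symm
    induction k with
    | zero =>
      change trunc 0 (g 0 (path ω)) = _
      rw [hgk, htrunc]; simp
    | succ k ih =>
      rw [e_succ, hgk, ih, htrunc, htrunc]
      simp
  refine ⟨e K, fun k => ?_, fun ω => by rw [h4, hK]⟩
  rcases le_total k K with h | h
  · have : (fun w => trunc k (e K w)) = e k := funext fun w => h2 K w k h
    rw [this]
    exact h3 k
  · have : (fun w => trunc k (e K w)) = e K := funext fun w => by
      rw [← hK (e K w), htrunc, min_eq_right h]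
    rw [this]
    exact (h3 K).mono (hmono h) le_rfl

/-! ### Controls given by lists of grid indices and requests. -/

section Lists

/-- In a sorted list, cutting at the first large entry amounts to filtering each entry on its own,
so truncations can be examined index by index. -/
theorem getElem?_takeWhile_of_sorted {β : Type*} (k : ℕ) {l : List (ℕ × β)}
    (hl : l.Pairwise fun x y => x.1 ≤ y.1) (j : ℕ) :
    (l.takeWhile fun x => decide (x.1 ≤ k))[j]? = l[j]?.filter fun x => decide (x.1 ≤ k) := by
  induction l generalizing j with
  | nil => simp
  | cons x l ih =>
    rw [List.pairwise_cons] at hl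
    by_cases hx : x.1 ≤ k
    · rw [List.takeWhile_cons_of_pos (by simpa using hx)]
      cases j with
      | zero => simp [hx, Option.filter]
      | succ j => simpa using ih hl.2 j
    · rw [List.takeWhile_cons_of_neg (by simpa using hx)]
      cases j with
      | zero => simp [hx, Option.filter]
      | succ j =>
        rcases hlj : l[j]? with _ | y
        · simp [hlj]
        · have := hl.1 y (List.mem_of_getElem? hlj)
          have hy : ¬ y.1 ≤ k := by omega
          simp [hlj, hy, Option.filter]

variable {Ω : Type*} {nG nL nc : ℕ}

/-- The control with requests at times on a grid that is given by lists of grid indices and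
requests; `b₀` is a default value. -/
def listControl (t h : ℝ) (b₀ : Switch nG) (c : Ω → List (ℕ × Switch nG)) : Control Ω nG where
  N ω := (c ω).length
  τ j ω := t + h * ((c ω)[j]?.getD (0, b₀)).1
  β j ω := ((c ω)[j]?.getD (0, b₀)).2

/-- The lists that describe admissible controls. -/
def validLists (d : SystemData nG nL nc) (t : ℝ) (a : Fin nG → GenMode) (r : Fin nG → ℝ) (h : ℝ)
    (b₀ : Switch nG) : Set (List (ℕ × Switch nG)) :=
  {l | PathValid d t a r l.length (fun j => t + h * (l[j]?.getD (0, b₀)).1)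
    fun j => (l[j]?.getD (0, b₀)).2}

variable {d : SystemData nG nL nc} {t : ℝ} {a : Fin nG → GenMode} {r : Fin nG → ℝ} {h : ℝ}
  {b₀ : Switch nG}

instance : MeasurableSpace (validLists d t a r h b₀) := ⊤

instance : DiscreteMeasurableSpace (validLists d t a r h b₀) := ⟨fun _ => trivial⟩

theorem finite_allowed (hd : d.Valid) : {b : Switch nG | (b.src, b.dst) ∈ d.Λ b.gen}.Finite := by
  have hf : (⋃ k : Fin nG, (fun e : ℝ × ℝ => Switch.mk k e.1 e.2) ''
      ((d.Θ k : Set ℝ) ×ˢ (d.Θ k : Set ℝ))).Finite :=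
    Set.finite_iUnion fun k => (((d.Θ k).finite_toSet).prod ((d.Θ k).finite_toSet)).image _
  refine hf.subset fun b hb => mem_iUnion.2 ⟨b.gen, (b.src, b.dst), ?_, rfl⟩
  exact hd.allowed_subset _ _ hb

theorem allowed_of_mem_validLists {l : List (ℕ × Switch nG)} (hl : l ∈ validLists d t a r h b₀)
    {x : ℕ × Switch nG} (hx : x ∈ l) : (x.2.src, x.2.dst) ∈ d.Λ x.2.gen := by
  obtain ⟨j, hj, rfl⟩ := List.getElem_of_mem hx
  have := hl.allowed j hj
  simpa [hj] using this

/-- The entries come from grid indices and the finitely many allowed transitions. Countability is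
what allows the discrete σ-algebra on lists. -/
theorem countable_validLists (hd : d.Valid) : (validLists d t a r h b₀).Countable := by
  have hS : (Set.univ ×ˢ {b : Switch nG | (b.src, b.dst) ∈ d.Λ b.gen} :
      Set (ℕ × Switch nG)).Countable := countable_univ.prod (finite_allowed hd).countable
  have := hS.to_subtype
  have h1 := countable_range (List.map ((↑) : (Set.univ ×ˢ {b : Switch nG |
    (b.src, b.dst) ∈ d.Λ b.gen} : Set (ℕ × Switch nG)) → ℕ × Switch nG))
  rw [Set.range_list_map_coe] at h1
  refine h1.mono fun l hl => ?_
  exact fun x hx => ⟨trivial, allowed_of_mem_validLists hl hx⟩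

theorem nil_mem_validLists : [] ∈ validLists d t a r h b₀ where
  time_mem _ hj := absurd hj (Nat.not_lt_zero _)
  mono _ _ _ hj := absurd hj (Nat.not_lt_zero _)
  allowed _ hj := absurd hj (Nat.not_lt_zero _)
  next _ _ _ hj := absurd hj (Nat.not_lt_zero _)
  first _ hj := absurd hj (Nat.not_lt_zero _)

instance : Nonempty (validLists d t a r h b₀) := ⟨⟨[], nil_mem_validLists⟩⟩

theorem sorted_of_mem_validLists (hh : 0 < h) {l : List (ℕ × Switch nG)}
    (hl : l ∈ validLists d t a r h b₀) : l.Pairwise fun x y => x.1 ≤ y.1 := by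
  rw [List.pairwise_iff_getElem]
  intro i j hi hj hij
  have := hl.mono i j hij.le hj
  simp only [hi, hj, List.getElem?_eq_getElem, Option.getD_some, add_le_add_iff_left] at this
  exact_mod_cast le_of_mul_le_mul_left this hh

theorem takeWhile_mem_validLists (p : ℕ × Switch nG → Bool) {l : List (ℕ × Switch nG)}
    (hl : l ∈ validLists d t a r h b₀) : l.takeWhile p ∈ validLists d t a r h b₀ := by
  have hpre := List.takeWhile_prefix p (l := l)
  refine (PathValid.take hl hpre.length_le).congr ?_ ?_ <;>
  · intro j hj
    simp only [List.getElem?_eq_getElem hj, List.getElem?_eq_getElem (hj.trans_le hpre.length_le),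
      Option.getD_some, hpre.getElem hj]

/-- The part of a list that concerns the grid points up to `k`. -/
def truncList (k : ℕ) (l : validLists d t a r h b₀) : validLists d t a r h b₀ :=
  ⟨l.1.takeWhile fun x => decide (x.1 ≤ k), takeWhile_mem_validLists _ l.2⟩

theorem truncList_truncList (i j : ℕ) (l : validLists d t a r h b₀) :
    truncList i (truncList j l) = truncList (min i j) l := by
  apply Subtype.ext
  simp only [truncList, List.takeWhile_takeWhile]
  congr 1
  ext x
  simp

theorem getElem?_truncList (hh : 0 < h) (k : ℕ) (l : validLists d t a r h b₀) (j : ℕ) :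
    (truncList k l).1[j]? = l.1[j]?.filter fun x => decide (x.1 ≤ k) :=
  getElem?_takeWhile_of_sorted k (sorted_of_mem_validLists hh l.2) j

theorem time_le_of_mem_validLists {l : List (ℕ × Switch nG)} (hl : l ∈ validLists d t a r h b₀)
    {j : ℕ} {x : ℕ × Switch nG} (hx : l[j]? = some x) : t + h * x.1 ≤ d.T := by
  obtain ⟨hj, rfl⟩ := List.getElem?_eq_some_iff.1 hx
  have := (hl.time_mem j hj).2
  simpa [hj] using this

theorem grid_le_iff (hh : 0 < h) {s : ℝ} (hs : t ≤ s) (i : ℕ) :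
    t + h * i ≤ s ↔ i ≤ ⌊(s - t) / h⌋₊ := by
  rw [Nat.le_floor_iff (div_nonneg (by linarith) hh.le), le_div_iff₀ hh]
  constructor <;> intro h <;> linarith

/-- All requests of a valid list are made by time `T`, so finitely many levels suffice in
`exists_adapted_extension`. -/
theorem truncList_horizon (hh : 0 < h) (ht : t ≤ d.T) (l : validLists d t a r h b₀) :
    truncList ⌊(d.T - t) / h⌋₊ l = l := by
  apply Subtype.ext
  refine List.ext_getElem? fun j => ?_
  rw [getElem?_truncList hh]
  rcases hx : l.1[j]? with _ | x
  · rfl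
  · have := (grid_le_iff hh ht x.1).1 (time_le_of_mem_validLists l.2 hx)
    simp [this]

theorem listControl_validAt (c : Ω → validLists d t a r h b₀) (ω : Ω) :
    (listControl t h b₀ fun ω => (c ω).1).ValidAt d t a r ω :=
  (c ω).2

/-- Turns events about the padded sequences `τ` and `β` into events about entries that exist, so
that the default `b₀` plays no role. -/
theorem listControl_lt_iff (c : Ω → validLists d t a r h b₀) (j : ℕ) (ω : Ω)
    (Q : ℝ → Switch nG → Prop) :
    (j < (listControl t h b₀ fun ω => (c ω).1).N ω ∧
      Q ((listControl t h b₀ fun ω => (c ω).1).τ j ω)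
        ((listControl t h b₀ fun ω => (c ω).1).β j ω)) ↔
    ∃ x, (c ω).1[j]? = some x ∧ Q (t + h * x.1) x.2 := by
  simp only [listControl]
  constructor
  · rintro ⟨hj, hQ⟩
    rw [List.getElem?_eq_getElem hj] at hQ
    exact ⟨_, List.getElem?_eq_getElem hj, hQ⟩
  · rintro ⟨x, hx, hQ⟩
    obtain ⟨hj, -⟩ := List.getElem?_eq_some_iff.1 hx
    refine ⟨hj, ?_⟩
    rw [hx]
    exact hQ

theorem timeOrTop_le_iff (N : Ω → ℕ) (τ : ℕ → Ω → ℝ) (j : ℕ) (s : ℝ) (ω : Ω) :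
    timeOrTop N τ j ω ≤ (s : WithTop ℝ) ↔ j < N ω ∧ τ j ω ≤ s := by
  unfold timeOrTop
  split_ifs with hj <;> simp [hj]

variable [mΩ : MeasurableSpace Ω] {𝓕 : Filtration ℝ mΩ}

/-- A property of the `j`-th request is known once the request is made. -/
theorem measurableSet_request (hh : 0 < h) {c : Ω → validLists d t a r h b₀}
    (hc : ∀ k : ℕ, Measurable[𝓕 (t + h * k)] fun ω => truncList k (c ω)) (j : ℕ) (s : ℝ)
    (Q : ℕ × Switch nG → Prop) :
    MeasurableSet[𝓕 s] {ω | ∃ x, (c ω).1[j]? = some x ∧ t + h * x.1 ≤ s ∧ Q x} := by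
  rcases lt_or_ge s t with hs | hs
  · convert MeasurableSet.empty
    ext ω
    simp only [Set.mem_ofPred_eq, mem_empty_iff_false, iff_false]
    rintro ⟨x, -, hx, -⟩
    have : 0 ≤ h * x.1 := by positivity
    linarith
  -- Between grid points nothing new is requested, so information at the last grid point up to `s`
  -- is enough.
  · have hk := (grid_le_iff hh hs ⌊(s - t) / h⌋₊).2 le_rfl
    have hset : {ω | ∃ x, (c ω).1[j]? = some x ∧ t + h * x.1 ≤ s ∧ Q x} =
        (fun ω => truncList ⌊(s - t) / h⌋₊ (c ω)) ⁻¹' {l | ∃ x, l.1[j]? = some x ∧ Q x} := by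
      ext ω
      simp only [Set.mem_ofPred_eq, mem_preimage, getElem?_truncList hh, grid_le_iff hh hs,
        Option.filter_eq_some_iff, decide_eq_true_eq]
      exact ⟨fun ⟨x, h1, h2, h3⟩ => ⟨x, ⟨h1, h2⟩, h3⟩, fun ⟨x, ⟨h1, h2⟩, h3⟩ => ⟨x, h1, h2, h3⟩⟩
    rw [hset]
    exact 𝓕.mono hk _ (hc _ (MeasurableSet.of_discrete))

/-- Adapted lists of requests give admissible requests. -/
theorem listControl_isAdmissible (hd : d.Valid) (hh : 0 < h) {c : Ω → validLists d t a r h b₀}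
    (hc : ∀ k : ℕ, Measurable[𝓕 (t + h * k)] fun ω => truncList k (c ω)) :
    (listControl t h b₀ fun ω => (c ω).1).IsAdmissible d 𝓕
      (((listControl t h b₀ fun ω => (c ω).1).withDelays d t a r).mode a) t := by
  have hst : ∀ j, IsStoppingTime 𝓕 (timeOrTop (listControl t h b₀ fun ω => (c ω).1).N
      (listControl t h b₀ fun ω => (c ω).1).τ j) := by
    intro j s
    simp only [timeOrTop_le_iff, listControl_lt_iff c j _ fun u _ => u ≤ s]
    simpa using measurableSet_request hh hc j s fun _ => True
  refine ⟨fun ω j hj => (listControl_validAt c ω).time_mem j hj,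
    fun ω i j hij hj => (listControl_validAt c ω).mono i j hij hj,
    fun ω i j hij hj hk => (listControl_validAt c ω).strict hd hij hj hk, hst, ?_,
    fun ω j hj => (listControl_validAt c ω).request hd hj⟩
  intro j b
  have h1 := fun s => measurableSet_request hh hc j s fun x => x.2 = b
  -- Membership in the stopping σ-algebra has two parts: measurability for the join of the
  -- filtration, which follows from time `T` since every request is made by then, and measurability
  -- of the intersections with the events that the request is made by time `s`.
  refine ⟨?_, fun s => ?_⟩
  · have hT := le_iSup (fun s => (𝓕 s : MeasurableSpace Ω)) d.T _ (h1 d.T)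
    convert hT using 1
    ext ω
    refine (listControl_lt_iff c j ω fun _ b' => b' = b).trans ?_
    exact exists_congr fun x => and_congr_right fun hx =>
      (and_iff_right (time_le_of_mem_validLists (c ω).2 hx)).symm
  · convert h1 s using 1
    ext ω
    simp only [mem_inter_iff, Set.mem_ofPred_eq, timeOrTop_le_iff]
    refine Iff.trans ?_ (listControl_lt_iff c j ω fun u b' => u ≤ s ∧ b' = b)
    tauto

end Lists

/-! ### Grid controls in the relaxed problem. -/

section Relaxed

variable {Ω : Type*} [mΩ : MeasurableSpace Ω] {P : Measure Ω} {nG nL nc Nη : ℕ}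
  {d : SystemData nG nL nc} {η : Directions nG nL Nη} {B : BrownianMotion Ω P nL} {t : ℝ}
  {a : Fin nG → GenMode} {r : Fin nG → ℝ} {h : ℝ} {b₀ : Switch nG}

/-- Execution of all transitions after their durations is admissible in the relaxed problem. -/
theorem listControl_isAdmissibleη (hd : d.Valid) (hr : r ∈ d.H a) (hh : 0 < h)
    {c : Ω → validLists d t a r h b₀}
    (hc : ∀ k : ℕ, Measurable[filtrationη d η B (t + h * k)] fun ω => truncList k (c ω)) :
    ((listControl t h b₀ fun ω => (c ω).1).withDelays d t a r).IsAdmissibleη d η B t a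
      (∑ k, r k) := by
  refine ⟨listControl_isAdmissible hd hh hc, ?_, fun _ _ _ _ => isStoppingTime_const _ _, ?_, ?_, ?_⟩
  · intro k l m hk ω
    have := hr k
    rw [hk] at this
    simp only at this
    simp only [Control.withDelays, hk, SystemData.modeDelay]
    linarith
  · intro ω j hj
    exact le_add_of_nonneg_right ((listControl_validAt c ω).delay_pos hd hj).le
  · intro j s
    have h1 := measurableSet_request hh hc j s fun x => t + h * x.1 + d.delay x.2 ≤ s
    convert h1 using 1
    ext ω
    refine (timeOrTop_le_iff _ _ j s ω).trans
      ((listControl_lt_iff c j ω fun u b => u + d.delay b ≤ s).trans ?_)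
    -- Durations are positive, so a transition completed by time `s` was requested by time `s` and
    -- its execution time is known.
    refine exists_congr fun x => and_congr_right fun hx => (and_iff_right_of_imp fun hle => ?_).symm
    have := hd.delay_pos _ _ (allowed_of_mem_validLists (c ω).2 (List.mem_of_getElem? hx))
    change 0 < d.delay x.2 at this
    linarith
  · intro ω s hs
    have hv := listControl_validAt c ω
    -- The total is a sum of progressions, each between zero and the duration of its transition.
    rw [hv.total_eq hd hr hs.1]
    have hH := Control.progress_mem (v := listControl t h b₀ fun ω => (c ω).1) (d := d) (a := a)
      (ω := ω) hr hs.1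
    refine ⟨Finset.sum_nonneg fun k _ => ?_, Finset.sum_le_sum fun k _ => ?_⟩
    · have := hH k
      split at this
      · exact this.ge
      · exact this.1
    · have := hH k
      split at this
      · rename_i l hl
        rw [hl, this]
        exact le_rfl
      · rename_i l m hl
        rw [hl]
        exact this.2.le

end Relaxed

end Dispatch

/-! ### Discretization of a control by postponing its requests. -/

namespace Dispatch

section Discretize

variable {Ω : Type*} {nG nL nc : ℕ}

/-- Grid index of the postponed `j`-th request. -/
noncomputable def gridIdx (t h : ℝ) (v : Control Ω nG) (j : ℕ) (ω : Ω) : ℕ :=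
  ⌈(v.τ j ω - t) / h⌉₊ + j

/-- The requests of a control, with the `j`-th one postponed to the next grid point and then
by `j` more grid points. -/
noncomputable def gridList (t h : ℝ) (v : Control Ω nG) (ω : Ω) : List (ℕ × Switch nG) :=
  (List.range (v.N ω)).map fun j => (gridIdx t h v j ω, v.β j ω)

/-- The postponed requests up to time `T`. -/
noncomputable def discList (T t h : ℝ) (v : Control Ω nG) (ω : Ω) : List (ℕ × Switch nG) :=
  (gridList t h v ω).takeWhile fun x => decide (x.1 ≤ ⌊(T - t) / h⌋₊)

variable {d : SystemData nG nL nc} {t : ℝ} {a : Fin nG → GenMode} {r : Fin nG → ℝ} {h : ℝ}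
  {b₀ : Switch nG} {v : Control Ω nG} {ω : Ω}

theorem getElem?_gridList (j : ℕ) : (gridList t h v ω)[j]? =
    if j < v.N ω then some (gridIdx t h v j ω, v.β j ω) else none := by
  unfold gridList
  split_ifs with hj <;> simp [hj]

theorem Control.ValidAt.sorted_gridList (hv : v.ValidAt d t a r ω) (hh : 0 < h) :
    (gridList t h v ω).Pairwise fun x y => x.1 ≤ y.1 := by
  rw [List.pairwise_iff_getElem]
  intro i j hi hj hij
  simp only [gridList, List.length_map, List.length_range] at hi hj
  simp only [gridList, List.getElem_map, List.getElem_range, gridIdx]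
  have : v.τ i ω ≤ v.τ j ω := hv.mono i j hij.le hj
  gcongr

theorem Control.ValidAt.getElem?_discList (hv : v.ValidAt d t a r ω) (hh : 0 < h) (j : ℕ) :
    (discList d.T t h v ω)[j]? = if j < v.N ω ∧ gridIdx t h v j ω ≤ ⌊(d.T - t) / h⌋₊
      then some (gridIdx t h v j ω, v.β j ω) else none := by
  rw [discList, getElem?_takeWhile_of_sorted _ (hv.sorted_gridList hh), getElem?_gridList]
  by_cases hj : j < v.N ω <;>
    by_cases hi : gridIdx t h v j ω ≤ ⌊(d.T - t) / h⌋₊ <;> simp [hj, hi, Option.filter]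

theorem Control.ValidAt.lt_length_discList (hv : v.ValidAt d t a r ω) (hh : 0 < h)
    (htT : t ≤ d.T) (j : ℕ) :
    j < (discList d.T t h v ω).length ↔ j < v.N ω ∧ t + h * gridIdx t h v j ω ≤ d.T := by
  rw [grid_le_iff hh htT]
  have h1 := hv.getElem?_discList hh j
  constructor
  · intro hj
    by_contra hc
    rw [if_neg hc, List.getElem?_eq_getElem hj] at h1
    exact absurd h1 (by simp)
  · intro hc
    rw [if_pos hc] at h1
    exact (List.getElem?_eq_some_iff.1 h1).1

theorem Control.ValidAt.discList_getD (hv : v.ValidAt d t a r ω) (hh : 0 < h) {j : ℕ}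
    (hj : j < (discList d.T t h v ω).length) :
    (discList d.T t h v ω)[j]?.getD (0, b₀) = (gridIdx t h v j ω, v.β j ω) := by
  have h1 := hv.getElem?_discList hh j
  rw [h1]
  split_ifs at h1 with hc
  · simp [hc]
  · rw [List.getElem?_eq_getElem hj] at h1
    exact absurd h1 (by simp)

theorem le_grid_time (hh : 0 < h) (j : ℕ) : v.τ j ω ≤ t + h * gridIdx t h v j ω := by
  have h1 := Nat.le_ceil ((v.τ j ω - t) / h)
  rw [div_le_iff₀ hh] at h1
  have h2 : (0 : ℝ) ≤ h * j := by positivity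
  simp only [gridIdx, Nat.cast_add]
  linarith

/-- For a fixed request the postponement is at most `j + 1` meshes and hence tends to zero with the
mesh. -/
theorem grid_time_le (hh : 0 < h) {j : ℕ} (hj : t ≤ v.τ j ω) :
    t + h * gridIdx t h v j ω ≤ v.τ j ω + h * (j + 1) := by
  have h1 := (Nat.ceil_lt_add_one (div_nonneg (sub_nonneg.2 hj) hh.le)).le
  have h2 := mul_le_mul_of_nonneg_left h1 hh.le
  have h3 : h * ((v.τ j ω - t) / h) = v.τ j ω - t := by field_simp
  simp only [gridIdx, Nat.cast_add]
  linarith [mul_add h ((v.τ j ω - t) / h) 1]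

theorem Control.ValidAt.discList_mem (hv : v.ValidAt d t a r ω) (hh : 0 < h) (htT : t ≤ d.T) :
    discList d.T t h v ω ∈ validLists d t a r h b₀ := by
  have hlen : (discList d.T t h v ω).length ≤ v.N ω := by
    by_contra! hc
    exact absurd ((hv.lt_length_discList hh htT _).1 hc).1 (lt_irrefl _)
  have hpost : PathValid d t a r (discList d.T t h v ω).length
      (fun j => t + h * gridIdx t h v j ω) fun j => v.β j ω := by
    -- Rounding up may shorten the gap between two requests by at most one mesh; request `j` is
    -- shifted at least one mesh more than request `i < j`, which makes up for it. Hence gaps never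
    -- shrink and `postpone` applies.
    refine (PathValid.take hv hlen).postpone (fun j _ => le_grid_time hh j)
      (fun j hj => ((hv.lt_length_discList hh htT j).1 hj).2) fun i j hij hj => ?_
    have h1 := grid_time_le (v := v) (ω := ω) (h := h) hh
      (hv.time_mem i ((hij.trans hj).trans_le hlen)).1
    have h2 : v.τ j ω + h * j ≤ t + h * gridIdx t h v j ω := by
      have h1 := Nat.le_ceil ((v.τ j ω - t) / h)
      rw [div_le_iff₀ hh] at h1
      simp only [gridIdx, Nat.cast_add]
      linarith
    have h3 : (i : ℝ) + 1 ≤ j := by exact_mod_cast hij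
    have h4 := mul_le_mul_of_nonneg_left h3 hh.le
    linarith
  refine PathValid.congr hpost ?_ ?_ <;>
  · intro j hj
    simp only [hv.discList_getD hh hj]

/-! ### Adaptedness of the discretized control. -/

section Measurability

variable [mΩ : MeasurableSpace Ω] {𝓕 : Filtration ℝ mΩ} {α : ℝ → Ω → Fin nG → GenMode}

/-- The postponed request falls at or before grid point `i` iff the original one is made by grid
point `i - j`, an event known by then. If `i < j` it cannot occur, since grid indices of the `j`-th
request are at least `j`; this also covers truncated subtraction. -/
theorem Control.IsAdmissible.measurableSet_gridIdx_le (hv : v.IsAdmissible d 𝓕 α t)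
    (hh : 0 < h) (j i : ℕ) (b : Switch nG) :
    MeasurableSet[𝓕 (t + h * i)] {ω | j < v.N ω ∧ gridIdx t h v j ω ≤ i ∧ v.β j ω = b} := by
  by_cases hji : j ≤ i
  · have h1 := (hv.known j b).2 (t + h * ((i - j : ℕ) : ℝ))
    have hle : t + h * ((i - j : ℕ) : ℝ) ≤ t + h * i := by
      gcongr
      exact Nat.sub_le _ _
    convert 𝓕.mono hle _ h1 using 1
    ext ω
    have : gridIdx t h v j ω ≤ i ↔ v.τ j ω ≤ t + h * ((i - j : ℕ) : ℝ) := by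
      have h2 : gridIdx t h v j ω ≤ i ↔ ⌈(v.τ j ω - t) / h⌉₊ ≤ i - j := by
        unfold gridIdx; omega
      rw [h2, Nat.ceil_le, div_le_iff₀ hh]
      constructor <;> intro h <;> linarith
    simp only [Set.mem_ofPred_eq, mem_inter_iff, timeOrTop_le_iff, this]
    tauto
  · convert MeasurableSet.empty
    ext ω
    simp only [Set.mem_ofPred_eq, mem_empty_iff_false, iff_false]
    rintro ⟨-, h1, -⟩
    unfold gridIdx at h1
    omega

theorem Control.IsAdmissible.measurableSet_gridIdx_eq (hv : v.IsAdmissible d 𝓕 α t)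
    (hh : 0 < h) (j i : ℕ) (b : Switch nG) :
    MeasurableSet[𝓕 (t + h * i)] {ω | j < v.N ω ∧ gridIdx t h v j ω = i ∧ v.β j ω = b} := by
  have h1 := hv.measurableSet_gridIdx_le hh j i b
  rcases i with _ | i
  · simpa using h1
  · have hle : t + h * (i : ℝ) ≤ t + h * ((i + 1 : ℕ) : ℝ) := by
      gcongr
      exact Nat.le_succ i
    have h2 := 𝓕.mono hle _ (hv.measurableSet_gridIdx_le hh j i b)
    convert h1.diff h2 using 1
    ext ω
    simp only [Set.mem_ofPred_eq, Set.mem_sdiff]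
    constructor
    · rintro ⟨h1, h2, h3⟩
      exact ⟨⟨h1, h2.le, h3⟩, fun hc => by omega⟩
    · rintro ⟨⟨h1, h2, h3⟩, h4⟩
      refine ⟨h1, ?_, h3⟩
      by_contra hc
      exact h4 ⟨h1, by omega, h3⟩

/-- There are countably many lists, so it suffices that each value is attained on a measurable
event; such an event is an intersection of conditions on single entries. -/
theorem Control.IsAdmissible.measurable_truncList (hd : d.Valid)
    (hv : v.IsAdmissible d 𝓕 ((v.withDelays d t a r).mode a) t) (hh : 0 < h) (htT : t ≤ d.T)
    (k : ℕ) :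
    Measurable[𝓕 (t + h * k)] fun ω => truncList k
      (⟨discList d.T t h v ω, (hv.validAt ω).discList_mem hh htT⟩ :
        validLists d t a r h b₀) := by
  have := (countable_validLists (t := t) (a := a) (r := r) (h := h) (b₀ := b₀) hd).to_subtype
  refine @measurable_to_countable' _ _ _ _ (𝓕 (t + h * k)) _ fun l => ?_
  set K := min k ⌊(d.T - t) / h⌋₊ with hK
  have hset : (fun ω => truncList k
      (⟨discList d.T t h v ω, (hv.validAt ω).discList_mem hh htT⟩ :
        validLists d t a r h b₀)) ⁻¹' {l} =
      ⋂ j : ℕ, {ω | (if j < v.N ω ∧ gridIdx t h v j ω ≤ K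
        then some (gridIdx t h v j ω, v.β j ω) else none) = l.1[j]?} := by
    ext ω
    simp only [mem_preimage, mem_singleton_iff, mem_iInter, Set.mem_ofPred_eq]
    rw [Subtype.ext_iff, List.ext_getElem?_iff]
    refine forall_congr' fun j => ?_
    rw [getElem?_truncList hh, (hv.validAt ω).getElem?_discList hh]
    have : (if j < v.N ω ∧ gridIdx t h v j ω ≤ ⌊(d.T - t) / h⌋₊
        then some (gridIdx t h v j ω, v.β j ω) else none).filter (fun x => decide (x.1 ≤ k)) =
        if j < v.N ω ∧ gridIdx t h v j ω ≤ K
          then some (gridIdx t h v j ω, v.β j ω) else none := by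
      by_cases h1 : j < v.N ω <;> by_cases h2 : gridIdx t h v j ω ≤ ⌊(d.T - t) / h⌋₊ <;>
        by_cases h3 : gridIdx t h v j ω ≤ k <;> simp [h1, h2, h3, hK, Option.filter]
    rw [this]
  rw [hset]
  refine MeasurableSet.iInter fun j => ?_
  have hmono : ∀ i ≤ K, t + h * (i : ℝ) ≤ t + h * k := by
    intro i hi
    have : i ≤ k := hi.trans (min_le_left _ _)
    gcongr
  -- A missing entry means that the original request is not made by grid point `K - j`, the
  -- complement of a stopping event. A present entry fixes both grid index and request.
  rcases hl : l.1[j]? with _ | x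
  · have h1 := hv.stopping j (t + h * ((K - j : ℕ) : ℝ))
    have hKk := hmono (K - j) (Nat.sub_le _ _)
    have h2 := 𝓕.mono hKk _ h1
    by_cases hjK : j ≤ K
    · convert h2.compl using 1
      ext ω
      have : gridIdx t h v j ω ≤ K ↔ v.τ j ω ≤ t + h * ((K - j : ℕ) : ℝ) := by
        have h2 : gridIdx t h v j ω ≤ K ↔ ⌈(v.τ j ω - t) / h⌉₊ ≤ K - j := by
          unfold gridIdx; omega
        rw [h2, Nat.ceil_le, div_le_iff₀ hh]
        constructor <;> intro h <;> linarith
      simp only [Set.mem_ofPred_eq, mem_compl_iff, timeOrTop_le_iff, this]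
      split_ifs with hc <;> simp [hc]
    · convert MeasurableSet.univ
      ext ω
      have : ¬ gridIdx t h v j ω ≤ K := by
        unfold gridIdx
        omega
      simp [not_le.1 this]
  · by_cases hx : x.1 ≤ K
    · convert 𝓕.mono (hmono _ hx) _ (hv.measurableSet_gridIdx_eq hh j x.1 x.2) using 1
      ext ω
      simp only [Set.mem_ofPred_eq]
      split_ifs with hc
      · simp only [Option.some.injEq, Prod.ext_iff, hc.1, true_and]
      · simp only [false_iff]
        rintro ⟨h1, h2, h3⟩
        exact hc ⟨h1, h2.le.trans hx⟩
    · convert MeasurableSet.empty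
      ext ω
      simp only [Set.mem_ofPred_eq, mem_empty_iff_false, iff_false]
      split_ifs with hc
      · intro h1
        simp only [Option.some.injEq] at h1
        exact hx (h1 ▸ hc.2)
      · simp

end Measurability

/-! ### Convergence of the production as the mesh tends to zero. -/

section Convergence

/-- The production of a generator in the transition `e` (completed or not), as a function of the
time since the request. -/
def SystemData.ramp (d : SystemData nG nL nc) (k : Fin nG) (e : ℝ × ℝ) (u : ℝ) : ℝ :=
  d.θT k e (min u (d.δ k e))

theorem SystemData.Valid.continuousOn_ramp (hd : d.Valid) {k : Fin nG} {e : ℝ × ℝ}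
    (he : e ∈ d.Λ k) : ContinuousOn (d.ramp k e) (Ici 0) :=
  (hd.ramp_continuous k e he).comp (by fun_prop) fun _ hu =>
    ⟨le_min hu (hd.delay_pos k e he).le, min_le_right _ _⟩

/-- The mode jumps when a transition is completed, but the production does not, since the ramp ends
at the target level. After a request the production is thus a single continuous function of the
elapsed time. -/
theorem Control.ValidAt.production_of_coe (hv : v.ValidAt d t a r ω) (hd : d.Valid) {s : ℝ}
    {j : ℕ} (hj : j < v.N ω) (hl : v.last (v.β j ω).gen s ω = j) :
    d.production ((v.withDelays d t a r).mode a s ω) (v.progress d t a r s ω) (v.β j ω).gen =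
      d.ramp (v.β j ω).gen ((v.β j ω).src, (v.β j ω).dst) (s - v.τ j ω) := by
  have hΛ := hv.allowed j hj
  unfold SystemData.production SystemData.ramp
  rw [Control.mode_withDelays_of_coe hl, Control.progress_of_coe hl]
  by_cases hs : s < v.τ j ω + d.delay (v.β j ω)
  · rw [if_pos hs, if_pos hs]
    have : s - v.τ j ω ≤ d.δ (v.β j ω).gen ((v.β j ω).src, (v.β j ω).dst) := by
      unfold SystemData.delay at hs
      linarith
    rw [min_eq_left this]
  · rw [if_neg hs, if_neg hs]
    have : d.δ (v.β j ω).gen ((v.β j ω).src, (v.β j ω).dst) ≤ s - v.τ j ω := by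
      unfold SystemData.delay at hs
      linarith
    rw [min_eq_right this]
    exact (hd.ramp_end _ _ hΛ).symm

/-- Away from the finitely many request times, the last request before `s` stays before `s` on fine
grids and its time converges, while later requests only move further away. -/
theorem Control.ValidAt.tendsto_production (hv : v.ValidAt d t a r ω) (hd : d.Valid)
    {hn : ℕ → ℝ} (hpos : ∀ n, 0 < hn n) (hlim : Tendsto hn atTop (𝓝 0)) {s : ℝ}
    (hs : s ∈ Icc t d.T) (hne : ∀ j < v.N ω, v.τ j ω ≠ s) :
    Tendsto (fun n => d.production
      (((listControl t (hn n) b₀ (discList d.T t (hn n) v)).withDelays d t a r).mode a s ω)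
      ((listControl t (hn n) b₀ (discList d.T t (hn n) v)).progress d t a r s ω)) atTop
      (𝓝 (d.production ((v.withDelays d t a r).mode a s ω) (v.progress d t a r s ω))) := by
  have htT := hs.1.trans hs.2
  have hτ : ∀ n j, j < (discList d.T t (hn n) v ω).length →
      (listControl t (hn n) b₀ (discList d.T t (hn n) v)).τ j ω =
        t + hn n * gridIdx t (hn n) v j ω ∧
      (listControl t (hn n) b₀ (discList d.T t (hn n) v)).β j ω = v.β j ω := by
    intro n j hj
    simp only [listControl, hv.discList_getD (hpos n) hj, and_self]
  have hlt : ∀ n j, j < (discList d.T t (hn n) v ω).length → j < v.N ω := fun n j hj =>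
    ((hv.lt_length_discList (hpos n) htT j).1 hj).1
  have htime : ∀ j < v.N ω, Tendsto (fun n => t + hn n * gridIdx t (hn n) v j ω) atTop
      (𝓝 (v.τ j ω)) := by
    intro j hj
    have h1 : Tendsto (fun n => v.τ j ω + hn n * ((j : ℝ) + 1)) atTop (𝓝 (v.τ j ω)) := by
      simpa using (hlim.mul_const ((j : ℝ) + 1)).const_add (v.τ j ω)
    exact tendsto_of_tendsto_of_tendsto_of_le_of_le tendsto_const_nhds h1
      (fun n => le_grid_time (hpos n) j) fun n => grid_time_le (hpos n) (hv.time_mem j hj).1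
  refine tendsto_pi_nhds.2 fun k => ?_
  rcases v.last_cases k s ω with ⟨hl, hno⟩ | ⟨j, hl, hj, hk, hjs, hno⟩
  · refine tendsto_const_nhds.congr fun n => ?_
    have hl' : (listControl t (hn n) b₀ (discList d.T t (hn n) v)).last k s ω = ⊥ := by
      refine Control.last_eq_bot fun i hi hik => ?_
      rw [(hτ n i hi).2] at hik
      rw [(hτ n i hi).1]
      exact (hno i (hlt n i hi) hik).trans_le (le_grid_time (hpos n) i)
    unfold SystemData.production
    rw [Control.mode_withDelays_of_bot hl, Control.mode_withDelays_of_bot hl',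
      Control.progress_of_bot hl, Control.progress_of_bot hl']
  · subst hk
    have hjs' : v.τ j ω < s := lt_of_le_of_ne hjs (hne j hj)
    -- Needed because the ramp is continuous only for nonnegative elapsed time; it also ensures that
    -- request `j` is not cut off at `T`.
    have hev : ∀ᶠ n in atTop, t + hn n * gridIdx t (hn n) v j ω < s :=
      (htime j hj).eventually_lt_const hjs'
    rw [hv.production_of_coe hd hj hl]
    have hcont : Tendsto (fun n => d.ramp (v.β j ω).gen ((v.β j ω).src, (v.β j ω).dst)
        (s - (t + hn n * gridIdx t (hn n) v j ω))) atTop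
        (𝓝 (d.ramp (v.β j ω).gen ((v.β j ω).src, (v.β j ω).dst) (s - v.τ j ω))) := by
      have h1 := hd.continuousOn_ramp (hv.allowed j hj) (s - v.τ j ω)
        (by simpa using hjs)
      refine h1.tendsto.comp (tendsto_nhdsWithin_iff.2 ⟨(htime j hj).const_sub s, ?_⟩)
      filter_upwards [hev] with n hn'
      simpa using hn'.le
    refine hcont.congr' ?_
    filter_upwards [hev] with n hn'
    have hjN : j < (discList d.T t (hn n) v ω).length :=
      (hv.lt_length_discList (hpos n) htT j).2 ⟨hj, hn'.le.trans hs.2⟩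
    have hv' : (listControl t (hn n) b₀ (discList d.T t (hn n) v)).ValidAt d t a r ω :=
      hv.discList_mem (hpos n) htT
    have hl' : (listControl t (hn n) b₀ (discList d.T t (hn n) v)).last (v.β j ω).gen s ω = j := by
      refine Control.last_eq_coe hjN (by rw [(hτ n j hjN).2]) ?_ fun i hi hji hik => ?_
      · rw [(hτ n j hjN).1]
        exact hn'.le
      · rw [(hτ n i hi).2] at hik
        rw [(hτ n i hi).1]
        exact (hno i (hlt n i hi) hji hik).trans_le (le_grid_time (hpos n) i)
    have := hv'.production_of_coe hd hjN (by rw [(hτ n j hjN).2]; exact hl')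
    rw [(hτ n j hjN).1, (hτ n j hjN).2] at this
    exact this.symm

end Convergence

/-! ### Switching costs: monotonicity, uniform bound, measurability. -/

section SwitchingCosts

theorem Control.ValidAt.switchingCosts_eq (hv : v.ValidAt d t a r ω) :
    v.switchingCosts d ω = ∑ j ∈ Finset.range (v.N ω), d.switchCost (v.β j ω) :=
  Finset.sum_congr rfl fun j hj => if_pos (hv.time_mem j (Finset.mem_range.1 hj)).2

theorem Control.ValidAt.switchCost_nonneg (hv : v.ValidAt d t a r ω) (hd : d.Valid) {j : ℕ}
    (hj : j < v.N ω) : 0 ≤ d.switchCost (v.β j ω) :=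
  hd.switchCost_nonneg _ _ (hv.allowed j hj)

theorem Control.ValidAt.switchingCosts_nonneg (hv : v.ValidAt d t a r ω) (hd : d.Valid) :
    0 ≤ v.switchingCosts d ω := by
  rw [hv.switchingCosts_eq]
  exact Finset.sum_nonneg fun j hj => hv.switchCost_nonneg hd (Finset.mem_range.1 hj)

/-- The requests are the same, except that those postponed beyond `T` are dropped, and costs are
nonnegative. -/
theorem Control.ValidAt.switchingCosts_discList_le (hv : v.ValidAt d t a r ω) (hd : d.Valid)
    (hh : 0 < h) (htT : t ≤ d.T) :
    (listControl t h b₀ (discList d.T t h v)).switchingCosts d ω ≤ v.switchingCosts d ω := by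
  have hv' : (listControl t h b₀ (discList d.T t h v)).ValidAt d t a r ω :=
    hv.discList_mem hh htT
  have hN : (listControl t h b₀ (discList d.T t h v)).N ω = (discList d.T t h v ω).length := rfl
  rw [hv'.switchingCosts_eq, hv.switchingCosts_eq, hN]
  have h1 : ∑ j ∈ Finset.range (discList d.T t h v ω).length,
      d.switchCost ((listControl t h b₀ (discList d.T t h v)).β j ω) =
      ∑ j ∈ Finset.range (discList d.T t h v ω).length, d.switchCost (v.β j ω) := by
    refine Finset.sum_congr rfl fun j hj => ?_
    simp only [listControl, hv.discList_getD hh (Finset.mem_range.1 hj)]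
  rw [h1]
  refine Finset.sum_le_sum_of_subset_of_nonneg (fun j hj => ?_) fun j hj _ =>
    hv.switchCost_nonneg hd (Finset.mem_range.1 hj)
  rw [Finset.mem_range] at hj ⊢
  exact ((hv.lt_length_discList hh htT j).1 hj).1

theorem SystemData.Valid.exists_min_delay (hd : d.Valid) :
    ∃ δ > 0, ∀ k, ∀ e ∈ d.Λ k, δ ≤ d.δ k e := by
  have hf := (finite_allowed hd).image d.delay
  by_cases hne : (d.delay '' {b : Switch nG | (b.src, b.dst) ∈ d.Λ b.gen}).Nonempty
  · obtain ⟨x, ⟨b, hb, rfl⟩, hmin⟩ := Set.exists_min_image _ id hf hne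
    refine ⟨d.delay b, hd.delay_pos _ _ hb, fun k e he => ?_⟩
    exact hmin _ ⟨⟨k, e.1, e.2⟩, he, rfl⟩
  · refine ⟨1, one_pos, fun k e he => ?_⟩
    exact absurd ⟨_, ⟨⟨k, e.1, e.2⟩, he, rfl⟩⟩ hne

theorem SystemData.Valid.exists_length_bound (hd : d.Valid) (t : ℝ) :
    ∃ M : ℕ, ∀ (a : Fin nG → GenMode) (r : Fin nG → ℝ) N τ β, PathValid d t a r N τ β → N ≤ M := by
  obtain ⟨δ, hδ0, hδ⟩ := hd.exists_min_delay
  exact ⟨_, fun a r N τ β h => h.length_le hδ0 hδ⟩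

theorem SystemData.Valid.exists_switchingCosts_bound (hd : d.Valid) (t : ℝ) :
    ∃ C, ∀ (a : Fin nG → GenMode) (r : Fin nG → ℝ) (v : Control Ω nG) (ω : Ω),
      v.ValidAt d t a r ω → v.switchingCosts d ω ≤ C := by
  obtain ⟨M, hM⟩ := hd.exists_length_bound t
  obtain ⟨K, hK⟩ := ((finite_allowed hd).image d.switchCost).bddAbove
  refine ⟨M * max K 0, fun a r v ω hv => ?_⟩
  rw [hv.switchingCosts_eq]
  calc ∑ j ∈ Finset.range (v.N ω), d.switchCost (v.β j ω)
      ≤ ∑ _j ∈ Finset.range (v.N ω), max K 0 := Finset.sum_le_sum fun j hj =>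
        (hK ⟨_, hv.allowed j (Finset.mem_range.1 hj), rfl⟩).trans (le_max_left _ _)
    _ = v.N ω * max K 0 := by simp
    _ ≤ M * max K 0 := by
        gcongr
        exact hM _ _ _ _ _ hv

/-- Admissibility provides the events that the `j`-th request exists and equals `b`. The random sum
is rewritten over such events, with fixed finite ranges for `j` and `b`. -/
theorem Control.IsAdmissible.measurable_switchingCosts [mΩ : MeasurableSpace Ω]
    {𝓕 : Filtration ℝ mΩ} (hd : d.Valid)
    (hv : v.IsAdmissible d 𝓕 ((v.withDelays d t a r).mode a) t) :
    Measurable (v.switchingCosts d) := by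
  classical
  obtain ⟨M, hM⟩ := hd.exists_length_bound t
  set S := (finite_allowed hd).toFinset
  have heq : v.switchingCosts d = fun ω => ∑ j ∈ Finset.range M, ∑ b ∈ S,
      if j < v.N ω ∧ v.β j ω = b then d.switchCost b else 0 := by
    ext ω
    have hva := hv.validAt ω
    rw [hva.switchingCosts_eq, ← Finset.sum_subset
      (Finset.range_subset_range.2 (hM _ _ _ _ _ hva))]
    · refine Finset.sum_congr rfl fun j hj => ?_
      rw [Finset.mem_range] at hj
      have hmem : v.β j ω ∈ S := by simpa [S] using hva.allowed j hj
      simp [hj, hmem]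
    · intro j _ hj
      rw [Finset.mem_range] at hj
      exact Finset.sum_eq_zero fun b _ => if_neg fun hc => hj hc.1
  rw [heq]
  refine Finset.measurable_sum _ fun j _ => Finset.measurable_sum _ fun b _ => ?_
  have hm : MeasurableSet {ω | j < v.N ω ∧ v.β j ω = b} :=
    (hv.stopping j).measurableSpace_le _ (hv.known j b)
  exact Measurable.ite hm measurable_const measurable_const

end SwitchingCosts

end Discretize

end Dispatch

/-! ### Measurability in time of modes, progressions and costs. -/

namespace Dispatch

theorem measurable_of_countable_index {ι α β : Type*} [Countable ι] [MeasurableSpace α]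
    [MeasurableSpace β] {m : α → ι} {F : ι → α → β} (hm : ∀ i, MeasurableSet (m ⁻¹' {i}))
    (hF : ∀ i, Measurable (F i)) : Measurable fun z => F (m z) z := by
  intro S hS
  have : (fun z => F (m z) z) ⁻¹' S = ⋃ i, m ⁻¹' {i} ∩ F i ⁻¹' S := by
    ext z
    simp
  rw [this]
  exact MeasurableSet.iUnion fun i => (hm i).inter (hF i hS)

section Modes

variable {Ω : Type*} {nG nL nc Nη : ℕ} {d : SystemData nG nL nc} {t : ℝ} {a : Fin nG → GenMode}
  {r : Fin nG → ℝ}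

instance : MeasurableSpace GenMode := ⊤

theorem SystemData.finite_modes (d : SystemData nG nL nc) (hd : d.Valid) : d.modes.Finite := by
  have hf : ∀ k, (GenMode.steady '' (d.Θ k : Set ℝ) ∪
      (fun e : ℝ × ℝ => GenMode.transit e.1 e.2) '' ((d.Θ k : Set ℝ) ×ˢ (d.Θ k : Set ℝ))).Finite :=
    fun k => ((d.Θ k).finite_toSet.image _).union
      (((d.Θ k).finite_toSet.prod (d.Θ k).finite_toSet).image _)
  refine (Set.Finite.pi hf).subset fun b hb k _ => ?_
  have hbk := hb k
  rcases h : b k with l | ⟨l, m⟩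
  · rw [h] at hbk
    exact Or.inl ⟨l, hbk, rfl⟩
  · rw [h] at hbk
    exact Or.inr ⟨(l, m), hd.allowed_subset k _ hbk, rfl⟩

theorem SystemData.measurableSet_H (d : SystemData nG nL nc) (b : Fin nG → GenMode) :
    MeasurableSet (d.H b) := by
  rw [d.H_eq_pi]
  refine MeasurableSet.univ_pi fun k => ?_
  split
  · exact measurableSet_singleton _
  · exact measurableSet_Ico

/-- The index of the last request is monotone in time, so each of its level sets is an interval. -/
theorem Control.measurableSet_last (v : Control Ω nG) (k : Fin nG) (ω : Ω) (j : WithBot ℕ) :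
    MeasurableSet ((fun s => v.last k s ω) ⁻¹' {j}) := by
  have hm : Monotone fun s => v.last k s ω := fun s u hsu =>
    Finset.max_mono (Finset.monotone_filter_right _ fun i _ hi => ⟨hi.1, hi.2.trans hsu⟩)
  exact (ordConnected_singleton.preimage_mono hm).measurableSet

theorem ExecControl.measurable_mode (v : ExecControl Ω nG) (a : Fin nG → GenMode) (k : Fin nG)
    (ω : Ω) : Measurable fun s => v.mode a s ω k := by
  let F : WithBot ℕ → ℝ → GenMode := fun j s =>
    match j with
    | ⊥ =>
      match a k with
      | .steady l => .steady l
      | .transit l m => if s < v.ϑ₀ k ω then .transit l m else .steady m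
    | (j : ℕ) =>
      if s < v.ϑ j ω then .transit (v.β j ω).src (v.β j ω).dst else .steady (v.β j ω).dst
  refine measurable_of_countable_index (F := F) (v.measurableSet_last k ω) fun j => ?_
  rcases j with _ | j
  · change Measurable fun s => match a k with
      | .steady l => GenMode.steady l
      | .transit l m => if s < v.ϑ₀ k ω then .transit l m else .steady m
    split
    · exact measurable_const
    · exact Measurable.ite measurableSet_Iio measurable_const measurable_const
  · exact Measurable.ite measurableSet_Iio measurable_const measurable_const

theorem ExecControl.measurableSet_mode (v : ExecControl Ω nG) (a b : Fin nG → GenMode) (ω : Ω) :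
    MeasurableSet {s | v.mode a s ω = b} := by
  have : {s | v.mode a s ω = b} = ⋂ k, (fun s => v.mode a s ω k) ⁻¹' {b k} := by
    ext s
    simp [funext_iff]
  rw [this]
  exact MeasurableSet.iInter fun k => v.measurable_mode a k ω trivial

theorem Control.measurable_progress (v : Control Ω nG) (ω : Ω) :
    Measurable fun s => v.progress d t a r s ω := by
  refine measurable_pi_lambda _ fun k => ?_
  let F : WithBot ℕ → ℝ → ℝ := fun j s =>
    match j with
    | ⊥ => if s < t - r k + d.modeDelay k (a k) then s - (t - r k) else 0
    | (j : ℕ) => if s < v.τ j ω + d.delay (v.β j ω) then s - v.τ j ω else 0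
  refine measurable_of_countable_index (F := F) (v.measurableSet_last k ω) fun j => ?_
  rcases j with _ | j
  · exact Measurable.ite measurableSet_Iio (measurable_id.sub_const _) measurable_const
  · exact Measurable.ite measurableSet_Iio (measurable_id.sub_const _) measurable_const

variable {v : Control Ω nG} {ω : Ω} {α : Type*} [MeasurableSpace α]

theorem Control.ValidAt.measurable_comp_mode (hv : v.ValidAt d t a r ω) (hd : d.Valid)
    (ha : a ∈ d.modes) {β : Type*} [MeasurableSpace β] {S : α → ℝ} (hS : Measurable S)
    {F : (Fin nG → GenMode) → α → β} (hF : ∀ b ∈ d.modes, Measurable (F b)) :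
    Measurable fun z => F ((v.withDelays d t a r).mode a (S z) ω) z := by
  have := (d.finite_modes hd).to_subtype
  refine measurable_of_countable_index (ι := d.modes)
    (m := fun z => ⟨(v.withDelays d t a r).mode a (S z) ω, hv.mode_mem hd ha (S z)⟩)
    (F := fun b => F b) (fun b => ?_) fun b => hF b b.2
  convert hS ((v.withDelays d t a r).measurableSet_mode a b ω) using 1
  ext z
  simp [Subtype.ext_iff]

theorem Control.ValidAt.measurable_runCostη₂ {η : Directions nG nL Nη} (hv : v.ValidAt d t a r ω)
    (hd : d.Valid) (hη : η.Valid) (ha : a ∈ d.modes) {Y S : α → ℝ} (hY : Measurable Y)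
    (hS : Measurable S) :
    Measurable fun z => runCostη₂ d η (Y z) ((v.withDelays d t a r).mode a (S z) ω)
      (∑ k, v.progress d t a r (S z) ω k) := by
  refine hv.measurable_comp_mode hd ha hS
    (F := fun b z => runCostη₂ d η (Y z) b (∑ k, v.progress d t a r (S z) ω k)) fun b hb => ?_
  have hp : Measurable fun z => v.progress d t a r (S z) ω := (v.measurable_progress ω).comp hS
  have hsum : Measurable fun z => ∑ k, v.progress d t a r (S z) ω k :=
    Finset.measurable_sum _ fun k _ => measurable_pi_iff.1 hp k
  have hm : Measurable fun p : ℝ × ℝ => runCostη₂ d η p.1 b p.2 :=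
    Dispatch.measurable_runCostη₂ hd hη hb
  have hYs : Measurable fun z => (Y z, ∑ k, v.progress d t a r (S z) ω k) := hY.prodMk hsum
  have hc := hm.comp hYs
  exact hc

theorem Control.ValidAt.measurable_production (hv : v.ValidAt d t a r ω) (hd : d.Valid)
    (ha : a ∈ d.modes) (hr : r ∈ d.H a) {S : α → ℝ} (hS : Measurable S) (hSt : ∀ z, t ≤ S z) :
    Measurable fun z => d.production ((v.withDelays d t a r).mode a (S z) ω)
      (v.progress d t a r (S z) ω) := by
  classical
  -- The production is continuous only on possible progressions. Extending it by zero makes it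
  -- measurable everywhere, and the actual progression is possible at all times from `t` on.
  have h1 : (fun z => d.production ((v.withDelays d t a r).mode a (S z) ω)
      (v.progress d t a r (S z) ω)) = fun z => (d.H ((v.withDelays d t a r).mode a (S z) ω)).piecewise
        (d.production ((v.withDelays d t a r).mode a (S z) ω)) (fun _ => 0)
        (v.progress d t a r (S z) ω) := by
    ext1 z
    exact (piecewise_eq_of_mem _ _ _ (Control.progress_mem hr (hSt z))).symm
  rw [h1]
  refine hv.measurable_comp_mode hd ha hS
    (F := fun b z => (d.H b).piecewise (d.production b) (fun _ => 0)
      (v.progress d t a r (S z) ω)) fun b hb => ?_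
  exact ((hd.continuousOn_production hb).measurable_piecewise continuousOn_const
    (d.measurableSet_H b)).comp ((v.measurable_progress ω).comp hS)

end Modes

end Dispatch

/-! ### Integrable bounds for the costs. -/

namespace Dispatch

theorem measurable_ouPath_real {Ω : Type*} [MeasurableSpace Ω] (γ t s z : ℝ) {U : ℝ → Ω → ℝ}
    (hm : ∀ s, Measurable (U s)) (hc : ∀ ω, Continuous fun s => U s ω) :
    Measurable fun ω => ouPath γ t z (fun u => U u ω) s := by
  have h1 := ouPath_measurable γ t s (fun _ : Fin 1 => z) (fun u ω _ => U u ω)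
    (fun u => measurable_pi_lambda _ fun _ => hm u) fun ω => continuous_pi fun _ => hc ω
  have h2 : (fun ω => ouPath γ t z (fun u => U u ω) s) =
      fun ω => ouPath γ t (fun _ : Fin 1 => z) (fun u _ => U u ω) s 0 := by
    ext ω
    exact ouPath_map (ContinuousLinearMap.proj (R := ℝ) (φ := fun _ : Fin 1 => ℝ) 0) γ t
      (fun _ : Fin 1 => z) (B := fun u _ => U u ω) (continuous_pi fun _ => hc ω) s
  rw [h2]
  exact measurable_pi_iff.1 h1 0

section Bounds

variable {Ω : Type*} [mΩ : MeasurableSpace Ω] {P : Measure Ω} {nG nL nc Nη : ℕ}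
  {d : SystemData nG nL nc} {η : Directions nG nL Nη} (B : BrownianMotion Ω P nL)

theorem continuous_forecastExt (hd : d.Valid) (hT : 0 ≤ d.T) :
    Continuous fun s => d.m (max 0 (min d.T s)) :=
  hd.forecast_smooth.continuousOn.comp_continuous (by fun_prop) fun _ =>
    ⟨le_max_left _ _, max_le hT (min_le_left _ _)⟩

theorem continuous_demandExt (hd : d.Valid) (hT : 0 ≤ d.T) (t : ℝ) (x : Fin nL → ℝ) (ω : Ω) :
    Continuous fun s => demandExt d B t x s ω :=
  (continuous_forecastExt hd hT).add (ouPath_continuous _ _ _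
    ((continuous_const.matrix_mulVec continuous_id).comp (B.continuous_path ω)))

theorem abs_prodCostη_le (hd : d.Valid) (hη : η.Valid) {C : ℝ} (hC : ∀ p ∈ d.DG, |d.CG p| ≤ C)
    {p : Fin nG → ℝ} (hp : p ∈ d.DG) (x : Fin nL → ℝ) :
    |prodCostη d η (η.ηL ⬝ᵥ x) p| ≤ C + d.growth * ‖x‖ := by
  have h1 := prodCostη_le_prodCost hd hη hp x
  have h2 := hd.prodCost_le hp x
  have h3 := CG_le_prodCostη (η := η) hd (η.ηL ⬝ᵥ x) p
  have h4 := abs_le.1 (hC p hp)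
  have h5 : 0 ≤ d.growth * ‖x‖ := mul_nonneg (mul_nonneg
    (Finset.sum_nonneg fun i _ => hd.weight_nonneg i)
    (Finset.sum_nonneg fun j _ => (hd.shedPrice_pos j).le)) (norm_nonneg _)
  exact abs_le.2 ⟨by linarith, by linarith⟩

theorem abs_prodCost_le (hd : d.Valid) {C : ℝ} (hC : ∀ p ∈ d.DG, |d.CG p| ≤ C)
    {p : Fin nG → ℝ} (hp : p ∈ d.DG) (x : Fin nL → ℝ) :
    |d.prodCost x p| ≤ C + d.growth * ‖x‖ := by
  have h2 := hd.prodCost_le hp x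
  have h3 : d.CG p ≤ d.prodCost x p := le_add_of_nonneg_right (Finset.sum_nonneg fun i _ =>
    mul_nonneg (hd.weight_nonneg i) (hd.shedCost_nonneg i p _))
  have h4 := abs_le.1 (hC p hp)
  have h5 : 0 ≤ d.growth * ‖x‖ := mul_nonneg (mul_nonneg
    (Finset.sum_nonneg fun i _ => hd.weight_nonneg i)
    (Finset.sum_nonneg fun j _ => (hd.shedPrice_pos j).le)) (norm_nonneg _)
  exact abs_le.2 ⟨by linarith, by linarith⟩

theorem abs_runCostη₂_le (hd : d.Valid) (hη : η.Valid) {C : ℝ} (hC : ∀ p ∈ d.DG, |d.CG p| ≤ C)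
    {b : Fin nG → GenMode} (hb : b ∈ d.modes) {p : Fin nG → ℝ} (hp : p ∈ d.H b)
    (x : Fin nL → ℝ) :
    |runCostη₂ d η (η.ηL ⬝ᵥ x) b (∑ k, p k)| ≤ C + d.growth * ‖x‖ := by
  have h1 := runCostη₂_le (η := η) hd hb hp (η.ηL ⬝ᵥ x)
  have h2 := abs_le.1 (abs_prodCostη_le hd hη hC (hd.production_mem hb hp) x)
  have h3 := le_runCostη₂ (η := η) hd hC hb hp (η.ηL ⬝ᵥ x)
  have h5 : 0 ≤ d.growth * ‖x‖ := mul_nonneg (mul_nonneg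
    (Finset.sum_nonneg fun i _ => hd.weight_nonneg i)
    (Finset.sum_nonneg fun j _ => (hd.shedPrice_pos j).le)) (norm_nonneg _)
  exact abs_le.2 ⟨by linarith, h1.trans h2.2⟩

theorem integrable_demandBound (hd : d.Valid) {t : ℝ} (ht : t ∈ Icc 0 d.T) (x : Fin nL → ℝ)
    (C : ℝ) : Integrable (fun p : Ω × ℝ => C + d.growth * ‖demandExt d B t x p.2 p.1‖)
      (P.prod (volume.restrict (Ioc t d.T))) := by
  have := B.isProbabilityMeasure
  exact (integrable_const _).add ((integrable_norm_demandExt B hd ht x).swap.const_mul _)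

theorem integrableOn_demandBound (hd : d.Valid) {t : ℝ} (ht : t ∈ Icc 0 d.T) (x : Fin nL → ℝ)
    (C : ℝ) (ω : Ω) :
    IntegrableOn (fun s => C + d.growth * ‖demandExt d B t x s ω‖) (Ioc t d.T) := by
  have hc := continuous_demandExt B hd (ht.1.trans ht.2) t x ω
  exact (Continuous.integrableOn_Icc (a := t) (b := d.T) (by fun_prop)).mono_set Ioc_subset_Icc_self

end Bounds

/-! ### Freezing the part of the noise that the relaxed problem does not observe. -/

section KeyBound

variable {Ω : Type*} [mΩ : MeasurableSpace Ω] {P : Measure Ω} {nG nL nc Nη : ℕ}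
  (d : SystemData nG nL nc) (η : Directions nG nL Nη) (B : BrownianMotion Ω P nL)

/-- The cost in the relaxed problem of a list of requests for a given demand scenario. -/
noncomputable def listCost (t y : ℝ) (a : Fin nG → GenMode) (r : Fin nG → ℝ) (h : ℝ)
    (b₀ : Switch nG) (ω : Ω) (l : validLists d t a r h b₀) : ℝ :=
  (∫ s in t..d.T, runCostη₂ d η (demandη d η B t y s ω)
    (((listControl t h b₀ fun l : validLists d t a r h b₀ => l.1).withDelays d t a r).mode a s l)
    (∑ k, (listControl t h b₀ fun l : validLists d t a r h b₀ => l.1).progress d t a r s l k)) +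
  (listControl t h b₀ fun l : validLists d t a r h b₀ => l.1).switchingCosts d l

variable {d η} {t : ℝ} {a : Fin nG → GenMode} {r : Fin nG → ℝ} {h : ℝ} {b₀ : Switch nG}

/-- Mode, progression and switching costs depend on `ω` only through the list, so the expected cost
is that of a random list in a random scenario. -/
theorem costToGoη_listControl (hd : d.Valid) (hr : r ∈ d.H a) (htT : t ≤ d.T) (y : ℝ)
    (c : Ω → validLists d t a r h b₀) :
    costToGoη d η B t y a (∑ k, r k)
      ((listControl t h b₀ fun ω => (c ω).1).withDelays d t a r) =
    ∫ ω, listCost d η B t y a r h b₀ ω (c ω) ∂P := by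
  unfold costToGoη listCost
  refine integral_congr_ae (ae_of_all _ fun ω => ?_)
  refine congrArg₂ _ (intervalIntegral.integral_congr fun s hs => ?_) rfl
  rw [uIcc_of_le htT] at hs
  rw [(listControl_validAt c ω).total_eq hd hr hs.1]
  rfl

theorem continuous_Wη (ω : Ω) : Continuous fun s => Wη d η B s ω := by
  simp only [Wη_eq]
  exact Continuous.dotProduct continuous_const (B.continuous_path ω)

/-- Stated for an arbitrary measurable space so that it can be applied to `Ω` with the σ-algebra
generated by `Wη` alone. -/
theorem measurable_listCost_of_noise {Ω' : Type*} [MeasurableSpace Ω'] (hd : d.Valid)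
    (hη : η.Valid) (ha : a ∈ d.modes) (ht : t ∈ Icc 0 d.T) (z : ℝ) {W : ℝ → Ω' → ℝ}
    (hWm : ∀ s, Measurable (W s)) (hWc : ∀ ω, Continuous fun s => W s ω)
    (l : validLists d t a r h b₀) :
    Measurable fun ω => ∫ s in t..d.T, runCostη₂ d η
      (η.ηL ⬝ᵥ d.m s + ouPath d.γ t z (fun u => volη d η * W u ω) s)
      (((listControl t h b₀ fun l : validLists d t a r h b₀ => l.1).withDelays d t a r).mode a s l)
      (∑ k, (listControl t h b₀ fun l : validLists d t a r h b₀ => l.1).progress d t a r s l k) := by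
  have hUm : ∀ s, Measurable fun ω => volη d η * W s ω := fun s => (hWm s).const_mul _
  have hUc : ∀ ω, Continuous fun s => volη d η * W s ω := fun ω => continuous_const.mul (hWc ω)
  let Y : ℝ → Ω' → ℝ := fun s ω => η.ηL ⬝ᵥ d.m (max 0 (min d.T s)) +
    ouPath d.γ t z (fun u => volη d η * W u ω) s
  have hYc : ∀ ω, Continuous fun s => Y s ω := fun ω =>
    (Continuous.dotProduct continuous_const (continuous_forecastExt hd (ht.1.trans ht.2))).add
      (ouPath_continuous _ _ _ (hUc ω))
  have hYm : ∀ s, Measurable (Y s) := fun s =>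
    measurable_const.add (measurable_ouPath_real d.γ t s z hUm hUc)
  have hY : Measurable fun p : ℝ × Ω' => Y p.1 p.2 :=
    measurable_uncurry_of_continuous_of_measurable (u := Y) hYc hYm
  have hl : (listControl t h b₀ fun l : validLists d t a r h b₀ => l.1).ValidAt d t a r l :=
    listControl_validAt id l
  have hm := hl.measurable_runCostη₂ (η := η) hd hη ha (hY.comp measurable_swap) measurable_snd
  have heq : ∀ ω, (∫ s in t..d.T, runCostη₂ d η
      (η.ηL ⬝ᵥ d.m s + ouPath d.γ t z (fun u => volη d η * W u ω) s)
      (((listControl t h b₀ fun l : validLists d t a r h b₀ => l.1).withDelays d t a r).mode a s l)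
      (∑ k, (listControl t h b₀ fun l : validLists d t a r h b₀ => l.1).progress d t a r s l k)) =
      ∫ s in Ioc t d.T, runCostη₂ d η (Y s ω)
      (((listControl t h b₀ fun l : validLists d t a r h b₀ => l.1).withDelays d t a r).mode a s l)
      (∑ k, (listControl t h b₀ fun l : validLists d t a r h b₀ => l.1).progress d t a r s l k) := by
    intro ω
    rw [intervalIntegral.integral_of_le ht.2]
    refine setIntegral_congr_fun measurableSet_Ioc fun s hs => ?_
    simp only [Y, min_eq_right hs.2, max_eq_right (ht.1.trans hs.1.le)]
  simp only [heq]
  exact hm.stronglyMeasurable.integral_prod_right.measurable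

theorem measurable_listCost (hd : d.Valid) (hη : η.Valid) (ha : a ∈ d.modes)
    (ht : t ∈ Icc 0 d.T) (y : ℝ) (l : validLists d t a r h b₀) :
    Measurable[MeasurableSpace.comap (fun ω s => Wη d η B s ω) MeasurableSpace.pi]
      fun ω => listCost d η B t y a r h b₀ ω l := by
  have hU : ∀ s, Measurable[MeasurableSpace.comap (fun ω s => Wη d η B s ω) MeasurableSpace.pi]
      (Wη d η B s) := fun s =>
    (measurable_pi_apply s).comp (comap_measurable (fun ω s => Wη d η B s ω))
  exact (@measurable_listCost_of_noise nG nL nc Nη d η t a r h b₀ Ω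
    (MeasurableSpace.comap (fun ω s => Wη d η B s ω) MeasurableSpace.pi) hd hη ha ht _
    (Wη d η B) hU (continuous_Wη B) l).add_const _

theorem abs_listCost_le (hd : d.Valid) (hη : η.Valid) (ha : a ∈ d.modes) (hr : r ∈ d.H a)
    (ht : t ∈ Icc 0 d.T) {C K : ℝ} (hC : ∀ p ∈ d.DG, |d.CG p| ≤ C)
    (hK : ∀ l : validLists d t a r h b₀,
      (listControl t h b₀ fun l : validLists d t a r h b₀ => l.1).switchingCosts d l ≤ K)
    (x : Fin nL → ℝ) (ω : Ω) (l : validLists d t a r h b₀) :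
    |listCost d η B t (η.ηL ⬝ᵥ x) a r h b₀ ω l| ≤
      (∫ s in Ioc t d.T, C + d.growth * ‖demandExt d B t x s ω‖) + K := by
  have hl : (listControl t h b₀ fun l : validLists d t a r h b₀ => l.1).ValidAt d t a r l :=
    listControl_validAt id l
  refine (abs_add_le _ _).trans (add_le_add ?_ ?_)
  · rw [intervalIntegral.integral_of_le ht.2, ← Real.norm_eq_abs]
    refine norm_integral_le_of_norm_le (integrableOn_demandBound B hd ht x C ω) ?_
    filter_upwards [ae_restrict_mem measurableSet_Ioc] with s hs
    rw [demandη_eq B hd hη, demandExt_eq B ⟨ht.1.trans hs.1.le, hs.2⟩]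
    exact abs_runCostη₂_le hd hη hC (hl.mode_mem hd ha s) (Control.progress_mem hr hs.1.le) _
  · rw [abs_of_nonneg (hl.switchingCosts_nonneg hd)]
    exact hK l

/-- Adapted lists of requests, which may depend on the whole Brownian motion, cannot do better
than the relaxed problem. -/
theorem valueη_le_integral_listCost (hd : d.Valid) (hη : η.Valid) (ha : a ∈ d.modes)
    (hr : r ∈ d.H a) (ht : t ∈ Icc 0 d.T) (hh : 0 < h) (x : Fin nL → ℝ)
    {c : Ω → validLists d t a r h b₀}
    (hc : ∀ k : ℕ, Measurable[(pathFiltration d.T nL (t + h * k)).comap B.path]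
      fun ω => truncList k (c ω)) :
    Integrable (fun ω => listCost d η B t (η.ηL ⬝ᵥ x) a r h b₀ ω (c ω)) P ∧
    valueη d η B t (η.ηL ⬝ᵥ x) a (∑ k, r k) ≤
      ((∫ ω, listCost d η B t (η.ηL ⬝ᵥ x) a r h b₀ ω (c ω) ∂P : ℝ) : EReal) := by
  have := B.isProbabilityMeasure
  have := (countable_validLists (t := t) (a := a) (r := r) (h := h) (b₀ := b₀) hd).to_subtype
  set Ψ := listCost d η B t (η.ηL ⬝ᵥ x) a r h b₀ with hΨ
  set e := projDir d η with he
  obtain ⟨C, -, hC⟩ := hd.exists_CG_bound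
  obtain ⟨K, hK⟩ := hd.exists_switchingCosts_bound (Ω := validLists d t a r h b₀) t
  have hΨ_le : ∀ ω l, |Ψ ω l| ≤ (∫ s in Ioc t d.T, C + d.growth * ‖demandExt d B t x s ω‖) + K :=
    abs_listCost_le B hd hη ha hr ht hC (fun l => hK a r _ l (listControl_validAt id l)) x
  have hdom : Integrable
      (fun ω => (∫ s in Ioc t d.T, C + d.growth * ‖demandExt d B t x s ω‖) + K) P :=
    (integrable_demandBound B hd ht x C).integral_prod_left.add (integrable_const _)
  -- The control must make sense on `Wη • e + w` for every `w`, and such a path need not come from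
  -- any `ω`.
  obtain ⟨c', hc'm, hc'⟩ := exists_adapted_extension (𝓖 := fun k : ℕ =>
    (pathFiltration d.T nL (t + h * k) : MeasurableSpace (ℝ → Fin nL → ℝ))) B.path
    (fun i j hij => (pathFiltration d.T nL).mono (by gcongr)) truncList_truncList
    (truncList_horizon hh ht.2) hc
  have hc'M : Measurable c' := by
    have h1 := hc'm ⌊(d.T - t) / h⌋₊
    simp only [truncList_horizon hh ht.2] at h1
    exact h1.mono ((pathFiltration d.T nL).le _) le_rfl
  let U : Ω → ℝ → ℝ := fun ω s => Wη d η B s ω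
  let V : Ω → ℝ → Fin nL → ℝ := fun ω s => B.path ω s - Wη d η B s ω • e
  have hU : Measurable U := measurable_pi_lambda _ fun s => Wη_measurable d η B s
  have hV : Measurable V := measurable_pi_lambda _ fun s =>
    ((measurable_pi_apply s).comp B.measurable_path).sub ((Wη_measurable d η B s).smul_const e)
  have hind : IndepFun U V P := by
    have h1 := B.indepFun_proj e (sum_sq_projDir hd hη)
    simp only [← Wη_eq, he] at h1
    exact h1
  -- For a fixed list the cost is a functional of the observed noise `U`; all dependence on `V`
  -- enters through the choice of the list.
  have hψ : ∀ l, ∃ ψ : (ℝ → ℝ) → ℝ, Measurable ψ ∧ (fun ω => Ψ ω l) = ψ ∘ U := fun l =>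
    (measurable_listCost B hd hη ha ht (η.ηL ⬝ᵥ x) l).exists_eq_measurable_comp
  choose ψ hψm hψU using hψ
  let G : (ℝ → ℝ) × (ℝ → Fin nL → ℝ) → ℝ := fun p => ψ (c' fun s => p.1 s • e + p.2 s) p.1
  have hpath : Measurable fun p : (ℝ → ℝ) × (ℝ → Fin nL → ℝ) => fun s => p.1 s • e + p.2 s := by
    refine measurable_pi_lambda _ fun s => ?_
    exact (((measurable_pi_apply s).comp measurable_fst).smul_const e).add
      ((measurable_pi_apply s).comp measurable_snd)
  have hG : Measurable G := measurable_of_countable_index (m := fun p :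
      (ℝ → ℝ) × (ℝ → Fin nL → ℝ) => c' fun s => p.1 s • e + p.2 s) (F := fun l p => ψ l p.1)
    (fun l => (hc'M.comp hpath) (MeasurableSet.of_discrete (s := {l})))
    fun l => (hψm l).comp measurable_fst
  have hGΨ : ∀ ω w, G (U ω, w) = Ψ ω (c' fun s => Wη d η B s ω • e + w s) := fun ω w =>
    (congrFun (hψU _) ω).symm
  have hGc : ∀ ω, G (U ω, V ω) = Ψ ω (c ω) := by
    intro ω
    rw [hGΨ, ← hc' ω]
    congr 2
    ext s j
    simp [V]
  have hint : Integrable (fun ω => Ψ ω (c ω)) P := by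
    refine hdom.mono' ?_ (ae_of_all _ fun ω => hΨ_le ω (c ω))
    simp only [← hGc]
    exact (hG.comp (hU.prodMk hV)).aestronglyMeasurable
  refine ⟨hint, ?_⟩
  have hprod : P.map (fun ω => (U ω, V ω)) = (P.map U).prod (P.map V) :=
    (indepFun_iff_map_prod_eq_prod_map_map hU.aemeasurable hV.aemeasurable).1 hind
  have hpU : IsProbabilityMeasure (P.map U) := Measure.isProbabilityMeasure_map hU.aemeasurable
  have hpV : IsProbabilityMeasure (P.map V) := Measure.isProbabilityMeasure_map hV.aemeasurable
  have hGint : Integrable G ((P.map U).prod (P.map V)) := by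
    rw [← hprod, integrable_map_measure hG.aestronglyMeasurable (hU.prodMk hV).aemeasurable]
    exact hint.congr (ae_of_all _ fun ω => (hGc ω).symm)
  have hGeq : ∫ ω, Ψ ω (c ω) ∂P = ∫ w, ∫ u, G (u, w) ∂(P.map U) ∂(P.map V) := by
    rw [← integral_prod_symm _ hGint, ← hprod,
      integral_map (hU.prodMk hV).aemeasurable hG.aestronglyMeasurable]
    exact integral_congr_ae (ae_of_all _ fun ω => (hGc ω).symm)
  -- By independence the cost is an average over frozen values `w` of the unobserved noise, so one
  -- of them does at least as well.
  obtain ⟨w, hw⟩ := exists_le_integral (μ := P.map V) hGint.integral_prod_right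
  have hwc : ∀ k : ℕ, Measurable[filtrationη d η B (t + h * k)]
      fun ω => truncList k (c' fun s => Wη d η B s ω • e + w s) := fun k =>
    (hc'm k).comp (measurable_replaceProj B w (t + h * k))
  have hle := iInf₂_le (f := fun (v : ExecControl Ω nG)
    (_ : v.IsAdmissibleη d η B t a (∑ k, r k)) =>
      (costToGoη d η B t (η.ηL ⬝ᵥ x) a (∑ k, r k) v : EReal)) _
    (listControl_isAdmissibleη hd hr hh hwc)
  refine hle.trans ?_
  rw [EReal.coe_le_coe_iff, costToGoη_listControl B hd hr ht.2, hGeq]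
  refine le_trans (le_of_eq ?_) hw
  have hGw : Measurable fun u => G (u, w) := hG.comp (measurable_id.prodMk measurable_const)
  rw [integral_map hU.aemeasurable hGw.aestronglyMeasurable]
  exact integral_congr_ae (ae_of_all _ fun ω => (hGΨ ω w).symm)

end KeyBound

end Dispatch

/-! ### Passage to the limit of vanishing mesh. -/

namespace Dispatch

section ListProduction

variable {nG nL nc : ℕ} (d : SystemData nG nL nc)

/-- The production under a list of requests. -/
noncomputable def listProduction (t : ℝ) (a : Fin nG → GenMode) (r : Fin nG → ℝ) (h : ℝ)
    (b₀ : Switch nG) (l : validLists d t a r h b₀) (s : ℝ) : Fin nG → ℝ :=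
  d.production
    (((listControl t h b₀ fun l : validLists d t a r h b₀ => l.1).withDelays d t a r).mode a
      (max t s) l)
    ((listControl t h b₀ fun l : validLists d t a r h b₀ => l.1).progress d t a r (max t s) l)

variable {d} {t : ℝ} {a : Fin nG → GenMode} {r : Fin nG → ℝ} {h : ℝ} {b₀ : Switch nG}

/-- Replacing `s` by `max t s` makes this true at every real time, not only from `t` on. -/
theorem listProduction_mem (hd : d.Valid) (ha : a ∈ d.modes) (hr : r ∈ d.H a)
    (l : validLists d t a r h b₀) (s : ℝ) : listProduction d t a r h b₀ l s ∈ d.DG :=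
  hd.production_mem (Control.ValidAt.mode_mem (listControl_validAt id l) hd ha _)
    (Control.progress_mem hr (le_max_left _ _))

theorem measurable_listProduction (hd : d.Valid) (ha : a ∈ d.modes) (hr : r ∈ d.H a)
    (l : validLists d t a r h b₀) : Measurable (listProduction d t a r h b₀ l) :=
  Control.ValidAt.measurable_production (listControl_validAt id l) hd ha hr
    (S := fun s : ℝ => max t s) (by fun_prop) fun _ => le_max_left _ _

end ListProduction

section Limit

variable {Ω : Type*} [mΩ : MeasurableSpace Ω] {P : Measure Ω} {nG nL nc Nη : ℕ}
  {d : SystemData nG nL nc} {η : Directions nG nL Nη} (B : BrownianMotion Ω P nL)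
  {t : ℝ} {a : Fin nG → GenMode} {r : Fin nG → ℝ} {h : ℝ} {b₀ : Switch nG}

/-- The slice infimum is given up for the cost of the actual production, which passes to the limit
by continuity. -/
theorem listCost_le (hd : d.Valid) (hη : η.Valid) (ha : a ∈ d.modes) (hr : r ∈ d.H a)
    (ht : t ∈ Icc 0 d.T) (x : Fin nL → ℝ) (ω : Ω) (l : validLists d t a r h b₀) :
    listCost d η B t (η.ηL ⬝ᵥ x) a r h b₀ ω l ≤
      (∫ s in Ioc t d.T, prodCostη d η (η.ηL ⬝ᵥ demandExt d B t x s ω)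
        (listProduction d t a r h b₀ l s)) +
      (listControl t h b₀ fun l : validLists d t a r h b₀ => l.1).switchingCosts d l := by
  have hl : (listControl t h b₀ fun l : validLists d t a r h b₀ => l.1).ValidAt d t a r l :=
    listControl_validAt id l
  obtain ⟨C, -, hC⟩ := hd.exists_CG_bound
  have hY : Measurable fun s => η.ηL ⬝ᵥ demandExt d B t x s ω :=
    (Continuous.dotProduct continuous_const
      (continuous_demandExt B hd (ht.1.trans ht.2) t x ω)).measurable
  have hbound := integrableOn_demandBound B hd ht x C ω
  unfold listCost
  refine add_le_add_left ?_ _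
  rw [intervalIntegral.integral_of_le ht.2]
  have h1 : ∫ s in Ioc t d.T, runCostη₂ d η (demandη d η B t (η.ηL ⬝ᵥ x) s ω)
      (((listControl t h b₀ fun l : validLists d t a r h b₀ => l.1).withDelays d t a r).mode a s l)
      (∑ k, (listControl t h b₀ fun l : validLists d t a r h b₀ => l.1).progress d t a r s l k) =
      ∫ s in Ioc t d.T, runCostη₂ d η (η.ηL ⬝ᵥ demandExt d B t x s ω)
      (((listControl t h b₀ fun l : validLists d t a r h b₀ => l.1).withDelays d t a r).mode a s l)
      (∑ k, (listControl t h b₀ fun l : validLists d t a r h b₀ => l.1).progress d t a r s l k) := by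
    refine setIntegral_congr_fun measurableSet_Ioc fun s hs => ?_
    simp only [demandη_eq B hd hη, demandExt_eq B ⟨ht.1.trans hs.1.le, hs.2⟩]
  rw [h1]
  refine setIntegral_mono_on (hbound.mono' ?_ ?_) (hbound.mono' ?_ ?_) measurableSet_Ioc
    fun s hs => ?_
  · exact (hl.measurable_runCostη₂ hd hη ha hY measurable_id).aestronglyMeasurable
  · filter_upwards [ae_restrict_mem measurableSet_Ioc] with s hs
    exact abs_runCostη₂_le hd hη hC (hl.mode_mem hd ha s) (Control.progress_mem hr hs.1.le) _
  · exact (measurable_prodCostη hd hη hY (measurable_listProduction hd ha hr l)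
      fun s => listProduction_mem hd ha hr l s).aestronglyMeasurable
  · exact ae_of_all _ fun s => abs_prodCostη_le hd hη hC (listProduction_mem hd ha hr l s) _
  · have h2 := runCostη₂_le (η := η) hd (hl.mode_mem hd ha s)
      (Control.progress_mem hr hs.1.le) (η.ηL ⬝ᵥ demandExt d B t x s ω)
    rw [listProduction, max_eq_right hs.1.le]
    exact h2

theorem tendsto_prodCostη (hd : d.Valid) (hη : η.Valid) (y : ℝ) {p : ℕ → Fin nG → ℝ}
    {q : Fin nG → ℝ} (hp : ∀ n, p n ∈ d.DG) (hq : q ∈ d.DG) (h : Tendsto p atTop (𝓝 q)) :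
    Tendsto (fun n => prodCostη d η y (p n)) atTop (𝓝 (prodCostη d η y q)) := by
  have h1 : Tendsto (fun u : ℝ × (Fin nG → ℝ) => prodCostη d η u.1 u.2)
      (𝓝[univ ×ˢ d.DG] (y, q)) (𝓝 (prodCostη d η y q)) :=
    continuousOn_prodCostη hd hη (y, q) ⟨trivial, hq⟩
  have h2 : Tendsto (fun n => (y, p n)) atTop (𝓝[univ ×ˢ d.DG] (y, q)) :=
    tendsto_nhdsWithin_iff.2 ⟨tendsto_const_nhds.prodMk_nhds h,
      Eventually.of_forall fun n => ⟨trivial, hp n⟩⟩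
  exact h1.comp h2

variable {v : Control Ω nG}

theorem valueη_le_costToGo (hd : d.Valid) (hη : η.Valid) (ha : a ∈ d.modes) (hr : r ∈ d.H a)
    (ht : t ∈ Icc 0 d.T) (x : Fin nL → ℝ) (hv : v ∈ admissible d B t a r) :
    valueη d η B t (η.ηL ⬝ᵥ x) a (∑ k, r k) ≤ (costToGo d B t x a r v : EReal) := by
  have := B.isProbabilityMeasure
  have hv' : v.IsAdmissible d (demandFiltration d B) ((v.withDelays d t a r).mode a) t := hv
  have hT : 0 ≤ d.T := ht.1.trans ht.2
  let b₀ : Switch nG := ⟨⟨0, hd.nG_pos⟩, 0, 0⟩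
  let hn : ℕ → ℝ := fun n => 1 / ((n : ℝ) + 1)
  have hpos : ∀ n, 0 < hn n := fun n => Nat.one_div_pos_of_nat
  have hlim : Tendsto hn atTop (𝓝 0) := tendsto_one_div_add_atTop_nhds_zero_nat
  let c : ∀ n, Ω → validLists d t a r (hn n) b₀ := fun n ω =>
    ⟨discList d.T t (hn n) v ω, (hv'.validAt ω).discList_mem (hpos n) ht.2⟩
  have hc : ∀ n (k : ℕ), Measurable[demandFiltration d B (t + hn n * k)]
      fun ω => truncList k (c n ω) := fun n k => hv'.measurable_truncList hd (hpos n) ht.2 k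
  have hcM : ∀ n, Measurable (c n) := by
    intro n
    have h1 := hc n ⌊(d.T - t) / hn n⌋₊
    simp only [truncList_horizon (hpos n) ht.2] at h1
    exact h1.mono ((demandFiltration d B).le _) le_rfl
  have hkey := fun n => valueη_le_integral_listCost B hd hη ha hr ht (hpos n) x (c := c n)
    fun k => (hc n k).mono (demandFiltration_le B _) le_rfl
  obtain ⟨C, -, hC⟩ := hd.exists_CG_bound
  obtain ⟨K, hK⟩ := hd.exists_switchingCosts_bound (Ω := Ω) t
  let μ : Measure (Ω × ℝ) := P.prod (volume.restrict (Ioc t d.T))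
  let X : Ω × ℝ → Fin nL → ℝ := fun z => demandExt d B t x z.2 z.1
  have hX : Measurable X := (measurable_demandExt B hd hT t x).comp measurable_swap
  have hY : Measurable fun z => η.ηL ⬝ᵥ X z := by
    unfold dotProduct
    exact Finset.measurable_sum _ fun j _ => (measurable_pi_iff.1 hX j).const_mul _
  have hbound : Integrable (fun z => C + d.growth * ‖X z‖) μ :=
    integrable_demandBound B hd ht x C
  let p : ℕ → Ω × ℝ → Fin nG → ℝ := fun n z => listProduction d t a r (hn n) b₀ (c n z.1) z.2
  have hpD : ∀ n z, p n z ∈ d.DG := fun n z => listProduction_mem hd ha hr _ _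
  have hpM : ∀ n, Measurable (p n) := by
    intro n
    have := (countable_validLists (t := t) (a := a) (r := r) (h := hn n) (b₀ := b₀) hd).to_subtype
    exact measurable_of_countable_index (m := fun z : Ω × ℝ => c n z.1)
      (F := fun l z => listProduction d t a r (hn n) b₀ l z.2)
      (fun l => (hcM n).comp measurable_fst (MeasurableSet.of_discrete (s := {l})))
      fun l => (measurable_listProduction hd ha hr l).comp measurable_snd
  -- The exceptional times are the finitely many request times, a null set for each `ω`.
  have hptend : ∀ ω, ∀ᵐ s ∂(volume.restrict (Ioc t d.T)), Tendsto (fun n => p n (ω, s)) atTop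
      (𝓝 (d.production ((v.withDelays d t a r).mode a s ω) (v.progress d t a r s ω))) := by
    intro ω
    have hcount : ((fun j => v.τ j ω) '' Iio (v.N ω)).Countable := ((finite_Iio _).image _).countable
    filter_upwards [ae_restrict_mem measurableSet_Ioc,
      ae_restrict_of_ae (hcount.ae_notMem volume)] with s hs hne
    have h1 := (hv'.validAt ω).tendsto_production (b₀ := b₀) hd hpos hlim (Ioc_subset_Icc_self hs)
      fun j hj he => hne ⟨j, hj, he⟩
    refine h1.congr fun n => ?_
    simp only [p, listProduction, max_eq_right hs.1.le]
    rfl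
  have hex : ∀ᵐ z ∂μ, ∃ q, Tendsto (fun n => p n z) atTop (𝓝 q) :=
    (Measure.ae_prod_iff_ae_ae (measurableSet_exists_tendsto hpM)).2
      (ae_of_all _ fun ω => (hptend ω).mono fun s hs => ⟨_, hs⟩)
  -- Joint measurability of the production under `v` is obtained only through the approximations:
  -- their almost everywhere limit has a measurable version.
  obtain ⟨q₀, hq₀M, hq₀⟩ := measurable_limit_of_tendsto_metrizable_ae
    (fun n => (hpM n).aemeasurable) hex
  classical
  -- The version is corrected so as to lie in the box everywhere; since the box is closed, this
  -- changes it only on a null set.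
  let q : Ω × ℝ → Fin nG → ℝ := fun z => if q₀ z ∈ d.DG then q₀ z else p 0 z
  have hDGc : IsClosed d.DG := hd.isCompact_DG.isClosed
  have hqM : Measurable q := Measurable.ite (hq₀M hDGc.measurableSet) hq₀M (hpM 0)
  have hqD : ∀ z, q z ∈ d.DG := by
    intro z
    simp only [q]
    split_ifs with hz
    · exact hz
    · exact hpD 0 z
  have hq : ∀ᵐ z ∂μ, Tendsto (fun n => p n z) atTop (𝓝 (q z)) := by
    filter_upwards [hq₀] with z hz
    have : q₀ z ∈ d.DG := hDGc.mem_of_tendsto hz (Eventually.of_forall fun n => hpD n z)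
    simpa only [q, if_pos this] using hz
  have hcostM : ∀ n, Measurable fun z => prodCostη d η (η.ηL ⬝ᵥ X z) (p n z) := fun n =>
    measurable_prodCostη hd hη hY (hpM n) (hpD n)
  have hA : Tendsto (fun n => ∫ z, prodCostη d η (η.ηL ⬝ᵥ X z) (p n z) ∂μ) atTop
      (𝓝 (∫ z, prodCostη d η (η.ηL ⬝ᵥ X z) (q z) ∂μ)) := by
    refine tendsto_integral_of_dominated_convergence (fun z => C + d.growth * ‖X z‖)
      (fun n => (hcostM n).aestronglyMeasurable) hbound
      (fun n => ae_of_all _ fun z => abs_prodCostη_le hd hη hC (hpD n z) _) ?_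
    filter_upwards [hq] with z hz
    exact tendsto_prodCostη hd hη _ (fun n => hpD n z) (hqD z) hz
  have hswM := hv'.measurable_switchingCosts hd
  have hsw : Integrable (v.switchingCosts d) P := by
    refine (integrable_const K).mono' hswM.aestronglyMeasurable (ae_of_all _ fun ω => ?_)
    rw [Real.norm_of_nonneg ((hv'.validAt ω).switchingCosts_nonneg hd)]
    exact hK a r v ω (hv'.validAt ω)
  have hupper : ∀ n, ∫ ω, listCost d η B t (η.ηL ⬝ᵥ x) a r (hn n) b₀ ω (c n ω) ∂P ≤
      (∫ z, prodCostη d η (η.ηL ⬝ᵥ X z) (p n z) ∂μ) + ∫ ω, v.switchingCosts d ω ∂P := by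
    intro n
    have hint : Integrable (fun z => prodCostη d η (η.ηL ⬝ᵥ X z) (p n z)) μ :=
      hbound.mono' (hcostM n).aestronglyMeasurable
        (ae_of_all _ fun z => abs_prodCostη_le hd hη hC (hpD n z) _)
    rw [integral_prod _ hint, ← integral_add hint.integral_prod_left hsw]
    refine integral_mono (hkey n).1 (hint.integral_prod_left.add hsw) fun ω => ?_
    refine (listCost_le B hd hη ha hr ht x ω (c n ω)).trans (add_le_add_right ?_ _)
    exact (hv'.validAt ω).switchingCosts_discList_le hd (hpos n) ht.2
  have hqint : Integrable (fun z => d.prodCost (X z) (q z)) μ :=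
    hbound.mono' (hd.measurable_prodCost hX hqM hqD).aestronglyMeasurable
      (ae_of_all _ fun z => abs_prodCost_le hd hC (hqD z) _)
  have hlower : (∫ z, prodCostη d η (η.ηL ⬝ᵥ X z) (q z) ∂μ) + ∫ ω, v.switchingCosts d ω ∂P ≤
      costToGo d B t x a r v := by
    have h1 : ∫ z, prodCostη d η (η.ηL ⬝ᵥ X z) (q z) ∂μ ≤ ∫ z, d.prodCost (X z) (q z) ∂μ := by
      refine integral_mono (hbound.mono' (measurable_prodCostη hd hη hY hqM hqD).aestronglyMeasurable
        (ae_of_all _ fun z => abs_prodCostη_le hd hη hC (hqD z) _)) hqint fun z => ?_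
      exact prodCostη_le_prodCost hd hη (hqD z) _
    refine (add_le_add_left h1 _).trans (le_of_eq ?_)
    rw [integral_prod _ hqint, ← integral_add hqint.integral_prod_left hsw, costToGo]
    refine integral_congr_ae ?_
    filter_upwards [Measure.ae_ae_of_ae_prod hq] with ω hω
    refine congrArg (· + v.switchingCosts d ω) ?_
    rw [intervalIntegral.integral_of_le ht.2]
    refine integral_congr_ae ?_
    filter_upwards [hω, hptend ω, ae_restrict_mem measurableSet_Ioc] with s hs1 hs2 hs3
    -- Uniqueness of limits identifies `q` with the production under `v`, for almost every `ω` and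
    -- almost every time.
    have hqs := tendsto_nhds_unique hs1 hs2
    simp only [X, hqs, demandExt_eq B ⟨ht.1.trans hs3.1.le, hs3.2⟩]
    rfl
  refine le_trans ?_ (EReal.coe_le_coe_iff.2 hlower)
  refine ge_of_tendsto' (EReal.tendsto_coe.2 (hA.add_const _)) fun n => ?_
  exact (hkey n).2.trans (EReal.coe_le_coe_iff.2 (hupper n))

end Limit

end Dispatch

theorem mainTheorem3 {nG nL nc Nη : ℕ}
    (d : Dispatch.SystemData nG nL nc) (hd : d.Valid)
    (η : Dispatch.Directions nG nL Nη) (hη : η.Valid)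
    {Ω : Type*} [MeasurableSpace Ω] (P : MeasureTheory.Measure Ω)
    [MeasureTheory.IsProbabilityMeasure P]
    (B : Dispatch.BrownianMotion Ω P nL)
    (t : ℝ) (ht : t ∈ Set.Icc 0 d.T) (x : Fin nL → ℝ)
    (a : Fin nG → Dispatch.GenMode) (ha : a ∈ d.modes)
    (r : Fin nG → ℝ) (hr : r ∈ d.H a) :
    Dispatch.valueη d η B t (η.ηL ⬝ᵥ x) a (∑ k, r k) ≤ Dispatch.value d B t x a r :=
  le_iInf₂ fun _ hv => Dispatch.valueη_le_costToGo B hd hη ha hr ht x hv
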